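/- Let $\xi:[-1,1]\to\mathbb{R}$ be three times continuously differentiable. For $N\ge 1$ let $S_N$ be the sphere of radius $\sqrt N$ centred at $0$ in $\mathbb{R}^N$, $\lambda_N$ the uniform probability measure on $S_N$, and $R(\vec\sigma,\vec\tau)=N^{-1}\sum_{i\le N}\sigma_i\tau_i$. For $N\ge 2$ let $H_N$ and $H_{N-1}$ be (jointly measurable) centred Gaussian processes indexed by $S_N$ and $S_{N-1}$, with covariances $$\mathbb{E}H_N(\vec\sigma)H_N(\vec\tau)=N\xi(R(\vec\sigma,\vec\tau)),\qquad \mathbb{E}H_{N-1}(\vec\sigma)H_{N-1}(\vec\tau)=(N-1)\xi(R(\vec\sigma,\vec\tau)),$$ and let $z$ be a standard Gaussian random variable, with $H_N,H_{N-1},z$ independent. Let $\beta>0$, $h\in\mathbb{R}\setminus\{0\}$, and let $q\in[0,1)$ be a solution of $$h^2+\beta^2\xi'(q)=\frac{q}{(1-q)^2}.$$ (The solution is unique when $\beta$ is small.) Put $b=h^2(1-q)+\beta^2(1-q)\xi'(q)$. For $\vec\sigma\in S_N$ write $\varepsilon=\sigma_N$ and $\hat\sigma_i=\sigma_i\big/\sqrt{(N-\varepsilon^2)/(N-1)}$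 for $i\le N-1$, so that $\hat{\vec\sigma}\in S_{N-1}$ for $\lambda_N$-almost all $\vec\sigma$, and for $t\in[0,1]$ define $$H_t(\vec\sigma)=\sqrt t\,\beta H_N(\vec\sigma)+\sqrt{1-t}\,\beta H_{N-1}(\hat{\vec\sigma})+h\sum_{i\le N-1}\hat\sigma_i\Bigl(1+t\Bigl(\sqrt{\tfrac{N-\varepsilon^2}{N-1}}-1\Bigr)\Bigr)+h\varepsilon+\sqrt{1-t}\,\varepsilon z\beta\sqrt{\xi'(q)}-\tfrac12(1-t)\varepsilon^2 b .$$ Here $\sqrt x$ is read as $0$ if $x<0$ (if Hamiltonians with the covariances above exist for every $N$, then $\xi'(q)\ge 0$). Let $Z_t=\int_{S_N}e^{H_t}\,d\lambda_N$, $\langle f\rangle_t=Z_t^{-1}\int_{S_N}f e^{H_t}\,d\lambda_N$ and $\nu_t(f)=\mathbb{E}\langle f\rangle_t$. Theorem. There are $\beta_0,h_0>0$, depending only on $\xi$, such that for all $0<\beta<\beta_0$ and $0<|h|<h_0$ and $q$ as above there is a constant $L>0$, independent of $N\ge 2$ and of $t$, with $$\nu_t\Bigl(\exp\frac{\varepsilon^2}{L}\Bigr)\le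 L\qquad\text{for all } t\in[0,1].$$ In particular, $Z_t<\infty$ almost surely and $\langle\exp(\varepsilon^2/L)\rangle_t$ is integrable. -/

import Mathlib

open MeasureTheory ProbabilityTheory

noncomputable section

namespace SphericalSK

/-- The configuration space `S_N`: the sphere of radius `√N` in `ℝ^N`. -/
abbrev Config (N : ℕ) : Type :=
  Metric.sphere (0 : EuclideanSpace ℝ (Fin N)) (Real.sqrt N)

/-- The dilation by `√N` of the unit sphere of `ℝ^N` onto `S_N`. -/
def dilate (N : ℕ) (x : Metric.sphere (0 : EuclideanSpace ℝ (Fin N)) 1) : Config N :=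
  ⟨Real.sqrt N • (x : EuclideanSpace ℝ (Fin N)), by
    have hx : ‖(x : EuclideanSpace ℝ (Fin N))‖ = 1 := by simp
    rw [mem_sphere_zero_iff_norm, norm_smul, hx, mul_one, Real.norm_eq_abs,
      abs_of_nonneg (Real.sqrt_nonneg _)]⟩

/-- The uniform probability measure `λ_N` on `S_N`: the normalized surface measure of the unit
sphere, transported by dilation. -/
def unif (N : ℕ) : Measure (Config N) :=
  Measure.map (dilate N)
    (((volume : Measure (EuclideanSpace ℝ (Fin N))).toSphere Set.univ)⁻¹ •
      (volume : Measure (EuclideanSpace ℝ (Fin N))).toSphere)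

/-- The overlap `R_{1,2} = N⁻¹ ∑ σ¹_i σ²_i`. -/
def overlap {N : ℕ} (σ τ : Config N) : ℝ :=
  (N : ℝ)⁻¹ * ∑ i, σ.1 i * τ.1 i

/-- `H` is a (jointly measurable) centred Gaussian process on `S_N` with covariance
`E H(σ) H(τ) = N ξ(R(σ, τ))`. -/
structure IsHamiltonian {Ω : Type*} [MeasurableSpace Ω] (P : Measure Ω) (ξ : ℝ → ℝ) (N : ℕ)
    (H : Config N → Ω → ℝ) : Prop where
  measurable : Measurable (fun p : Config N × Ω => H p.1 p.2)
  gaussian : IsGaussianProcess H P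
  centred : ∀ σ, ∫ ω, H σ ω ∂P = 0
  covariance : ∀ σ τ, ∫ ω, H σ ω * H τ ω ∂P = N * ξ (overlap σ τ)

/-! From here on the number of spins is `N = M + 1`, so that `N - 1 = M`. -/

/-- The last spin `ε = σ_N`. -/
def lastSpin {M : ℕ} (σ : Config (M + 1)) : ℝ := σ.1 (Fin.last M)

/-- The factor `√((N - ε²) / (N - 1))`. -/
def scale {M : ℕ} (σ : Config (M + 1)) : ℝ :=
  Real.sqrt ((((M + 1 : ℕ) : ℝ) - lastSpin σ ^ 2) / M)

/-- The rescaled vector `σ̂ = (σ_1, …, σ_{N-1}) / √((N - ε²) / (N - 1))`. It lies in `S_{N-1}`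
except at the two poles `ε² = N`, which are negligible for the uniform measure. -/
def hatVec {M : ℕ} (σ : Config (M + 1)) : EuclideanSpace ℝ (Fin M) :=
  WithLp.toLp 2 (fun i : Fin M => σ.1 i.castSucc / scale σ)

open Classical in
/-- A function on `S_{N-1}` evaluated at `σ̂` (with value `0` at the two poles). -/
def atHat {M : ℕ} (f : Config M → ℝ) (σ : Config (M + 1)) : ℝ :=
  if hσ : hatVec σ ∈ Metric.sphere (0 : EuclideanSpace ℝ (Fin M)) (Real.sqrt M)
  then f ⟨hatVec σ, hσ⟩ else 0

/-- The constant `b = h²(1 - q) + β²(1 - q) ξ'(q)`. -/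
def bConst (ξ : ℝ → ℝ) (β h q : ℝ) : ℝ :=
  h ^ 2 * (1 - q) + β ^ 2 * (1 - q) * deriv ξ q

/-- The interpolating Hamiltonian `H_t(σ)`, for given realizations `HN` of `H_N`, `HN'` of
`H_{N-1}` and `z` of the Gaussian variable. -/
def interpH (ξ : ℝ → ℝ) (β h q : ℝ) {M : ℕ} (HN : Config (M + 1) → ℝ) (HN' : Config M → ℝ)
    (z t : ℝ) (σ : Config (M + 1)) : ℝ :=
  Real.sqrt t * β * HN σ + Real.sqrt (1 - t) * β * atHat HN' σ
    + h * (∑ i, hatVec σ i) * (1 + t * (scale σ - 1))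
    + h * lastSpin σ
    + Real.sqrt (1 - t) * lastSpin σ * z * β * Real.sqrt (deriv ξ q)
    - 1 / 2 * (1 - t) * lastSpin σ ^ 2 * bConst ξ β h q

/-- The Gibbs average of `f : S_N → ℝ` for the energy `E : S_N → ℝ`:
`⟨f⟩ = Z⁻¹ ∫ f exp E dλ_N`, with `Z = ∫ exp E dλ_N`. -/
def gibbs {N : ℕ} (E f : Config N → ℝ) : ℝ :=
  (∫ σ, f σ * Real.exp (E σ) ∂(unif N)) / ∫ σ, Real.exp (E σ) ∂(unif N)

end SphericalSK

end

/-! The proof is a Gaussian interpolation in which the exponent decreases with `t`. Put φ(t) =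
ν_t(exp((a - κt)ε²)). Differentiating in `t` and integrating by parts in the disorder replaces the
Gaussian terms by the difference U(σ,τ) of the covariances of the families at the two ends, namely
β²Nξ(R) at `t = 1` and β²((N-1)ξ(R̂) + εε'√(ξ'(q))²) at `t = 0`, with R̂ the overlap of the rescaled
vectors. NR differs from (N-1)R̂ by at most a multiple of 1 + ε² + ε'², and ξ is Lipschitz, so |U| ≤
2Kβ²(1 + ε² + ε'²) uniformly in N (`abs_covariance_sub_le`). The deterministic drift is likewise at
most (|h| + b)(1 + ε²) (`abs_drift_le`).

These bounds produce terms of the form ⟨ε² exp(sε²)⟩ and ⟨ε²⟩⟨exp(sε²)⟩. The second is at most the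
first by Chebyshev's association inequality, and the first is cancelled by the derivative -κ⟨ε²
exp(sε²)⟩ of the moving exponent (`interpolation_pointwise_bound`). What remains is φ' ≤ κφ, hence
φ(t) ≤ e^κ φ(0). Small β and h make κ small, so that a - κt stays bounded below.

At `t = 0` the energy is a function of σ̂ plus a function of ε. These are independent under the
uniform measure (`indepFun_hatVec_lastSpin`), so the part in σ̂ cancels from the Gibbs average. The
remaining denominator is bounded below uniformly in `z`, by symmetry of ε and Jensen's inequality,
and the numerator is bounded by integrating over `z` and comparing ε with a Gaussian variable
(`lintegral_exp_sq_lastSpin`).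

Differentiation and integration by parts are carried out only for Gibbs averages over finitely many
configurations, where the disorder is a finite Gaussian vector (`integral_avg_interp_le`). The
constants do not depend on the finite set, and the strong law of large numbers for i.i.d. uniform
configurations transfers the inequality to the sphere (`integral_gibbsAvg_le_of_avg`). -/

namespace SphericalSK

/-! ### Gaussian integration by parts. -/

/-- Gaussian integration by parts on the line. -/
theorem integral_mul_gaussianReal {v : NNReal} {g g' : ℝ → ℝ} {C : ℝ}
    (hg : ∀ x, HasDerivAt g (g' x) x) (hgC : ∀ x, |g x| ≤ C) (hg'C : ∀ x, |g' x| ≤ C) :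
    ∫ x, x * g x ∂gaussianReal 0 v = v * ∫ x, g' x ∂gaussianReal 0 v := by
  rcases eq_or_ne v 0 with rfl | hv
  · simp
  have hv' : (v : ℝ) ≠ 0 := by exact_mod_cast hv
  set p := gaussianPDFReal 0 v with hp
  have hgm : Measurable g := (continuous_iff_continuousAt.2 fun x => (hg x).continuousAt).measurable
  have hg'm : Measurable g' := by
    have : g' = deriv g := by ext x; exact (hg x).deriv.symm
    rw [this]; exact measurable_deriv g
  have hpd : ∀ x, HasDerivAt p (-(x / v) * p x) x := by
    intro x
    have h1 : HasDerivAt (fun x : ℝ => -(x - 0) ^ 2 / (2 * v)) (-(x / v)) x := by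
      have := (((hasDerivAt_id x).sub_const 0).pow 2).neg.div_const (2 * (v : ℝ))
      refine HasDerivAt.congr_deriv (f := fun x : ℝ => -(x - 0) ^ 2 / (2 * v)) this ?_
      simp only [id, Nat.cast_ofNat, Nat.add_one_sub_one, pow_one]
      field_simp
      ring
    have h2 := (h1.exp).const_mul (Real.sqrt (2 * Real.pi * v))⁻¹
    refine HasDerivAt.congr_deriv (f := p) h2 ?_
    simp only [hp, gaussianPDFReal]; ring
  have hpint : Integrable p := integrable_gaussianPDFReal 0 v
  have hxp : Integrable (fun x : ℝ => x * p x) := by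
    have h : Integrable (id : ℝ → ℝ) (gaussianReal 0 v) :=
      (memLp_id_gaussianReal (μ := 0) (v := v) 1).integrable (by simp)
    rw [gaussianReal_of_var_ne_zero _ hv,
      integrable_withDensity_iff_integrable_smul' (measurable_gaussianPDF 0 v)
        (Filter.Eventually.of_forall fun x => gaussianPDF_lt_top)] at h
    refine h.congr (Filter.Eventually.of_forall fun x => ?_)
    simp [hp, toReal_gaussianPDF, mul_comm]
  have key := integral_mul_deriv_eq_deriv_mul_of_integrable
    (u := g) (u' := g') (v := p) (v' := fun x => -(x / v) * p x)
    (fun x _ => hg x) (fun x _ => hpd x) ?_ ?_ ?_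
  · rw [integral_gaussianReal_eq_integral_smul hv, integral_gaussianReal_eq_integral_smul hv]
    simp only [smul_eq_mul, ← hp]
    have e1 : ∫ x, p x * (x * g x) = -(v : ℝ) * ∫ x, g x * (-(x / v) * p x) := by
      rw [← integral_const_mul]
      congr 1; ext x; field_simp
    rw [e1, key]
    have e2 : ∫ x, g' x * p x = ∫ x, p x * g' x := by congr 1; ext x; ring
    rw [e2]; ring
  · have : (g * fun x => -(x / v) * p x) = fun x => g x * (-(v : ℝ)⁻¹ * (x * p x)) := by
      ext x; simp only [Pi.mul_apply]; field_simp
    rw [this]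
    exact (hxp.const_mul _).bdd_mul hgm.aestronglyMeasurable
      (Filter.Eventually.of_forall fun x => by simpa using hgC x)
  · exact hpint.bdd_mul hg'm.aestronglyMeasurable
      (Filter.Eventually.of_forall fun x => by simpa using hg'C x)
  · exact hpint.bdd_mul hgm.aestronglyMeasurable
      (Filter.Eventually.of_forall fun x => by simpa using hgC x)

/-- Gaussian integration by parts for a jointly Gaussian family. -/
theorem integral_mul_of_hasGaussianLaw {Ω ι : Type*} [Fintype ι] [mΩ : MeasurableSpace Ω]
    {P : Measure Ω} {X : Ω → ℝ} {V : Ω → ι → ℝ}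
    (hXV : HasGaussianLaw (fun ω => (X ω, V ω)) P) (hX : ∫ ω, X ω ∂P = 0)
    {G : (ι → ℝ) → ℝ} {D : ι → (ι → ℝ) → ℝ} {C : ℝ}
    (hG : ∀ v, HasFDerivAt G (∑ j, D j v • ContinuousLinearMap.proj (R := ℝ) (φ := fun _ : ι => ℝ) j) v)
    (hD : ∀ j, Continuous (D j)) (hGC : ∀ v, |G v| ≤ C) (hDC : ∀ j v, |D j v| ≤ C) :
    ∫ ω, X ω * G (V ω) ∂P = ∑ j, (∫ ω, X ω * V ω j ∂P) * ∫ ω, D j (V ω) ∂P := by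
  have : IsProbabilityMeasure P := hXV.isProbabilityMeasure
  have hXG := hXV.fst
  have hVG := hXV.snd
  have hXm := hXG.aemeasurable
  have hVm := hVG.aemeasurable
  have hVj : ∀ j, MemLp (fun ω => V ω j) 2 P := fun j => (hVG.eval j).memLp_two
  have hX2 : MemLp X 2 P := hXG.memLp_two
  have hGcont : Continuous G := continuous_iff_continuousAt.2 fun x => (hG x).continuousAt
  set s : ℝ := ∫ ω, X ω * X ω ∂P with hs
  have hvar : Var[X; P] = s := by
    rw [variance_eq_sub hX2, hX, hs]
    simp [pow_two]
  have hs0 : 0 ≤ s := integral_nonneg fun ω => mul_self_nonneg _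
  rcases eq_or_ne s 0 with h0 | h0
  · have hX0 : X =ᵐ[P] 0 := by
      have := (integral_eq_zero_iff_of_nonneg (fun ω => mul_self_nonneg (X ω))
        (hX2.integrable_mul hX2)).1 h0
      filter_upwards [this] with ω hω
      simpa using hω
    rw [integral_eq_zero_of_ae (by filter_upwards [hX0] with ω hω; simp [hω])]
    refine (Finset.sum_eq_zero fun j _ => ?_).symm
    rw [integral_eq_zero_of_ae (by filter_upwards [hX0] with ω hω; simp [hω]), zero_mul]
  -- Regression coefficients of `V` on `X`: the residual `W` is uncorrelated with `X`, hence
  -- independent of it by joint Gaussianity. With `W` frozen, `V = W + X • k` depends on `X` alone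
  -- and the one-dimensional formula applies.
  set k : ι → ℝ := fun j => (∫ ω, X ω * V ω j ∂P) / s with hk
  set W : Ω → ι → ℝ := fun ω => V ω - X ω • k with hW
  have hXW : HasGaussianLaw (fun ω => (X ω, W ω)) P :=
    hXV.map_fun ((ContinuousLinearMap.fst ℝ ℝ (ι → ℝ)).prod
      (ContinuousLinearMap.snd ℝ ℝ (ι → ℝ) -
        (ContinuousLinearMap.fst ℝ ℝ (ι → ℝ)).smulRight k))
  have hind : IndepFun X W P := by
    have h1 : HasGaussianLaw (fun ω => ((fun _ : Unit => X ω), fun j => W ω j)) P :=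
      hXW.map_fun ((ContinuousLinearMap.pi fun _ : Unit => ContinuousLinearMap.fst ℝ ℝ (ι → ℝ)).prod
        (ContinuousLinearMap.snd ℝ ℝ (ι → ℝ)))
    have h2 := HasGaussianLaw.indepFun_of_covariance_eval (X := fun _ : Unit => X)
      (Y := fun j ω => W ω j) h1 (fun _ j => ?_)
    · exact h2.comp (φ := fun f : Unit → ℝ => f ()) (ψ := id) (measurable_pi_apply _) measurable_id
    · rw [covariance_eq_sub hX2 (hXW.snd.eval j).memLp_two, hX, zero_mul, sub_zero]
      simp only [Pi.mul_apply, Pi.sub_apply, Pi.smul_apply, smul_eq_mul, mul_sub]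
      rw [integral_sub (f := fun ω => X ω * V ω j) (hX2.integrable_mul (hVj j))]
      · have : ∀ ω, X ω * (X ω * k j) = X ω * X ω * k j := fun ω => by ring
        simp_rw [this]
        rw [integral_mul_const, ← hs, hk]
        field_simp
        simp
      · have : ∀ ω, X ω * (X ω * k j) = X ω * X ω * k j := fun ω => by ring
        simp_rw [this]
        exact (hX2.integrable_mul hX2).mul_const _
  have hWm := hXW.snd.aemeasurable
  have hprod := (indepFun_iff_map_prod_eq_prod_map_map hXm hWm).1 hind
  have hVW : ∀ ω, V ω = W ω + X ω • k := fun ω => by simp [hW]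
  have hmapX : Measure.map X P = gaussianReal 0 s.toNNReal := by
    rw [hXG.map_eq_gaussianReal, hX, hvar]
  have hpm : AEMeasurable (fun ω => (X ω, W ω)) P := hXm.prodMk hWm
  have : IsProbabilityMeasure (Measure.map X P) := Measure.isProbabilityMeasure_map hXm
  have : IsProbabilityMeasure (Measure.map W P) := Measure.isProbabilityMeasure_map hWm
  have hDVint : ∀ j, Integrable (fun ω => D j (V ω)) P := fun j =>
    Integrable.of_bound ((hD j).measurable.comp_aemeasurable hVm).aestronglyMeasurable C
      (Filter.Eventually.of_forall fun ω => by simpa using hDC j _)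
  set E : (ι → ℝ) → ℝ := fun v => ∑ j, D j v * k j with hE
  have hEc : Continuous E := by
    have := hD
    fun_prop
  have hEC : ∀ v, |E v| ≤ ∑ j, C * |k j| := fun v => by
    refine (Finset.abs_sum_le_sum_abs _ _).trans (Finset.sum_le_sum fun j _ => ?_)
    rw [abs_mul]
    exact mul_le_mul_of_nonneg_right (hDC j v) (abs_nonneg _)
  have hC0 : 0 ≤ C := (abs_nonneg _).trans (hGC 0)
  calc ∫ ω, X ω * G (V ω) ∂P
      = ∫ z, z.1 * G (z.2 + z.1 • k) ∂((Measure.map X P).prod (Measure.map W P)) := by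
        rw [← hprod, integral_map hpm]
        · simp_rw [hVW]
        · exact (Continuous.aestronglyMeasurable (by fun_prop))
    _ = ∫ w, ∫ x, x * G (w + x • k) ∂(Measure.map X P) ∂(Measure.map W P) := by
        rw [integral_prod_symm]
        have h1 : Integrable (fun z : ℝ × (ι → ℝ) => z.1)
            ((Measure.map X P).prod (Measure.map W P)) := by
          have : Integrable (fun x : ℝ => x) (Measure.map X P) := by
            rw [hmapX]
            exact (memLp_id_gaussianReal (μ := 0) (v := s.toNNReal) 1).integrable (by simp)
          exact this.comp_fst _
        refine h1.mul_bdd (c := C) (Continuous.aestronglyMeasurable (by fun_prop))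
          (Filter.Eventually.of_forall fun z => by simpa using hGC _)
    _ = ∫ w, ∫ x, s * E (w + x • k) ∂(Measure.map X P) ∂(Measure.map W P) := by
        congr 1; ext w
        rw [hmapX, integral_mul_gaussianReal (g' := fun x => E (w + x • k))
          (C := max C (∑ j, C * |k j|))
          (fun x => ?_) (fun x => (hGC _).trans (le_max_left _ _))
          (fun x => (hEC _).trans (le_max_right _ _)), integral_const_mul, Real.coe_toNNReal _ hs0]
        have hl : HasDerivAt (fun x : ℝ => w + x • k) k x := by
          simpa using ((hasDerivAt_id x).smul_const k).const_add w
        have := (hG (w + x • k)).comp_hasDerivAt x hl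
        refine HasDerivAt.congr_deriv (f := fun x : ℝ => G (w + x • k)) this ?_
        simp [hE]
    _ = ∫ z, s * E (z.2 + z.1 • k) ∂((Measure.map X P).prod (Measure.map W P)) := by
        rw [integral_prod_symm]
        refine (Integrable.of_bound (Continuous.aestronglyMeasurable (by fun_prop))
          (∑ j, C * |k j|) (Filter.Eventually.of_forall fun z => ?_)).const_mul s
        simpa using hEC _
    _ = ∫ ω, s * E (V ω) ∂P := by
        rw [← hprod, integral_map hpm]
        · simp_rw [hVW]
        · exact (Continuous.aestronglyMeasurable (by fun_prop))
    _ = ∑ j, (∫ ω, X ω * V ω j ∂P) * ∫ ω, D j (V ω) ∂P := by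
        rw [integral_const_mul]
        simp only [hE]
        rw [integral_finsetSum _ fun j _ => (hDVint j).mul_const _, Finset.mul_sum]
        refine Finset.sum_congr rfl fun j _ => ?_
        rw [integral_mul_const, hk]
        field_simp

end SphericalSK

/-! ### Gibbs averages over a finite set: derivatives and the pointwise differential inequality. -/

namespace SphericalSK

variable {ι : Type*} [Fintype ι]

/-- The Gibbs weights of the energies `v` on a finite set. -/
noncomputable def weight (v : ι → ℝ) (i : ι) : ℝ := Real.exp (v i) / ∑ j, Real.exp (v j)

/-- The Gibbs average of `f` for the energies `v` on a finite set. -/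
noncomputable def avg (v f : ι → ℝ) : ℝ := ∑ i, weight v i * f i

theorem sum_exp_pos [Nonempty ι] (v : ι → ℝ) : 0 < ∑ j, Real.exp (v j) :=
  Finset.sum_pos (fun _ _ => Real.exp_pos _) Finset.univ_nonempty

theorem weight_nonneg (v : ι → ℝ) (i : ι) : 0 ≤ weight v i :=
  div_nonneg (Real.exp_pos _).le (Finset.sum_nonneg fun _ _ => (Real.exp_pos _).le)

theorem sum_weight [Nonempty ι] (v : ι → ℝ) : ∑ i, weight v i = 1 := by
  simp only [weight]
  rw [← Finset.sum_div, div_self (sum_exp_pos v).ne']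

theorem weight_le_one [Nonempty ι] (v : ι → ℝ) (i : ι) : weight v i ≤ 1 := by
  rw [← sum_weight v]
  exact Finset.single_le_sum (fun j _ => weight_nonneg v j) (Finset.mem_univ i)

theorem continuous_weight [Nonempty ι] (i : ι) : Continuous fun v : ι → ℝ => weight v i :=
  Continuous.div (by fun_prop) (by fun_prop) fun v => (sum_exp_pos v).ne'

theorem abs_avg_le [Nonempty ι] {v f : ι → ℝ} {F : ℝ} (hf : ∀ i, |f i| ≤ F) : |avg v f| ≤ F := by
  calc |avg v f| ≤ ∑ i, |weight v i * f i| := Finset.abs_sum_le_sum_abs _ _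
    _ ≤ ∑ i, weight v i * F := Finset.sum_le_sum fun i _ => by
        rw [abs_mul, abs_of_nonneg (weight_nonneg v i)]
        exact mul_le_mul_of_nonneg_left (hf i) (weight_nonneg v i)
    _ = F := by rw [← Finset.sum_mul, sum_weight, one_mul]

/-- The quotient rule yields the Gibbs covariance of `f` and `v'`. The centring is put on `f` rather
than on `v'`, so that the coefficient of each `v' i` is a bounded function of the energies to which
integration by parts applies. -/
theorem hasDerivAt_avg [Nonempty ι] {v f : ℝ → ι → ℝ} {v' f' : ι → ℝ} {t : ℝ}
    (hv : ∀ i, HasDerivAt (fun s => v s i) (v' i) t)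
    (hf : ∀ i, HasDerivAt (fun s => f s i) (f' i) t) :
    HasDerivAt (fun s => avg (v s) (f s))
      (avg (v t) f' + ∑ i, weight (v t) i * (f t i - avg (v t) (f t)) * v' i) t := by
  have hZ : HasDerivAt (fun s => ∑ j, Real.exp (v s j)) (∑ j, Real.exp (v t j) * v' j) t :=
    HasDerivAt.fun_sum fun j _ => (hv j).exp
  have hZ0 := (sum_exp_pos (v t)).ne'
  have h1 : HasDerivAt (fun s => avg (v s) (f s)) _ t :=
    HasDerivAt.fun_sum (u := Finset.univ) fun i _ => (((hv i).exp).div hZ hZ0).mul (hf i)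
  refine h1.congr_deriv ?_
  have e1 : ∀ i, Real.exp (v t i) = weight (v t) i * ∑ j, Real.exp (v t j) := fun i => by
    simp only [weight]; field_simp
  have e2 : ∑ j, Real.exp (v t j) * v' j
      = (∑ j, weight (v t) j * v' j) * ∑ j, Real.exp (v t j) := by
    rw [Finset.sum_mul]
    exact Finset.sum_congr rfl fun j _ => by rw [e1 j]; ring
  have e3 : ∀ i, (Real.exp (v t i) * v' i * ∑ j, Real.exp (v t j)
      - Real.exp (v t i) * ∑ j, Real.exp (v t j) * v' j) / (∑ j, Real.exp (v t j)) ^ 2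
      = weight (v t) i * (v' i - ∑ j, weight (v t) j * v' j) := fun i => by
    rw [e2, e1 i]; field_simp
  calc _ = ∑ i, (weight (v t) i * (v' i - ∑ j, weight (v t) j * v' j) * f t i
        + weight (v t) i * f' i) := Finset.sum_congr rfl fun i _ => by rw [e3 i]; rfl
    _ = _ := by
      rw [Finset.sum_add_distrib, add_comm]
      congr 1
      set k := ∑ j, weight (v t) j * v' j with hk
      have e4 : ∀ i, weight (v t) i * (v' i - k) * f t i
          = weight (v t) i * f t i * v' i - weight (v t) i * f t i * k := fun i => by ring
      have e5 : ∀ i, weight (v t) i * (f t i - avg (v t) (f t)) * v' i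
          = weight (v t) i * f t i * v' i - avg (v t) (f t) * (weight (v t) i * v' i) :=
        fun i => by ring
      simp only [e4, e5, Finset.sum_sub_distrib, ← Finset.sum_mul, ← Finset.mul_sum, ← hk]
      rfl

open Classical in
/-- The derivative in the `j`-th energy of `weight v i * (f i - avg v f)`. -/
noncomputable def weightDeriv (f : ι → ℝ) (i j : ι) (v : ι → ℝ) : ℝ :=
  weight v i * ((if i = j then 1 else 0) - weight v j) * (f i - avg v f)
    - weight v i * (weight v j * (f j - avg v f))

-- A weight is the average of an indicator function, so `hasDerivAt_avg` along the lines `v + s • x`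
-- differentiates both factors. The identity of the two directional derivatives then identifies the
-- Fréchet derivative.
open Classical in
theorem hasFDerivAt_weight_mul_sub [Nonempty ι] (f : ι → ℝ) (i : ι) (v : ι → ℝ) :
    HasFDerivAt (fun v => weight v i * (f i - avg v f))
      (∑ j, weightDeriv f i j v • ContinuousLinearMap.proj (R := ℝ) (φ := fun _ : ι => ℝ) j) v := by
  have hw : ∀ i, DifferentiableAt ℝ (fun v : ι → ℝ => weight v i) v := fun i =>
    by
    simp only [weight, div_eq_mul_inv]
    exact DifferentiableAt.mul (by fun_prop)
      (DifferentiableAt.inv (by fun_prop) (sum_exp_pos v).ne')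
  have hm : DifferentiableAt ℝ (fun v : ι → ℝ => avg v f) v := by
    simp only [avg]; fun_prop
  have hd : DifferentiableAt ℝ (fun v => weight v i * (f i - avg v f)) v :=
    (hw i).mul ((differentiableAt_const _).sub hm)
  refine hd.hasFDerivAt.congr_fderiv ?_
  ext x
  have hl : ∀ j, HasDerivAt (fun s : ℝ => (v + s • x) j) (x j) 0 := fun j => by
    simpa using ((hasDerivAt_id (0 : ℝ)).mul_const (x j)).const_add (v j)
  have hl' : HasDerivAt (fun s : ℝ => v + s • x) x 0 := hasDerivAt_pi.2 hl
  have h0 : v + (0 : ℝ) • x = v := by simp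
  have h1 : HasDerivAt (fun s : ℝ => weight (v + s • x) i * (f i - avg (v + s • x) f))
      (fderiv ℝ (fun v => weight v i * (f i - avg v f)) v x) 0 := by
    have := hd.hasFDerivAt
    rw [← h0] at this
    have h := this.comp_hasDerivAt (0 : ℝ) hl'
    rw [h0] at h
    exact h
  have h2 := hasDerivAt_avg (v := fun s : ℝ => v + s • x) (f := fun _ => f) (f' := 0) hl
    (fun j => hasDerivAt_const _ _)
  have h3 := hasDerivAt_avg (v := fun s : ℝ => v + s • x) (f := fun _ j => if i = j then 1 else 0)
    (f' := 0) hl (fun j => hasDerivAt_const _ _)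
  have h4 : ∀ v : ι → ℝ, avg v (fun j => if i = j then (1 : ℝ) else 0) = weight v i := fun v => by
    simp [avg]
  simp only [h4] at h3
  have h5 := h1.unique (h3.mul (h2.const_sub (f i)))
  rw [h5]
  have h6 : ∀ v : ι → ℝ, avg v 0 = 0 := fun v => by simp [avg]
  simp only [zero_smul, add_zero, h6, zero_add]
  simp only [weightDeriv, sum_apply, smul_apply,
    ContinuousLinearMap.proj_apply, smul_eq_mul]
  rw [Finset.sum_mul, ← Finset.sum_neg_distrib, Finset.mul_sum, ← Finset.sum_add_distrib]
  have h7 : ∑ j, weight v j * ((if i = j then (1 : ℝ) else 0) - weight v i) * x j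
      = ∑ j, weight v i * ((if i = j then (1 : ℝ) else 0) - weight v j) * x j :=
    Finset.sum_congr rfl fun j _ => by
      rcases eq_or_ne i j with rfl | h
      · rfl
      · simp only [if_neg h]; ring
  refine Finset.sum_congr rfl fun j _ => ?_
  rcases eq_or_ne i j with rfl | h
  · ring
  · simp only [if_neg h]; ring

theorem continuous_avg [Nonempty ι] (f : ι → ℝ) : Continuous fun v => avg v f :=
  continuous_finsetSum _ fun i _ => (continuous_weight i).mul continuous_const

theorem continuous_weightDeriv [Nonempty ι] (f : ι → ℝ) (i j : ι) :
    Continuous (weightDeriv f i j) := by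
  have h1 := continuous_weight i
  have h2 := continuous_weight j
  have h3 := continuous_avg f
  unfold weightDeriv
  fun_prop

theorem abs_weight_mul_sub_le [Nonempty ι] {f : ι → ℝ} {F : ℝ} (hf : ∀ i, |f i| ≤ F) (i : ι)
    (v : ι → ℝ) : |weight v i * (f i - avg v f)| ≤ 2 * F := by
  rw [abs_mul, abs_of_nonneg (weight_nonneg v i)]
  have h1 : |f i - avg v f| ≤ 2 * F := (abs_sub _ _).trans (by linarith [hf i, abs_avg_le (v := v) hf])
  have h2 := mul_le_mul (weight_le_one v i) h1 (abs_nonneg _) zero_le_one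
  simpa using h2

theorem abs_weightDeriv_le [Nonempty ι] {f : ι → ℝ} {F : ℝ} (hf : ∀ i, |f i| ≤ F) (i j : ι)
    (v : ι → ℝ) : |weightDeriv f i j v| ≤ 4 * F := by
  classical
  have h1 : |f i - avg v f| ≤ 2 * F := (abs_sub _ _).trans (by linarith [hf i, abs_avg_le (v := v) hf])
  have h2 := abs_weight_mul_sub_le hf j v
  have hi0 := weight_nonneg v i
  have hj0 := weight_nonneg v j
  have hi1 := weight_le_one v i
  have hj1 := weight_le_one v j
  have h3 : |weight v i * ((if i = j then 1 else 0) - weight v j)| ≤ 1 := by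
    rw [abs_mul, abs_of_nonneg hi0]
    have : |(if i = j then (1 : ℝ) else 0) - weight v j| ≤ 1 := by
      rw [abs_le]; split_ifs <;> constructor <;> linarith
    nlinarith [abs_nonneg ((if i = j then (1 : ℝ) else 0) - weight v j)]
  unfold weightDeriv
  refine (abs_sub _ _).trans ?_
  have e1 : |weight v i * ((if i = j then 1 else 0) - weight v j) * (f i - avg v f)| ≤ 1 * (2 * F) := by
    rw [abs_mul]
    exact mul_le_mul h3 h1 (abs_nonneg _) zero_le_one
  have e2 : |weight v i * (weight v j * (f j - avg v f))| ≤ 1 * (2 * F) := by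
    rw [abs_mul, abs_of_nonneg hi0]
    exact mul_le_mul hi1 h2 (abs_nonneg _) zero_le_one
  linarith

/-- Chebyshev's association inequality for an average of `e` and `exp (s * e)`. -/
theorem sum_mul_sum_exp_le {w e : ι → ℝ} {s : ℝ} (hw : ∀ i, 0 ≤ w i) (hw1 : ∑ i, w i = 1)
    (hs : 0 ≤ s) :
    (∑ i, w i * e i) * ∑ i, w i * Real.exp (s * e i) ≤ ∑ i, w i * (e i * Real.exp (s * e i)) := by
  set m := ∑ i, w i * e i with hm
  have h : 0 ≤ ∑ i, w i * ((e i - m) * (Real.exp (s * e i) - Real.exp (s * m))) := by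
    refine Finset.sum_nonneg fun i _ => mul_nonneg (hw i) ?_
    rcases le_total (e i) m with h | h
    · exact mul_nonneg_of_nonpos_of_nonpos (by linarith) (by
        have := Real.exp_le_exp.2 (mul_le_mul_of_nonneg_left h hs); linarith)
    · exact mul_nonneg (by linarith) (by
        have := Real.exp_le_exp.2 (mul_le_mul_of_nonneg_left h hs); linarith)
  have h2 : ∑ i, w i * ((e i - m) * (Real.exp (s * e i) - Real.exp (s * m)))
      = ∑ i, w i * (e i * Real.exp (s * e i)) - m * (∑ i, w i * Real.exp (s * e i))
        - Real.exp (s * m) * (∑ i, w i * e i - m * ∑ i, w i) := by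
    simp only [Finset.mul_sum, ← Finset.sum_sub_distrib]
    exact Finset.sum_congr rfl fun i _ => by ring
  rw [h2, hw1, ← hm] at h
  linarith

/-- With m, g, k the averages of f, e·f and e, bounding |f - m| by f + m and using km ≤ g gives at
most d(2m + 2g) for the drift and u(2m + 4g) for each of the three parts of the second-order term,
which carries the factor 1/2. The total coefficient of g is 2d + 6u, exactly what the moving
exponent removes, and that of m is 2d + 3u. -/
theorem interpolation_pointwise_bound [Nonempty ι] (v e D : ι → ℝ) (U : ι → ι → ℝ) {s u d : ℝ}
    (hs : 0 ≤ s) (he : ∀ i, 0 ≤ e i)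
    (hU : ∀ i j, |U i j| ≤ u * (1 + e i + e j)) (hD : ∀ i, |D i| ≤ d * (1 + e i)) (f : ι → ℝ)
    (hf : f = fun i => Real.exp (s * e i)) :
    avg v (fun i => -((2 * d + 6 * u) * e i) * f i) + ∑ i, D i * (weight v i * (f i - avg v f))
      + 1 / 2 * ∑ i, ∑ j, U i j * weightDeriv f i j v ≤ (2 * d + 6 * u) * avg v f := by
  classical
  set w := weight v with hw
  have hw0 : ∀ i, 0 ≤ w i := weight_nonneg v
  have hw1 : ∑ i, w i = 1 := sum_weight v
  have hf0 : ∀ i, 0 ≤ f i := fun i => by rw [hf]; exact (Real.exp_pos _).le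
  obtain ⟨i0⟩ := ‹Nonempty ι›
  have hu : 0 ≤ u := nonneg_of_mul_nonneg_left ((abs_nonneg _).trans (hU i0 i0))
    (by linarith [he i0])
  have hd : 0 ≤ d := nonneg_of_mul_nonneg_left ((abs_nonneg _).trans (hD i0)) (by linarith [he i0])
  set m := ∑ i, w i * f i with hm
  set g := ∑ i, w i * (e i * f i) with hg
  set k := ∑ i, w i * e i with hk
  have hma : avg v f = m := rfl
  have hm0 : 0 ≤ m := Finset.sum_nonneg fun i _ => mul_nonneg (hw0 i) (hf0 i)
  have hkm : k * m ≤ g := by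
    rw [hk, hm, hg, hf]; exact sum_mul_sum_exp_le hw0 hw1 hs
  have habs : ∀ i, |f i - m| ≤ f i + m := fun i => by
    rw [abs_le]; constructor <;> linarith [hf0 i]
  have b0 : avg v (fun i => -((2 * d + 6 * u) * e i) * f i) = -((2 * d + 6 * u) * g) := by
    rw [hg, Finset.mul_sum, ← Finset.sum_neg_distrib]
    exact Finset.sum_congr rfl fun i _ => by simp only [hw]; ring
  have b1 : ∑ i, D i * (w i * (f i - m)) ≤ d * (2 * m + 2 * g) := by
    have : ∑ i, D i * (w i * (f i - m)) ≤ ∑ i, d * (1 + e i) * (w i * (f i + m)) := by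
      refine Finset.sum_le_sum fun i _ => (le_abs_self _).trans ?_
      rw [abs_mul, abs_mul, abs_of_nonneg (hw0 i)]
      have := habs i; have := hD i; have := hw0 i; have := he i
      gcongr
    refine this.trans ?_
    have e1 : ∑ i, d * (1 + e i) * (w i * (f i + m)) = d * (m + g + m * ∑ i, w i + k * m) := by
      have : ∀ i, d * (1 + e i) * (w i * (f i + m)) = d * (w i * f i + w i * (e i * f i)
        + m * w i + w i * e i * m) := fun i => by ring
      simp only [this, ← Finset.mul_sum, Finset.sum_add_distrib, ← Finset.sum_mul]
      rw [← hm, ← hg, ← hk]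
    rw [e1, hw1]
    nlinarith
  have b2 : ∑ i, U i i * (w i * (f i - m)) ≤ u * (2 * m + 4 * g) := by
    have : ∑ i, U i i * (w i * (f i - m)) ≤ ∑ i, u * (1 + e i + e i) * (w i * (f i + m)) := by
      refine Finset.sum_le_sum fun i _ => (le_abs_self _).trans ?_
      rw [abs_mul, abs_mul, abs_of_nonneg (hw0 i)]
      have := habs i; have := hU i i; have := hw0 i; have := he i
      gcongr
    refine this.trans ?_
    have e1 : ∑ i, u * (1 + e i + e i) * (w i * (f i + m))
        = u * (m + 2 * g + m * ∑ i, w i + 2 * k * m) := by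
      have : ∀ i, u * (1 + e i + e i) * (w i * (f i + m)) = u * (w i * f i
        + 2 * (w i * (e i * f i)) + m * w i + 2 * (w i * e i) * m) := fun i => by ring
      simp only [this, ← Finset.mul_sum, Finset.sum_add_distrib, ← Finset.sum_mul]
      rw [← hm, ← hg, ← hk]
    rw [e1, hw1]
    nlinarith
  -- A general `T` is taken because the bound serves both for `U` and for its transpose. The sum is
  -- u(2m + g + 3km), and km ≤ g gives the coefficient 4.
  have b3 : ∀ T : ι → ι → ℝ, (∀ i j, |T i j| ≤ u * (1 + e i + e j)) →
      -∑ i, ∑ j, T i j * (w i * w j * (f i - m)) ≤ u * (2 * m + 4 * g) := by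
    intro T hT
    have : -∑ i, ∑ j, T i j * (w i * w j * (f i - m))
        ≤ ∑ i, ∑ j, u * (1 + e i + e j) * (w i * w j * (f i + m)) := by
      rw [← Finset.sum_neg_distrib]
      refine Finset.sum_le_sum fun i _ => ?_
      rw [← Finset.sum_neg_distrib]
      refine Finset.sum_le_sum fun j _ => (neg_le_abs _).trans ?_
      rw [abs_mul, abs_mul, abs_mul, abs_of_nonneg (hw0 i), abs_of_nonneg (hw0 j)]
      have := habs i; have := hT i j; have := hw0 i; have := hw0 j; have := he i; have := he j
      gcongr
    refine this.trans ?_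
    have e0 : ∀ i, ∑ j, u * (1 + e i + e j) * (w i * w j * (f i + m))
        = u * (w i * (f i + m)) * ((1 + e i) * ∑ j, w j + k) := fun i => by
      have : ∀ j, u * (1 + e i + e j) * (w i * w j * (f i + m))
        = u * (w i * (f i + m)) * ((1 + e i) * w j + w j * e j) := fun j => by ring
      simp only [this, ← Finset.mul_sum, Finset.sum_add_distrib]
      rw [← hk]
    have e1 : ∑ i, u * (w i * (f i + m)) * ((1 + e i) * 1 + k)
        = u * (m + g + k * m + m * ∑ i, w i + k * m + k * m * ∑ i, w i) := by
      have : ∀ i, u * (w i * (f i + m)) * ((1 + e i) * 1 + k) = u * (w i * f i + w i * (e i * f i)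
        + k * (w i * f i) + m * w i + m * (w i * e i) + k * m * w i) := fun i => by ring
      simp only [this, ← Finset.mul_sum, Finset.sum_add_distrib]
      rw [← hm, ← hg, ← hk]; ring
    simp only [e0, hw1]
    rw [e1, hw1]
    nlinarith
  -- The three parts of `weightDeriv`: the diagonal one, and two products of weights that are
  -- exchanged by transposing `U`.
  have b4 : ∑ i, ∑ j, U i j * weightDeriv f i j v = ∑ i, U i i * (w i * (f i - m))
      + (-∑ i, ∑ j, U i j * (w i * w j * (f i - m)))
      + (-∑ i, ∑ j, U j i * (w i * w j * (f i - m))) := by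
    rw [Finset.sum_comm (f := fun i j => U j i * (w i * w j * (f i - m))),
      ← Finset.sum_neg_distrib, ← Finset.sum_neg_distrib, ← Finset.sum_add_distrib,
      ← Finset.sum_add_distrib]
    refine Finset.sum_congr rfl fun i _ => ?_
    have : ∀ j, U i j * weightDeriv f i j v = (if i = j then U i j * (w i * (f i - m)) else 0)
        + -(U i j * (w i * w j * (f i - m))) + -(U i j * (w j * w i * (f j - m))) := fun j => by
      simp only [weightDeriv, hma, ← hw]
      split_ifs <;> ring
    simp only [this, Finset.sum_add_distrib, Finset.sum_neg_distrib, Finset.sum_ite_eq,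
      Finset.mem_univ, if_true]
  rw [b0, b4, hma]
  have b5 := b3 U hU
  have b6 := b3 (fun i j => U j i) (fun i j => by
    rw [show 1 + e i + e j = 1 + e j + e i by ring]; exact hU j i)
  linarith [mul_nonneg hu hm0]

end SphericalSK

/-! ### The interpolation inequality for finite Gaussian families. -/

namespace SphericalSK

section Interpolation

variable {Ω ι : Type*} [mΩ : MeasurableSpace Ω]

/-- The interpolating energies `√t X + √(1 - t) Y + D₀ + t D₁` on a finite set. -/
noncomputable def interp (x y D₀ D₁ : ι → ℝ) (t : ℝ) (i : ι) : ℝ :=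
  Real.sqrt t * x i + Real.sqrt (1 - t) * y i + (D₀ i + t * D₁ i)

theorem hasDerivAt_interp (x y D₀ D₁ : ι → ℝ) {t : ℝ} (ht : t ∈ Set.Ioo (0 : ℝ) 1) (i : ι) :
    HasDerivAt (fun s => interp x y D₀ D₁ s i)
      (1 / (2 * Real.sqrt t) * x i - 1 / (2 * Real.sqrt (1 - t)) * y i + D₁ i) t := by
  have h1 := (Real.hasDerivAt_sqrt ht.1.ne').mul_const (x i)
  have h2 := (((hasDerivAt_id t).const_sub 1).sqrt (by simpa using (sub_pos.2 ht.2).ne')).mul_const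
    (y i)
  have h3 := ((hasDerivAt_id t).mul_const (D₁ i)).const_add (D₀ i)
  refine HasDerivAt.congr_deriv (f := fun s => interp x y D₀ D₁ s i) ((h1.add h2).add h3) ?_
  simp only [id]; ring

theorem continuous_interp (x y D₀ D₁ : ι → ℝ) (i : ι) :
    Continuous fun t => interp x y D₀ D₁ t i := by
  unfold interp; fun_prop

/-- Along the interpolation between two Gaussian families whose covariances differ by at most
`u (1 + e i + e j)`, the exponential moment of `e`, with a linearly decreasing exponent, grows at
most exponentially. -/
theorem integral_avg_interp_le [Fintype ι] [Nonempty ι] {P : Measure Ω} {X Y : Ω → ι → ℝ}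
    (hXY : HasGaussianLaw (fun ω => (X ω, Y ω)) P)
    (hX : ∀ i, ∫ ω, X ω i ∂P = 0) (hY : ∀ i, ∫ ω, Y ω i ∂P = 0)
    (hXY0 : ∀ i j, ∫ ω, X ω i * Y ω j ∂P = 0) {e D₀ D₁ : ι → ℝ} {u d a : ℝ}
    (he : ∀ i, 0 ≤ e i)
    (hU : ∀ i j, |∫ ω, X ω i * X ω j ∂P - ∫ ω, Y ω i * Y ω j ∂P| ≤ u * (1 + e i + e j))
    (hD : ∀ i, |D₁ i| ≤ d * (1 + e i)) (ha : 2 * d + 6 * u ≤ a) {t : ℝ}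
    (ht : t ∈ Set.Icc (0 : ℝ) 1) :
    ∫ ω, avg (interp (X ω) (Y ω) D₀ D₁ t) (fun i => Real.exp ((a - (2 * d + 6 * u) * t) * e i)) ∂P
      ≤ Real.exp (2 * d + 6 * u)
        * ∫ ω, avg (interp (X ω) (Y ω) D₀ D₁ 0) (fun i => Real.exp (a * e i)) ∂P := by
  have : IsProbabilityMeasure P := hXY.isProbabilityMeasure
  set κ := 2 * d + 6 * u with hκ
  set f : ℝ → ι → ℝ := fun t i => Real.exp ((a - κ * t) * e i) with hf
  set φ : ℝ → ℝ := fun t => ∫ ω, avg (interp (X ω) (Y ω) D₀ D₁ t) (f t) ∂P with hφ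
  have hu : 0 ≤ u := by
    obtain ⟨i⟩ := ‹Nonempty ι›
    exact nonneg_of_mul_nonneg_left ((abs_nonneg _).trans (hU i i)) (by linarith [he i])
  have hd : 0 ≤ d := by
    obtain ⟨i⟩ := ‹Nonempty ι›
    exact nonneg_of_mul_nonneg_left ((abs_nonneg _).trans (hD i)) (by linarith [he i])
  have hκ0 : 0 ≤ κ := by positivity
  set F : ℝ := ∑ i, Real.exp (a * e i) with hF
  have hfF : ∀ t, 0 ≤ t → ∀ i, |f t i| ≤ F := fun t ht i => by
    rw [hf, abs_of_nonneg (Real.exp_pos _).le]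
    refine le_trans ?_ (Finset.single_le_sum (f := fun i => Real.exp (a * e i))
      (fun j _ => (Real.exp_pos _).le) (Finset.mem_univ i))
    refine Real.exp_le_exp.2 (mul_le_mul_of_nonneg_right ?_ (he i))
    nlinarith
  have hXm : AEMeasurable X P := hXY.fst.aemeasurable
  have hYm : AEMeasurable Y P := hXY.snd.aemeasurable
  have hXi : ∀ i, MemLp (fun ω => X ω i) 2 P := fun i => (hXY.fst.eval i).memLp_two
  have hYi : ∀ i, MemLp (fun ω => Y ω i) 2 P := fun i => (hXY.snd.eval i).memLp_two
  have hXI : ∀ i, Integrable (fun ω => X ω i) P := fun i => (hXi i).integrable (by norm_num)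
  have hYI : ∀ i, Integrable (fun ω => Y ω i) P := fun i => (hYi i).integrable (by norm_num)
  have hXX : ∀ i j, Integrable (fun ω => X ω i * X ω j) P := fun i j => (hXi i).integrable_mul (hXi j)
  have hXY' : ∀ i j, Integrable (fun ω => X ω i * Y ω j) P := fun i j =>
    (hXi i).integrable_mul (hYi j)
  have hYY : ∀ i j, Integrable (fun ω => Y ω i * Y ω j) P := fun i j => (hYi i).integrable_mul (hYi j)
  have hVm : ∀ t, AEMeasurable (fun ω => interp (X ω) (Y ω) D₀ D₁ t) P := fun t => by
    refine aemeasurable_pi_lambda _ fun i => ?_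
    unfold interp
    exact (((hXI i).aemeasurable.const_mul _).add ((hYI i).aemeasurable.const_mul _)).add_const _
  have hcomp : ∀ t {g : (ι → ℝ) → ℝ}, Continuous g →
      AEStronglyMeasurable (fun ω => g (interp (X ω) (Y ω) D₀ D₁ t)) P := fun t g hg =>
    (hg.measurable.comp_aemeasurable (hVm t)).aestronglyMeasurable
  have hbdd : ∀ t {g : (ι → ℝ) → ℝ} {B : ℝ}, Continuous g → (∀ v, |g v| ≤ B) →
      Integrable (fun ω => g (interp (X ω) (Y ω) D₀ D₁ t)) P := fun t g B hg hB =>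
    Integrable.of_bound (hcomp t hg) B (Filter.Eventually.of_forall fun ω => by simpa using hB _)
  set G : ℝ → ι → (ι → ℝ) → ℝ := fun t i v => weight v i * (f t i - avg v (f t)) with hG
  have hGc : ∀ t i, Continuous (G t i) := fun t i => by
    have h1 := continuous_weight (ι := ι) i
    have h2 := continuous_avg (f t)
    simp only [hG]; fun_prop
  have hGb : ∀ t, 0 ≤ t → ∀ i v, |G t i v| ≤ 2 * F := fun t ht i v =>
    abs_weight_mul_sub_le (hfF t ht) i v
  set f' : ℝ → ι → ℝ := fun t i => -(κ * e i) * f t i with hf'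
  set F' : ℝ → Ω → ℝ := fun t ω => avg (interp (X ω) (Y ω) D₀ D₁ t) (f' t)
    + ∑ i, G t i (interp (X ω) (Y ω) D₀ D₁ t)
      * (1 / (2 * Real.sqrt t) * X ω i - 1 / (2 * Real.sqrt (1 - t)) * Y ω i + D₁ i) with hF'
  set E : ℝ := ∑ i, κ * e i with hE
  have hf'b : ∀ t, 0 ≤ t → ∀ i, |f' t i| ≤ E * F := fun t ht i => by
    simp only [hf', abs_mul, abs_neg]
    refine mul_le_mul ?_ (hfF t ht i) (abs_nonneg _) (Finset.sum_nonneg fun i _ =>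
      mul_nonneg hκ0 (he i))
    rw [← abs_mul, abs_of_nonneg (mul_nonneg hκ0 (he i))]
    exact Finset.single_le_sum (f := fun i => κ * e i)
      (fun j _ => mul_nonneg hκ0 (he j)) (Finset.mem_univ i)
  have hfd : ∀ t i, HasDerivAt (fun s => f s i) (f' t i) t := fun t i => by
    have := ((((hasDerivAt_id t).const_mul κ).const_sub a).mul_const (e i)).exp
    refine HasDerivAt.congr_deriv (f := fun s => f s i) this ?_
    simp only [hf', hf, id]; ring
  have hpt : ∀ t ∈ Set.Ioo (0 : ℝ) 1, ∀ ω,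
      HasDerivAt (fun s => avg (interp (X ω) (Y ω) D₀ D₁ s) (f s)) (F' t ω) t := fun t ht ω =>
    hasDerivAt_avg (fun i => hasDerivAt_interp _ _ _ _ ht i) (hfd t)
  have hder : ∀ t ∈ Set.Ioo (0 : ℝ) 1, HasDerivAt φ (∫ ω, F' t ω ∂P) t := by
    intro t ht
    -- The derivatives of √t and √(1 - t) blow up at the end points, so domination is only available
    -- on (δ, 1 - δ).
    obtain ⟨δ, hδ, hδt, hδt'⟩ : ∃ δ > 0, δ < t ∧ δ < 1 - t :=
      ⟨min t (1 - t) / 2, by have := lt_min ht.1 (sub_pos.2 ht.2); positivity,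
        by have := lt_min ht.1 (sub_pos.2 ht.2); linarith [min_le_left t (1 - t)],
        by have := lt_min ht.1 (sub_pos.2 ht.2); linarith [min_le_right t (1 - t)]⟩
    have hsδ : 0 < Real.sqrt δ := Real.sqrt_pos.2 hδ
    refine (hasDerivAt_integral_of_dominated_loc_of_deriv_le (s := Set.Ioo δ (1 - δ))
      (bound := fun ω => E * F + ∑ i, 2 * F * (1 / (2 * Real.sqrt δ) * |X ω i|
        + 1 / (2 * Real.sqrt δ) * |Y ω i| + |D₁ i|))
      (Ioo_mem_nhds hδt (by linarith)) ?_ ?_ ?_ ?_ ?_ ?_).2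
    · exact Filter.Eventually.of_forall fun s => hcomp s (continuous_avg _)
    · exact hbdd t (continuous_avg _) fun v => abs_avg_le (hfF t ht.1.le)
    · refine (hcomp t (continuous_avg _)).add (Finset.aestronglyMeasurable_fun_sum _ fun i _ => ?_)
      refine (hcomp t (hGc t i)).mul ?_
      exact ((((hXI i).const_mul _).sub ((hYI i).const_mul _)).add (integrable_const _)).1
    · refine Filter.Eventually.of_forall fun ω s hs => ?_
      have hs0 : 0 < s := hδ.trans hs.1
      have hb : ∀ r, δ < r → |1 / (2 * Real.sqrt r)| ≤ 1 / (2 * Real.sqrt δ) := fun r hr => by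
        rw [abs_of_nonneg (by positivity)]
        have := Real.sqrt_le_sqrt hr.le
        gcongr
      rw [Real.norm_eq_abs]
      refine (abs_add_le _ _).trans (add_le_add (abs_avg_le (hf'b s hs0.le)) ?_)
      refine (Finset.abs_sum_le_sum_abs _ _).trans (Finset.sum_le_sum fun i _ => ?_)
      rw [abs_mul]
      refine mul_le_mul (hGb s hs0.le i _) ?_ (abs_nonneg _)
        ((abs_nonneg _).trans (hGb s hs0.le i 0))
      refine (abs_add_le _ _).trans (add_le_add ((abs_sub _ _).trans (add_le_add ?_ ?_)) le_rfl)
      · rw [abs_mul]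
        exact mul_le_mul_of_nonneg_right (hb s hs.1) (abs_nonneg _)
      · rw [abs_mul]
        exact mul_le_mul_of_nonneg_right (hb (1 - s) (by linarith [hs.2])) (abs_nonneg _)
    · refine (integrable_const _).add (integrable_finsetSum _ fun i _ => ?_)
      exact ((((hXI i).abs.const_mul _).add ((hYI i).abs.const_mul _)).add
        (integrable_const _)).const_mul _
    · exact Filter.Eventually.of_forall fun ω s hs =>
        hpt s ⟨hδ.trans hs.1, by linarith [hs.2]⟩ ω
  have hbound : ∀ t ∈ Set.Ioo (0 : ℝ) 1, ∫ ω, F' t ω ∂P ≤ κ * φ t := by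
    intro t ht
    have ht0 : 0 < Real.sqrt t := Real.sqrt_pos.2 ht.1
    have ht1 : 0 < Real.sqrt (1 - t) := Real.sqrt_pos.2 (sub_pos.2 ht.2)
    have hff := hfF t ht.1.le
    set D : ι → ℝ := fun i => D₀ i + t * D₁ i with hDdef
    set V : Ω → ι → ℝ := fun ω => Real.sqrt t • X ω + Real.sqrt (1 - t) • Y ω with hV
    have hVD : ∀ ω, interp (X ω) (Y ω) D₀ D₁ t = V ω + D := fun ω => by
      ext i; simp [interp, hV, hDdef]
    have hdc : ∀ i j, Continuous fun v => weightDeriv (f t) i j (v + D) := fun i j =>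
      (continuous_weightDeriv (f t) i j).comp (continuous_id.add continuous_const)
    have hjoint : ∀ L : ((ι → ℝ) × (ι → ℝ)) →L[ℝ] ℝ,
        HasGaussianLaw (fun ω => (L (X ω, Y ω), V ω)) P := fun L =>
      hXY.map_fun (L.prod (Real.sqrt t • ContinuousLinearMap.fst ℝ (ι → ℝ) (ι → ℝ)
        + Real.sqrt (1 - t) • ContinuousLinearMap.snd ℝ (ι → ℝ) (ι → ℝ)))
    have hGd : ∀ i v, HasFDerivAt (fun v => G t i (v + D)) (∑ j, weightDeriv (f t) i j (v + D) •
        ContinuousLinearMap.proj (R := ℝ) (φ := fun _ : ι => ℝ) j) v := fun i v =>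
      (hasFDerivAt_comp_add_right D).2 (hasFDerivAt_weight_mul_sub (f t) i (v + D))
    have hGb' : ∀ i v, |G t i (v + D)| ≤ 4 * F := fun i v =>
      (hGb t ht.1.le i _).trans (by
        have := (abs_nonneg _).trans (hff i)
        linarith)
    have ibpX : ∀ i, ∫ ω, X ω i * G t i (interp (X ω) (Y ω) D₀ D₁ t) ∂P
        = ∑ j, Real.sqrt t * (∫ ω, X ω i * X ω j ∂P)
          * ∫ ω, weightDeriv (f t) i j (interp (X ω) (Y ω) D₀ D₁ t) ∂P := fun i => by
      simp only [hVD]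
      rw [integral_mul_of_hasGaussianLaw (X := fun ω => X ω i) (G := fun v => G t i (v + D))
        (hjoint ((ContinuousLinearMap.proj i).comp (ContinuousLinearMap.fst ℝ _ _))) (hX i)
        (hGd i) (hdc i) (hGb' i) fun j v => abs_weightDeriv_le hff i j _]
      refine Finset.sum_congr rfl fun j _ => ?_
      congr 1
      have : ∀ ω, X ω i * V ω j = Real.sqrt t * (X ω i * X ω j)
          + Real.sqrt (1 - t) * (X ω i * Y ω j) := fun ω => by simp [hV]; ring
      show ∫ ω, X ω i * V ω j ∂P = _
      simp only [this]
      rw [integral_add ((hXX i j).const_mul _) ((hXY' i j).const_mul _), integral_const_mul, integral_const_mul,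
        hXY0, mul_zero, add_zero]
    have ibpY : ∀ i, ∫ ω, Y ω i * G t i (interp (X ω) (Y ω) D₀ D₁ t) ∂P
        = ∑ j, Real.sqrt (1 - t) * (∫ ω, Y ω i * Y ω j ∂P)
          * ∫ ω, weightDeriv (f t) i j (interp (X ω) (Y ω) D₀ D₁ t) ∂P := fun i => by
      simp only [hVD]
      rw [integral_mul_of_hasGaussianLaw (X := fun ω => Y ω i) (G := fun v => G t i (v + D))
        (hjoint ((ContinuousLinearMap.proj i).comp (ContinuousLinearMap.snd ℝ _ _))) (hY i)
        (hGd i) (hdc i) (hGb' i) fun j v => abs_weightDeriv_le hff i j _]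
      refine Finset.sum_congr rfl fun j _ => ?_
      congr 1
      have : ∀ ω, Y ω i * V ω j = Real.sqrt t * (X ω j * Y ω i)
          + Real.sqrt (1 - t) * (Y ω i * Y ω j) := fun ω => by simp [hV]; ring
      show ∫ ω, Y ω i * V ω j ∂P = _
      simp only [this]
      rw [integral_add ((hXY' j i).const_mul _) ((hYY i j).const_mul _), integral_const_mul, integral_const_mul,
        hXY0, mul_zero, zero_add]
    have hGI : ∀ i, Integrable (fun ω => G t i (interp (X ω) (Y ω) D₀ D₁ t)) P := fun i =>
      hbdd t (hGc t i) (hGb t ht.1.le i)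
    have hGX : ∀ i, Integrable (fun ω => X ω i * G t i (interp (X ω) (Y ω) D₀ D₁ t)) P :=
      fun i => (hXI i).mul_bdd (c := 2 * F) (hGI i).1
        (Filter.Eventually.of_forall fun ω => by simpa using hGb t ht.1.le i _)
    have hGY : ∀ i, Integrable (fun ω => Y ω i * G t i (interp (X ω) (Y ω) D₀ D₁ t)) P :=
      fun i => (hYI i).mul_bdd (c := 2 * F) (hGI i).1
        (Filter.Eventually.of_forall fun ω => by simpa using hGb t ht.1.le i _)
    have hWI : ∀ i j, Integrable (fun ω => weightDeriv (f t) i j (interp (X ω) (Y ω) D₀ D₁ t)) P :=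
      fun i j => hbdd t (continuous_weightDeriv (f t) i j) fun v => abs_weightDeriv_le hff i j v
    have hA : Integrable (fun ω => avg (interp (X ω) (Y ω) D₀ D₁ t) (f' t)) P :=
      hbdd t (continuous_avg _) fun v => abs_avg_le (hf'b t ht.1.le)
    set U : ι → ι → ℝ := fun i j => ∫ ω, X ω i * X ω j ∂P - ∫ ω, Y ω i * Y ω j ∂P with hUdef
    -- Integration by parts produces factors √t and √(1 - t), which cancel those in 1/(2√t) and
    -- 1/(2√(1 - t)). The mixed covariances vanish, and half the difference of the two covariances
    -- is left.
    have hI1 : ∫ ω, F' t ω ∂P = ∫ ω, (avg (interp (X ω) (Y ω) D₀ D₁ t) (f' t)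
        + ∑ i, D₁ i * G t i (interp (X ω) (Y ω) D₀ D₁ t)
        + 1 / 2 * ∑ i, ∑ j, U i j * weightDeriv (f t) i j (interp (X ω) (Y ω) D₀ D₁ t)) ∂P := by
      have hL : ∀ i, Integrable (fun ω => G t i (interp (X ω) (Y ω) D₀ D₁ t)
          * (1 / (2 * Real.sqrt t) * X ω i - 1 / (2 * Real.sqrt (1 - t)) * Y ω i + D₁ i)) P :=
        fun i => by
          refine ((((hGX i).const_mul (1 / (2 * Real.sqrt t))).sub
            ((hGY i).const_mul (1 / (2 * Real.sqrt (1 - t))))).add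
            ((hGI i).const_mul (D₁ i))).congr (Filter.Eventually.of_forall fun ω => ?_)
          simp only [Pi.add_apply, Pi.sub_apply]; ring
      have hS : ∀ i, Integrable (fun ω => ∑ j, U i j *
          weightDeriv (f t) i j (interp (X ω) (Y ω) D₀ D₁ t)) P := fun i =>
        integrable_finsetSum _ fun j _ => (hWI i j).const_mul _
      have hDG : Integrable (fun ω => ∑ i, D₁ i * G t i (interp (X ω) (Y ω) D₀ D₁ t)) P :=
        integrable_finsetSum _ fun i _ => (hGI i).const_mul _
      rw [integral_add hA (integrable_finsetSum _ fun i _ => hL i), integral_add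
        (f := fun ω => avg (interp (X ω) (Y ω) D₀ D₁ t) (f' t)
          + ∑ i, D₁ i * G t i (interp (X ω) (Y ω) D₀ D₁ t)) (hA.add hDG)
        ((integrable_finsetSum _ fun i _ => hS i).const_mul _), integral_add hA hDG, add_assoc]
      congr 1
      rw [integral_finsetSum _ fun i _ => hL i, integral_finsetSum _ fun i _ =>
        (hGI i).const_mul _, integral_const_mul, integral_finsetSum _ fun i _ => hS i,
        Finset.mul_sum, ← Finset.sum_add_distrib]
      refine Finset.sum_congr rfl fun i _ => ?_
      have : ∀ ω, G t i (interp (X ω) (Y ω) D₀ D₁ t)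
          * (1 / (2 * Real.sqrt t) * X ω i - 1 / (2 * Real.sqrt (1 - t)) * Y ω i + D₁ i)
          = 1 / (2 * Real.sqrt t) * (X ω i * G t i (interp (X ω) (Y ω) D₀ D₁ t))
          - 1 / (2 * Real.sqrt (1 - t)) * (Y ω i * G t i (interp (X ω) (Y ω) D₀ D₁ t))
          + D₁ i * G t i (interp (X ω) (Y ω) D₀ D₁ t) := fun ω => by ring
      simp only [this]
      rw [integral_add (f := fun ω => 1 / (2 * Real.sqrt t)
          * (X ω i * G t i (interp (X ω) (Y ω) D₀ D₁ t))
          - 1 / (2 * Real.sqrt (1 - t)) * (Y ω i * G t i (interp (X ω) (Y ω) D₀ D₁ t)))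
          (((hGX i).const_mul _).sub ((hGY i).const_mul _)) ((hGI i).const_mul _),
        integral_sub ((hGX i).const_mul _) ((hGY i).const_mul _), integral_const_mul,
        integral_const_mul, ibpX, ibpY, add_comm]
      congr 1
      rw [integral_finsetSum _ fun j _ => (hWI i j).const_mul _, Finset.mul_sum, Finset.mul_sum,
        Finset.mul_sum, ← Finset.sum_sub_distrib]
      refine Finset.sum_congr rfl fun j _ => ?_
      rw [integral_const_mul]
      simp only [hUdef]
      field_simp
    rw [hI1, hφ, ← integral_const_mul]
    refine integral_mono ?_ ?_ fun ω => ?_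
    · exact (hA.add (integrable_finsetSum _ fun i _ => (hGI i).const_mul _)).add
        ((integrable_finsetSum _ fun i _ => integrable_finsetSum _ fun j _ =>
          (hWI i j).const_mul _).const_mul _)
    · exact (hbdd t (continuous_avg _) fun v => abs_avg_le hff).const_mul _
    -- The association inequality needs a nonnegative exponent; this is where `κ ≤ a` enters.
    · exact interpolation_pointwise_bound _ e D₁ U (s := a - κ * t)
        (by nlinarith [ht.2, ht.1]) he hU hD (f t) rfl
  have hφc : ContinuousOn φ (Set.Icc 0 1) := by
    refine continuousOn_of_dominated (bound := fun _ => F)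
      (fun s _ => hcomp s (continuous_avg _))
      (fun s hs => Filter.Eventually.of_forall fun ω => abs_avg_le (hfF s hs.1))
      (integrable_const _) (Filter.Eventually.of_forall fun ω => Continuous.continuousOn ?_)
    refine continuous_finsetSum _ fun i _ => ((continuous_weight i).comp
      (continuous_pi fun j => continuous_interp _ _ _ _ j)).mul ?_
    simp only [hf]; fun_prop
  -- Grönwall's argument: φ' ≤ κφ inside the interval, and continuity carries the conclusion to the
  -- end points.
  have hanti : AntitoneOn (fun s => Real.exp (-κ * s) * φ s) (Set.Icc 0 1) := by
    have hd' : ∀ s ∈ Set.Ioo (0 : ℝ) 1, HasDerivAt (fun s => Real.exp (-κ * s) * φ s)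
        (Real.exp (-κ * s) * (∫ ω, F' s ω ∂P - κ * φ s)) s := fun s hs => by
      have := (((hasDerivAt_id s).const_mul (-κ)).exp).mul (hder s hs)
      refine HasDerivAt.congr_deriv (f := fun s => Real.exp (-κ * s) * φ s) this ?_
      simp only [id]; ring
    refine antitoneOn_of_deriv_nonpos (convex_Icc 0 1) (by fun_prop) ?_ ?_
    · rw [interior_Icc]
      exact fun s hs => (hd' s hs).differentiableAt.differentiableWithinAt
    · rw [interior_Icc]
      intro s hs
      rw [(hd' s hs).deriv]
      exact mul_nonpos_of_nonneg_of_nonpos (Real.exp_pos _).le (sub_nonpos.2 (hbound s hs))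
  have h1 := hanti (Set.left_mem_Icc.2 zero_le_one) ht ht.1
  have hφ0 : 0 ≤ φ 0 := integral_nonneg fun ω => Finset.sum_nonneg fun i _ =>
    mul_nonneg (weight_nonneg _ i) (Real.exp_pos _).le
  have e0 : φ 0 = ∫ ω, avg (interp (X ω) (Y ω) D₀ D₁ 0) (fun i => Real.exp (a * e i)) ∂P := by
    simp [hφ, hf]
  rw [← e0]
  simp only [mul_zero, Real.exp_zero, one_mul] at h1
  show φ t ≤ _
  calc φ t = Real.exp (κ * t) * (Real.exp (-κ * t) * φ t) := by
        rw [← mul_assoc, ← Real.exp_add]; simp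
    _ ≤ Real.exp (κ * t) * φ 0 := mul_le_mul_of_nonneg_left h1 (Real.exp_pos _).le
    _ ≤ Real.exp κ * φ 0 := by
        refine mul_le_mul_of_nonneg_right (Real.exp_le_exp.2 ?_) hφ0
        nlinarith [ht.2]

end Interpolation

end SphericalSK

/-! ### Polar coordinates, and the uniform measure as a normalized Gaussian vector. -/

namespace SphericalSK

/-- Integration in polar coordinates. -/
theorem lintegral_polar {E : Type*} [NormedAddCommGroup E] [NormedSpace ℝ E] [MeasurableSpace E]
    [BorelSpace E] [FiniteDimensional ℝ E] [Nontrivial E] (μ : Measure E) [μ.IsAddHaarMeasure]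
    {K : E → ENNReal} (hK : Measurable K) :
    ∫⁻ x, K x ∂μ = ∫⁻ s, ∫⁻ r, K ((r : ℝ) • (s : E))
      ∂(Measure.volumeIoiPow (Module.finrank ℝ E - 1)) ∂μ.toSphere := by
  have h1 : ∫⁻ x, K x ∂μ = ∫⁻ x : ({0}ᶜ : Set E), K x ∂(μ.comap (↑)) := by
    rw [lintegral_subtype_comap (measurableSet_singleton _).compl, restrict_compl_singleton]
  have h2 := (μ.measurePreserving_homeomorphUnitSphereProd).lintegral_comp_emb
    (Homeomorph.measurableEmbedding _) (fun p => K ((p.2 : ℝ) • (p.1 : E)))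
  have h3 : ∀ x : ({0}ᶜ : Set E), K ((((homeomorphUnitSphereProd E) x).2 : ℝ) •
      (((homeomorphUnitSphereProd E) x).1 : E)) = K x := fun x => by
    rw [← homeomorphUnitSphereProd_symm_apply_coe, Homeomorph.symm_apply_apply]
  simp only [h3] at h2
  rw [h1, h2, lintegral_prod]
  exact (hK.comp ((measurable_subtype_coe.comp measurable_snd).smul
    (measurable_subtype_coe.comp measurable_fst))).aemeasurable

/-- The unnormalized Gaussian weight. -/
noncomputable def gaussWeight {E : Type*} [Norm E] (x : E) : ENNReal :=
  ENNReal.ofReal (Real.exp (-(‖x‖ ^ 2) / 2))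

theorem measurable_gaussWeight {E : Type*} [NormedAddCommGroup E] [MeasurableSpace E]
    [OpensMeasurableSpace E] : Measurable (gaussWeight (E := E)) := by
  unfold gaussWeight; fun_prop

theorem lintegral_exp_neg_mul_sq_norm (E : Type*) [NormedAddCommGroup E] [InnerProductSpace ℝ E]
    [FiniteDimensional ℝ E] [MeasurableSpace E] [BorelSpace E] {b : ℝ} (hb : 0 < b) :
    ∫⁻ x : E, ENNReal.ofReal (Real.exp (-b * ‖x‖ ^ 2))
      = ENNReal.ofReal ((Real.pi / b) ^ ((Module.finrank ℝ E : ℝ) / 2)) := by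
  have h := GaussianFourier.integral_rexp_neg_mul_sq_norm (V := E) hb
  rw [← h, ofReal_integral_eq_lintegral_ofReal]
  -- The known value of the integral is positive, whereas the integral of a non-integrable function
  -- is 0 by convention.
  · by_contra hn
    rw [integral_undef hn] at h
    have : 0 < (Real.pi / b) ^ ((Module.finrank ℝ E : ℝ) / 2) := by positivity
    exact this.ne h
  · exact Filter.Eventually.of_forall fun x => (Real.exp_pos _).le

theorem lintegral_gaussWeight (E : Type*) [NormedAddCommGroup E] [InnerProductSpace ℝ E]
    [FiniteDimensional ℝ E] [MeasurableSpace E] [BorelSpace E] :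
    ∫⁻ x : E, gaussWeight x = ENNReal.ofReal ((2 * Real.pi) ^ ((Module.finrank ℝ E : ℝ) / 2)) := by
  have := lintegral_exp_neg_mul_sq_norm E (b := 1 / 2) (by norm_num)
  rw [show Real.pi / (1 / 2) = 2 * Real.pi by ring] at this
  rw [← this]
  refine lintegral_congr fun x => ?_
  rw [gaussWeight]; congr 2; ring

theorem measurable_dilate (N : ℕ) : Measurable (dilate N) := by
  unfold dilate
  exact Measurable.subtype_mk (by fun_prop)

/-- The uniform measure on the sphere is the law of the normalization of a Gaussian vector. -/
theorem lintegral_unif {N : ℕ} (hN : 1 ≤ N) {F : EuclideanSpace ℝ (Fin N) → ENNReal}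
    (hF : Measurable F) :
    (∫⁻ x : EuclideanSpace ℝ (Fin N), gaussWeight x) * ∫⁻ σ, F σ.1 ∂unif N
      = ∫⁻ x : EuclideanSpace ℝ (Fin N), F ((Real.sqrt N / ‖x‖) • x) * gaussWeight x := by
  have : Nonempty (Fin N) := ⟨⟨0, hN⟩⟩
  set S := (volume : Measure (EuclideanSpace ℝ (Fin N))).toSphere with hS
  set ρ := Measure.volumeIoiPow (Module.finrank ℝ (EuclideanSpace ℝ (Fin N)) - 1) with hρ
  set W : ENNReal := ∫⁻ r : Set.Ioi (0 : ℝ), ENNReal.ofReal (Real.exp (-(r : ℝ) ^ 2 / 2)) ∂ρ with hW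
  have hw : ∀ (s : Metric.sphere (0 : EuclideanSpace ℝ (Fin N)) 1) (r : Set.Ioi (0 : ℝ)),
      gaussWeight ((r : ℝ) • (s : EuclideanSpace ℝ (Fin N)))
        = ENNReal.ofReal (Real.exp (-(r : ℝ) ^ 2 / 2)) := fun s r => by
    rw [gaussWeight, norm_smul, norm_eq_of_mem_sphere s, mul_one, Real.norm_eq_abs, sq_abs]
  have hd : ∀ (s : Metric.sphere (0 : EuclideanSpace ℝ (Fin N)) 1) (r : Set.Ioi (0 : ℝ)),
      (Real.sqrt N / ‖(r : ℝ) • (s : EuclideanSpace ℝ (Fin N))‖) • ((r : ℝ) •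
        (s : EuclideanSpace ℝ (Fin N))) = (dilate N s).1 := fun s r => by
    have hr : (0 : ℝ) < r := r.2
    rw [norm_smul, norm_eq_of_mem_sphere s, mul_one, Real.norm_eq_abs, abs_of_pos hr, smul_smul,
      div_mul_cancel₀ _ hr.ne']
    rfl
  -- In polar coordinates the Gaussian weight depends only on the radius and the normalized vector
  -- only on the direction, so both integrals contain the same radial factor `W`.
  have h1 : ∫⁻ x : EuclideanSpace ℝ (Fin N), gaussWeight x = S Set.univ * W := by
    rw [lintegral_polar volume measurable_gaussWeight]
    simp only [hw, ← hρ, ← hS, ← hW]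
    rw [lintegral_const, mul_comm]
  have h2 : ∫⁻ x : EuclideanSpace ℝ (Fin N), F ((Real.sqrt N / ‖x‖) • x) * gaussWeight x
      = (∫⁻ s, F (dilate N s).1 ∂S) * W := by
    have hm : Measurable fun x : EuclideanSpace ℝ (Fin N) =>
        F ((Real.sqrt N / ‖x‖) • x) * gaussWeight x :=
      (hF.comp (f := fun x : EuclideanSpace ℝ (Fin N) => (Real.sqrt N / ‖x‖) • x)
        (by fun_prop)).mul measurable_gaussWeight
    rw [lintegral_polar volume hm]
    simp only [hw, hd, ← hρ, ← hS]
    have hm' : Measurable fun s => F (dilate N s).1 :=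
      hF.comp (measurable_subtype_coe.comp (measurable_dilate N))
    rw [← lintegral_mul_const _ hm']
    refine lintegral_congr fun s => ?_
    rw [lintegral_const_mul _ (by fun_prop)]
  have h3 : ∫⁻ σ, F σ.1 ∂unif N = (S Set.univ)⁻¹ * ∫⁻ s, F (dilate N s).1 ∂S := by
    have hm : Measurable fun σ : Config N => F σ.1 := hF.comp measurable_subtype_coe
    rw [unif, lintegral_map hm (measurable_dilate N), lintegral_smul_measure]
    rfl
  have hS0 : S Set.univ ≠ 0 := by
    rw [hS, Ne, Measure.measure_univ_eq_zero]; exact Measure.toSphere_ne_zero _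
  rw [h1, h2, h3]
  calc S Set.univ * W * ((S Set.univ)⁻¹ * ∫⁻ s, F (dilate N s).1 ∂S)
      = (S Set.univ * (S Set.univ)⁻¹) * ((∫⁻ s, F (dilate N s).1 ∂S) * W) := by ring
    _ = _ := by rw [ENNReal.mul_inv_cancel hS0 (measure_ne_top _ _), one_mul]

theorem isProbabilityMeasure_unif {N : ℕ} (hN : 1 ≤ N) : IsProbabilityMeasure (unif N) := by
  have : Nonempty (Fin N) := ⟨⟨0, hN⟩⟩
  rw [unif]
  have h : IsProbabilityMeasure
      (((volume : Measure (EuclideanSpace ℝ (Fin N))).toSphere Set.univ)⁻¹ •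
      (volume : Measure (EuclideanSpace ℝ (Fin N))).toSphere) := ⟨by
    rw [Measure.smul_apply, smul_eq_mul, ENNReal.inv_mul_cancel _ (measure_ne_top _ _)]
    rw [Ne, Measure.measure_univ_eq_zero]; exact Measure.toSphere_ne_zero _⟩
  exact Measure.isProbabilityMeasure_map (measurable_dilate N).aemeasurable


/-- The vector of `ℝ^(M+1)` with first coordinates `u` and last coordinate `y`. -/
noncomputable def snocVec {M : ℕ} (u : EuclideanSpace ℝ (Fin M)) (y : ℝ) : EuclideanSpace ℝ (Fin (M + 1)) :=
  WithLp.toLp 2 (Fin.snoc (α := fun _ => ℝ) u.ofLp y)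

theorem lintegral_snocVec {M : ℕ} {F : EuclideanSpace ℝ (Fin (M + 1)) → ENNReal}
    (hF : Measurable F) :
    ∫⁻ x, F x = ∫⁻ y : ℝ, ∫⁻ u : EuclideanSpace ℝ (Fin M), F (snocVec u y) := by
  have h1 := (PiLp.volume_preserving_toLp (Fin (M + 1))).lintegral_comp hF
  have h2 := (volume_preserving_piFinSuccAbove (fun _ : Fin (M + 1) => ℝ) (Fin.last M)).symm
  have h3 := h2.lintegral_comp (hF.comp (WithLp.measurable_toLp 2 (Fin (M + 1) → ℝ)))
  have h5 : ∀ y : ℝ, ∫⁻ u : EuclideanSpace ℝ (Fin M), F (snocVec u y)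
      = ∫⁻ v : Fin M → ℝ, F (WithLp.toLp 2 (Fin.snoc (α := fun _ => ℝ) v y)) := fun y => by
    have hm : Measurable fun u : EuclideanSpace ℝ (Fin M) => F (snocVec u y) := by
      refine hF.comp ((WithLp.measurable_toLp 2 _).comp ?_)
      refine measurable_pi_lambda _ fun i => ?_
      refine Fin.lastCases ?_ (fun j => ?_) i
      · simp
      · simp only [Fin.snoc_castSucc]; fun_prop
    rw [← (PiLp.volume_preserving_toLp (Fin M)).lintegral_comp hm]
    rfl
  rw [← h1]
  refine h3.symm.trans ?_
  rw [Measure.volume_eq_prod, lintegral_prod]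
  · refine lintegral_congr fun y => ?_
    rw [h5]
    refine lintegral_congr fun v => ?_
    simp only [Function.comp]
    congr 2
    simp [Fin.snocEquiv]
  · exact ((hF.comp (WithLp.measurable_toLp 2 (Fin (M + 1) → ℝ))).comp
      (MeasurableEquiv.measurable _)).aemeasurable

theorem norm_sq_snocVec {M : ℕ} (u : EuclideanSpace ℝ (Fin M)) (y : ℝ) :
    ‖snocVec u y‖ ^ 2 = ‖u‖ ^ 2 + y ^ 2 := by
  rw [EuclideanSpace.norm_sq_eq, EuclideanSpace.norm_sq_eq, Fin.sum_univ_castSucc]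
  simp [snocVec]

theorem gaussWeight_snocVec {M : ℕ} (u : EuclideanSpace ℝ (Fin M)) (y : ℝ) :
    gaussWeight (snocVec u y) = gaussWeight u * ENNReal.ofReal (Real.exp (-(y ^ 2) / 2)) := by
  rw [gaussWeight, gaussWeight, norm_sq_snocVec, ← ENNReal.ofReal_mul (Real.exp_pos _).le,
    ← Real.exp_add]
  congr 2; ring

/-- The map `σ ↦ σ̂` on the whole space. -/
noncomputable def hatMap {M : ℕ} (x : EuclideanSpace ℝ (Fin (M + 1))) : EuclideanSpace ℝ (Fin M) :=
  WithLp.toLp 2 fun i => x i.castSucc /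
    Real.sqrt ((((M + 1 : ℕ) : ℝ) - x (Fin.last M) ^ 2) / M)

theorem measurable_hatMap {M : ℕ} : Measurable (hatMap (M := M)) :=
  (WithLp.measurable_toLp 2 _).comp (measurable_pi_lambda _ fun i => by fun_prop)

/-- If x is the normalization of (u, y) to length √(M+1), then M + 1 minus the square of its last
coordinate is (M+1)‖u‖²/(‖u‖² + y²). Division by the scale therefore removes both `y` and ‖u‖,
leaving the direction of `u`: this is the source of the independence of σ̂ and ε. -/
theorem hatMap_normalize {M : ℕ} (hM : 1 ≤ M) {u : EuclideanSpace ℝ (Fin M)} (hu : u ≠ 0) (y : ℝ) :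
    hatMap ((Real.sqrt (M + 1 : ℕ) / ‖snocVec u y‖) • snocVec u y) = (Real.sqrt M / ‖u‖) • u := by
  have hu' : 0 < ‖u‖ := norm_pos_iff.2 hu
  have hM' : (0 : ℝ) < M := by exact_mod_cast hM
  have hn := norm_sq_snocVec u y
  have hs : 0 < ‖snocVec u y‖ := by
    refine (norm_nonneg _).lt_of_ne fun h => ?_
    rw [← h] at hn; nlinarith
  have hN : (0 : ℝ) < Real.sqrt (M + 1 : ℕ) := Real.sqrt_pos.2 (by positivity)
  have hN2 : Real.sqrt (M + 1 : ℕ) ^ 2 = (M + 1 : ℕ) := Real.sq_sqrt (by positivity)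
  ext i
  simp only [hatMap, PiLp.smul_apply, smul_eq_mul, PiLp.toLp_apply]
  have e1 : (((M + 1 : ℕ) : ℝ) - (Real.sqrt (M + 1 : ℕ) / ‖snocVec u y‖
      * (snocVec u y) (Fin.last M)) ^ 2) / M
      = (Real.sqrt (M + 1 : ℕ) * ‖u‖ / (Real.sqrt M * ‖snocVec u y‖)) ^ 2 := by
    have : (snocVec u y) (Fin.last M) = y := by simp [snocVec]
    rw [this, mul_pow, div_pow, div_pow, mul_pow, mul_pow, hN2, Real.sq_sqrt hM'.le]
    field_simp
    linarith
  rw [e1, Real.sqrt_sq (by positivity)]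
  have : (snocVec u y) i.castSucc = u i := by simp [snocVec]
  rw [this]
  have := Real.sqrt_pos.2 hM'
  field_simp

end SphericalSK

/-! ### The joint law of the rescaled vector and the last spin. -/

namespace SphericalSK

theorem ae_ne_zero_euclidean {M : ℕ} (hM : 1 ≤ M) :
    ∀ᵐ u : EuclideanSpace ℝ (Fin M), u ≠ 0 := by
  have : Nonempty (Fin M) := ⟨⟨0, hM⟩⟩
  have := compl_mem_ae_iff.2 (measure_singleton (μ := (volume : Measure (EuclideanSpace ℝ (Fin M)))) 0)
  filter_upwards [this] with u hu
  exact hu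

theorem norm_snocVec {M : ℕ} (u : EuclideanSpace ℝ (Fin M)) (y : ℝ) :
    ‖snocVec u y‖ = Real.sqrt (‖u‖ ^ 2 + y ^ 2) := by
  rw [← norm_sq_snocVec, Real.sqrt_sq (norm_nonneg _)]

theorem measurable_lastSpin {M : ℕ} : Measurable (lastSpin (M := M)) := by
  unfold lastSpin; fun_prop

theorem measurable_hatVec {M : ℕ} : Measurable (hatVec (M := M)) :=
  measurable_hatMap.comp measurable_subtype_coe

/-- Factorization of integrals of functions of `σ̂` and of the last spin. -/
theorem exists_lintegral_unif_hat_last {M : ℕ} (hM : 1 ≤ M) :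
    ∃ (I : (EuclideanSpace ℝ (Fin M) → ENNReal) → ENNReal) (J : (ℝ → ENNReal) → ENNReal),
      ∀ A B, Measurable A → Measurable B →
        (∫⁻ x : EuclideanSpace ℝ (Fin (M + 1)), gaussWeight x) *
          ∫⁻ σ, A (hatVec σ) * B (lastSpin σ) ∂unif (M + 1) = I A * J B := by
  have : Nonempty (Fin M) := ⟨⟨0, hM⟩⟩
  set S := (volume : Measure (EuclideanSpace ℝ (Fin M))).toSphere with hS
  set ρ := Measure.volumeIoiPow (Module.finrank ℝ (EuclideanSpace ℝ (Fin M)) - 1) with hρ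
  set k : ℝ → ℝ → ℝ := fun r y => Real.sqrt (M + 1 : ℕ) / Real.sqrt (r ^ 2 + y ^ 2) * y with hk
  -- Write the Gaussian vector as (r s, y) with `s` on the unit sphere of ℝ^M. Then σ̂ = √M s
  -- depends on `s` alone and the last spin `k r y` on (r, y) alone, while the Gaussian weight does
  -- not depend on `s`.
  refine ⟨fun A => ∫⁻ s, A (Real.sqrt M • s.1) ∂S, fun B => ∫⁻ y : ℝ, (∫⁻ r : Set.Ioi (0 : ℝ),
    B (k r y) * ENNReal.ofReal (Real.exp (-((r : ℝ) ^ 2) / 2)) ∂ρ)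
      * ENNReal.ofReal (Real.exp (-(y ^ 2) / 2)), fun A B hA hB => ?_⟩
  have hF : Measurable fun x : EuclideanSpace ℝ (Fin (M + 1)) => A (hatMap x) * B (x (Fin.last M)) :=
    (hA.comp measurable_hatMap).mul (hB.comp (by fun_prop))
  have h1 := lintegral_unif (Nat.succ_pos M) hF
  refine h1.trans ?_
  have hm : Measurable fun x : EuclideanSpace ℝ (Fin (M + 1)) =>
      A (hatMap ((Real.sqrt (M + 1 : ℕ) / ‖x‖) • x)) *
        B (((Real.sqrt (M + 1 : ℕ) / ‖x‖) • x) (Fin.last M)) * gaussWeight x :=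
    (hF.comp (f := fun x : EuclideanSpace ℝ (Fin (M + 1)) => (Real.sqrt (M + 1 : ℕ) / ‖x‖) • x)
      (by fun_prop)).mul measurable_gaussWeight
  rw [lintegral_snocVec hm, ← lintegral_const_mul]
  · refine lintegral_congr fun y => ?_
    have e1 : ∫⁻ u : EuclideanSpace ℝ (Fin M),
        A (hatMap ((Real.sqrt (M + 1 : ℕ) / ‖snocVec u y‖) • snocVec u y)) *
        B (((Real.sqrt (M + 1 : ℕ) / ‖snocVec u y‖) • snocVec u y) (Fin.last M))
          * gaussWeight (snocVec u y)
        = ∫⁻ u : EuclideanSpace ℝ (Fin M), A ((Real.sqrt M / ‖u‖) • u) * B (k ‖u‖ y) *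
          (gaussWeight u * ENNReal.ofReal (Real.exp (-(y ^ 2) / 2))) := by
      refine lintegral_congr_ae ?_
      filter_upwards [ae_ne_zero_euclidean hM] with u hu
      rw [hatMap_normalize hM hu, gaussWeight_snocVec]
      congr 3
      simp only [hk, ← norm_snocVec, PiLp.smul_apply, smul_eq_mul]
      simp [snocVec]
    rw [e1]
    have hkm : Measurable fun r : ℝ => B (k r y) := hB.comp (by simp only [hk]; fun_prop)
    have hm2 : Measurable fun u : EuclideanSpace ℝ (Fin M) =>
        A ((Real.sqrt M / ‖u‖) • u) * B (k ‖u‖ y) *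
          (gaussWeight u * ENNReal.ofReal (Real.exp (-(y ^ 2) / 2))) :=
      ((hA.comp (f := fun u : EuclideanSpace ℝ (Fin M) => (Real.sqrt M / ‖u‖) • u)
        (by fun_prop)).mul (hkm.comp measurable_norm)).mul
        (measurable_gaussWeight.mul_const _)
    rw [lintegral_polar volume hm2, ← hS, ← hρ, ← lintegral_mul_const]
    · refine lintegral_congr fun s => ?_
      rw [mul_comm (A _), mul_assoc, mul_comm _ (A _), ← mul_assoc, mul_comm _ (A _), mul_assoc,
        ← lintegral_mul_const, ← lintegral_const_mul]
      · refine lintegral_congr fun r => ?_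
        have hr : (0 : ℝ) < r := r.2
        have hn : ‖(r : ℝ) • (s : EuclideanSpace ℝ (Fin M))‖ = r := by
          rw [norm_smul, norm_eq_of_mem_sphere s, mul_one, Real.norm_eq_abs, abs_of_pos hr]
        rw [gaussWeight, hn, smul_smul, div_mul_cancel₀ _ hr.ne']
        ring
      · fun_prop
      · fun_prop
    · exact hA.comp (by fun_prop)
  · refine Measurable.mul (Measurable.lintegral_prod_right ?_) (by fun_prop)
    refine Measurable.mul (hB.comp ?_) (by fun_prop)
    simp only [hk]; fun_prop

theorem lintegral_gaussWeight_ne (E : Type*) [NormedAddCommGroup E] [InnerProductSpace ℝ E]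
    [FiniteDimensional ℝ E] [MeasurableSpace E] [BorelSpace E] :
    ∫⁻ x : E, gaussWeight x ≠ 0 ∧ ∫⁻ x : E, gaussWeight x ≠ ⊤ := by
  rw [lintegral_gaussWeight]
  refine ⟨?_, ENNReal.ofReal_ne_top⟩
  rw [Ne, ENNReal.ofReal_eq_zero, not_le]
  positivity

/-- Under the uniform measure, `σ̂` and the last spin are independent. -/
theorem indepFun_hatVec_lastSpin {M : ℕ} (hM : 1 ≤ M) :
    IndepFun (hatVec (M := M)) lastSpin (unif (M + 1)) := by
  have := isProbabilityMeasure_unif (Nat.succ_pos M)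
  obtain ⟨I, J, h⟩ := exists_lintegral_unif_hat_last hM
  obtain ⟨hT0, hT1⟩ := lintegral_gaussWeight_ne (EuclideanSpace ℝ (Fin (M + 1)))
  set T := ∫⁻ x : EuclideanSpace ℝ (Fin (M + 1)), gaussWeight x
  rw [indepFun_iff_measure_inter_preimage_eq_mul]
  intro s t hs ht
  have hst := h (s.indicator 1) (t.indicator 1) (measurable_one.indicator hs)
    (measurable_one.indicator ht)
  have hs1 := h (s.indicator 1) (fun _ => 1) (measurable_one.indicator hs) measurable_const
  have ht1 := h (fun _ => 1) (t.indicator 1) measurable_const (measurable_one.indicator ht)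
  have h11 := h (fun _ => 1) (fun _ => 1) measurable_const measurable_const
  have i1 : ∫⁻ σ, s.indicator 1 (hatVec σ) * t.indicator 1 (lastSpin σ) ∂unif (M + 1)
      = unif (M + 1) (hatVec ⁻¹' s ∩ lastSpin ⁻¹' t) := by
    rw [← lintegral_indicator_one ((measurable_hatVec hs).inter (measurable_lastSpin ht))]
    refine lintegral_congr fun σ => ?_
    by_cases h1 : hatVec σ ∈ s <;> by_cases h2 : lastSpin σ ∈ t <;> simp [h1, h2]
  have i2 : ∫⁻ σ, s.indicator 1 (hatVec σ) * 1 ∂unif (M + 1) = unif (M + 1) (hatVec ⁻¹' s) := by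
    rw [← lintegral_indicator_one (measurable_hatVec hs)]
    refine lintegral_congr fun σ => ?_
    by_cases h1 : hatVec σ ∈ s <;> simp [h1]
  have i3 : ∫⁻ σ, 1 * t.indicator 1 (lastSpin σ) ∂unif (M + 1) = unif (M + 1) (lastSpin ⁻¹' t) := by
    rw [← lintegral_indicator_one (measurable_lastSpin ht)]
    refine lintegral_congr fun σ => ?_
    by_cases h2 : lastSpin σ ∈ t <;> simp [h2]
  rw [i1] at hst
  rw [i2] at hs1
  rw [i3] at ht1
  simp only [mul_one, lintegral_one, measure_univ] at h11
  -- `I` and `J` are not normalized. The identity I(A)J(B) · I(1)J(1) = I(A)J(1) · I(1)J(B) gives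
  -- the product formula without computing them.
  have key : T * T * unif (M + 1) (hatVec ⁻¹' s ∩ lastSpin ⁻¹' t)
      = T * T * (unif (M + 1) (hatVec ⁻¹' s) * unif (M + 1) (lastSpin ⁻¹' t)) := by
    calc _ = T * (T * unif (M + 1) (hatVec ⁻¹' s ∩ lastSpin ⁻¹' t)) := by ring
      _ = (I (s.indicator 1) * J fun _ => 1) * ((I fun _ => 1) * J (t.indicator 1)) := by
        rw [hst, h11]; ring
      _ = _ := by rw [← hs1, ← ht1]; ring
  exact (ENNReal.mul_right_inj (mul_ne_zero hT0 hT0) (ENNReal.mul_ne_top hT1 hT1)).1 key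

theorem sq_lastSpin_le {M : ℕ} (σ : Config (M + 1)) : lastSpin σ ^ 2 ≤ (M + 1 : ℕ) := by
  have h : ‖σ.1‖ ^ 2 = (M + 1 : ℕ) := by
    rw [mem_sphere_zero_iff_norm.1 σ.2, Real.sq_sqrt (by positivity)]
  rw [← h, EuclideanSpace.norm_sq_eq]
  have := Finset.single_le_sum (f := fun i => ‖σ.1 i‖ ^ 2) (fun i _ => by positivity)
    (Finset.mem_univ (Fin.last M))
  simpa [lastSpin] using this

/-- Where the scale vanishes, division by zero makes `hatVec σ` equal to 0, while for a normalized
Gaussian vector it almost surely has norm √M > 0. -/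
theorem ae_scale_pos {M : ℕ} (hM : 1 ≤ M) : ∀ᵐ σ ∂unif (M + 1), 0 < scale σ := by
  obtain ⟨hT0, hT1⟩ := lintegral_gaussWeight_ne (EuclideanSpace ℝ (Fin (M + 1)))
  set s : Set (EuclideanSpace ℝ (Fin (M + 1))) := {x | hatMap x = 0} with hs
  have hsm : MeasurableSet s := measurable_hatMap (measurableSet_singleton 0)
  have h := lintegral_unif (Nat.succ_pos M) (F := s.indicator 1) (measurable_one.indicator hsm)
  have hm : Measurable fun x : EuclideanSpace ℝ (Fin (M + 1)) =>
      s.indicator (1 : EuclideanSpace ℝ (Fin (M + 1)) → ENNReal) ((Real.sqrt (M + 1 : ℕ) / ‖x‖) • x) * gaussWeight x :=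
    ((measurable_one.indicator hsm).comp
      (f := fun x : EuclideanSpace ℝ (Fin (M + 1)) => (Real.sqrt (M + 1 : ℕ) / ‖x‖) • x)
      (by fun_prop)).mul measurable_gaussWeight
  rw [lintegral_snocVec hm] at h
  have h0 : ∀ y : ℝ, ∫⁻ u : EuclideanSpace ℝ (Fin M), s.indicator (1 : EuclideanSpace ℝ (Fin (M + 1)) → ENNReal)
      ((Real.sqrt (M + 1 : ℕ) / ‖snocVec u y‖) • snocVec u y) * gaussWeight (snocVec u y) = 0 := by
    intro y
    refine (lintegral_congr_ae ?_).trans lintegral_zero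
    filter_upwards [ae_ne_zero_euclidean hM] with u hu
    rw [Set.indicator_of_notMem, zero_mul]
    · simp only [hs, Set.mem_ofPred_eq, hatMap_normalize hM hu, smul_eq_zero, hu, or_false]
      have h1 : 0 < Real.sqrt M := Real.sqrt_pos.2 (by exact_mod_cast hM)
      have h2 : 0 < ‖u‖ := norm_pos_iff.2 hu
      positivity
  simp only [h0, lintegral_zero, mul_eq_zero, hT0, false_or] at h
  have h2 : ∫⁻ σ : Config (M + 1), s.indicator (1 : EuclideanSpace ℝ (Fin (M + 1)) → ENNReal) σ.1 ∂unif (M + 1)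
      = unif (M + 1) ((fun σ : Config (M + 1) => σ.1) ⁻¹' s) := by
    rw [← lintegral_indicator_one (measurable_subtype_coe hsm)]
    rfl
  rw [h2] at h
  rw [ae_iff]
  refine measure_mono_null (fun σ hσ => ?_) h
  have hz : scale σ = 0 := le_antisymm (not_lt.1 hσ) (Real.sqrt_nonneg _)
  show hatVec σ = 0
  ext i
  simp [hatVec, hz]

/-- The exponential square moment of the last spin is bounded by that of a Gaussian. -/
theorem lintegral_exp_sq_lastSpin {M : ℕ} :
    ∫⁻ σ, ENNReal.ofReal (Real.exp (1 / 4 * lastSpin σ ^ 2)) ∂unif (M + 1) ≤ 2 := by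
  obtain ⟨hT0, hT1⟩ := lintegral_gaussWeight_ne (EuclideanSpace ℝ (Fin (M + 1)))
  set S := (volume : Measure (EuclideanSpace ℝ (Fin (M + 1)))).toSphere with hS
  set ρ := Measure.volumeIoiPow (Module.finrank ℝ (EuclideanSpace ℝ (Fin (M + 1))) - 1) with hρ
  have hS0 : S Set.univ ≠ 0 := by
    rw [hS, Ne, Measure.measure_univ_eq_zero]; exact Measure.toSphere_ne_zero _
  have hF : Measurable fun x : EuclideanSpace ℝ (Fin (M + 1)) =>
      ENNReal.ofReal (Real.exp (1 / 4 * x (Fin.last M) ^ 2)) := by fun_prop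
  have hFm : Measurable fun x : EuclideanSpace ℝ (Fin (M + 1)) =>
      ENNReal.ofReal (Real.exp (1 / 4 * x (Fin.last M) ^ 2)) * gaussWeight x :=
    hF.mul measurable_gaussWeight
  have hrad : ∀ a : ℝ, a < 1 / 2 →
      S Set.univ * ∫⁻ r : Set.Ioi (0 : ℝ), ENNReal.ofReal (Real.exp (-(1 / 2 - a) * (r : ℝ) ^ 2)) ∂ρ
        = ENNReal.ofReal ((Real.pi / (1 / 2 - a)) ^ (((M + 1 : ℕ) : ℝ) / 2)) := fun a ha => by
    have h := lintegral_exp_neg_mul_sq_norm (EuclideanSpace ℝ (Fin (M + 1))) (sub_pos.2 ha)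
    rw [finrank_euclideanSpace_fin, lintegral_polar volume (by fun_prop), ← hS, ← hρ] at h
    rw [← h, mul_comm, ← lintegral_const]
    refine lintegral_congr fun s => lintegral_congr fun r => ?_
    rw [norm_smul, norm_eq_of_mem_sphere s, mul_one, Real.norm_eq_abs, sq_abs]
  -- This is Jensen's inequality exp(a E r²) ≤ E exp(a r²) for the radius of a standard Gaussian
  -- vector, where E r² = M + 1. Both sides are explicit by `hrad`, and it reduces to 1 - 2a ≤
  -- exp(-2a).
  have hjensen : ∀ a : ℝ, 0 ≤ a → a < 1 / 2 →
      ENNReal.ofReal (Real.exp (a * (M + 1 : ℕ)))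
        * ∫⁻ r : Set.Ioi (0 : ℝ), ENNReal.ofReal (Real.exp (-(1 / 2 - 0) * (r : ℝ) ^ 2)) ∂ρ
      ≤ ∫⁻ r : Set.Ioi (0 : ℝ), ENNReal.ofReal (Real.exp (-(1 / 2 - a) * (r : ℝ) ^ 2)) ∂ρ := by
    intro a ha0 ha
    rw [← ENNReal.mul_le_mul_iff_right hS0 (measure_ne_top S _), hrad a ha, mul_left_comm,
      hrad 0 (by norm_num), ← ENNReal.ofReal_mul (Real.exp_pos _).le]
    refine ENNReal.ofReal_le_ofReal ?_
    have e1 : Real.exp (a * (M + 1 : ℕ)) = Real.exp (2 * a) ^ (((M + 1 : ℕ) : ℝ) / 2) := by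
      rw [← Real.exp_mul]; congr 1; ring
    rw [e1, ← Real.mul_rpow (Real.exp_pos _).le (by positivity)]
    refine Real.rpow_le_rpow (by positivity) ?_ (by positivity)
    have h2 : 1 - 2 * a ≤ Real.exp (-(2 * a)) := by linarith [Real.add_one_le_exp (-(2 * a))]
    rw [le_div_iff₀ (by linarith)]
    have h3 : Real.exp (2 * a) * Real.exp (-(2 * a)) = 1 := by rw [← Real.exp_add]; simp
    have h4 := mul_le_mul_of_nonneg_left h2 (Real.exp_pos (2 * a)).le
    rw [h3] at h4
    rw [show Real.exp (2 * a) * (Real.pi / (1 / 2 - 0)) * (1 / 2 - a)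
      = Real.pi * (Real.exp (2 * a) * (1 - 2 * a)) by ring]
    exact mul_le_of_le_one_right Real.pi_pos.le h4
  -- For a unit direction with last coordinate y, the last spin has square (M+1)y² and the Gaussian
  -- coordinate has square r²y². Jensen with a = y²/4 ≤ 1/4 compares them direction by direction.
  have hcomp : (∫⁻ x : EuclideanSpace ℝ (Fin (M + 1)), gaussWeight x) *
      ∫⁻ σ, ENNReal.ofReal (Real.exp (1 / 4 * lastSpin σ ^ 2)) ∂unif (M + 1)
      ≤ ∫⁻ x : EuclideanSpace ℝ (Fin (M + 1)),
        ENNReal.ofReal (Real.exp (1 / 4 * x (Fin.last M) ^ 2)) * gaussWeight x := by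
    refine (lintegral_unif (Nat.succ_pos M) hF).le.trans ?_
    have hm : Measurable fun x : EuclideanSpace ℝ (Fin (M + 1)) => ENNReal.ofReal
        (Real.exp (1 / 4 * ((Real.sqrt (M + 1 : ℕ) / ‖x‖) • x) (Fin.last M) ^ 2)) * gaussWeight x :=
      (hF.comp (f := fun x : EuclideanSpace ℝ (Fin (M + 1)) => (Real.sqrt (M + 1 : ℕ) / ‖x‖) • x)
        (by fun_prop)).mul measurable_gaussWeight
    rw [lintegral_polar volume hm, lintegral_polar volume hFm, ← hS, ← hρ]
    refine lintegral_mono fun s => ?_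
    set y := s.1 (Fin.last M) with hy
    have hy1 : y ^ 2 ≤ 1 := by
      have h1 : ‖s.1‖ ^ 2 = 1 := by rw [norm_eq_of_mem_sphere s, one_pow]
      rw [← h1, EuclideanSpace.norm_sq_eq]
      have := Finset.single_le_sum (f := fun i => ‖s.1 i‖ ^ 2) (fun i _ => by positivity)
        (Finset.mem_univ (Fin.last M))
      simpa [hy] using this
    have hj := hjensen (1 / 4 * y ^ 2) (by positivity) (by linarith)
    refine le_trans (le_of_eq ?_) (hj.trans (le_of_eq ?_))
    · rw [← lintegral_const_mul _ (by fun_prop)]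
      refine lintegral_congr fun r => ?_
      have hr : (0 : ℝ) < r := r.2
      rw [gaussWeight, norm_smul, norm_eq_of_mem_sphere s, mul_one, Real.norm_eq_abs, abs_of_pos hr,
        smul_smul, div_mul_cancel₀ _ hr.ne', PiLp.smul_apply, smul_eq_mul, ← hy, mul_pow,
        Real.sq_sqrt (by positivity)]
      congr 3 <;> ring
    · refine lintegral_congr fun r => ?_
      simp only [gaussWeight]
      rw [norm_smul, norm_eq_of_mem_sphere s, mul_one, Real.norm_eq_abs, sq_abs,
        PiLp.smul_apply, smul_eq_mul, ← hy, ← ENNReal.ofReal_mul (Real.exp_pos _).le, ← Real.exp_add]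
      congr 2; ring
  rw [← ENNReal.mul_le_mul_iff_right hT0 hT1]
  refine hcomp.trans ?_
  rw [lintegral_snocVec hFm]
  have e1 : ∀ (y : ℝ), ∫⁻ u : EuclideanSpace ℝ (Fin M), ENNReal.ofReal
      (Real.exp (1 / 4 * (snocVec u y) (Fin.last M) ^ 2)) * gaussWeight (snocVec u y)
      = (∫⁻ u : EuclideanSpace ℝ (Fin M), gaussWeight u)
        * ENNReal.ofReal (Real.exp (-(1 / 4) * ‖y‖ ^ 2)) := fun y => by
    rw [← lintegral_mul_const _ measurable_gaussWeight]
    refine lintegral_congr fun u => ?_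
    have : (snocVec u y) (Fin.last M) = y := by simp [snocVec]
    rw [this, gaussWeight_snocVec, mul_left_comm, ← ENNReal.ofReal_mul (Real.exp_pos _).le,
      ← Real.exp_add, Real.norm_eq_abs, sq_abs]
    congr 3; ring
  simp only [e1]
  rw [lintegral_const_mul _ (by fun_prop), lintegral_exp_neg_mul_sq_norm ℝ (by norm_num),
    lintegral_gaussWeight, lintegral_gaussWeight, finrank_euclideanSpace_fin,
    finrank_euclideanSpace_fin, Module.finrank_self, ← ENNReal.ofReal_mul (by positivity),
    show (2 : ENNReal) = ENNReal.ofReal 2 by simp, ← ENNReal.ofReal_mul (by positivity)]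
  refine ENNReal.ofReal_le_ofReal ?_
  have e2 : (2 * Real.pi) ^ (((M + 1 : ℕ) : ℝ) / 2)
      = (2 * Real.pi) ^ ((M : ℝ) / 2) * (2 * Real.pi) ^ ((1 : ℝ) / 2) := by
    rw [← Real.rpow_add (by positivity)]; congr 1; push_cast; ring
  rw [e2, mul_assoc]
  refine mul_le_mul_of_nonneg_left ?_ (by positivity)
  -- The remaining inequality is √(4π) ≤ 2√(2π): the Gaussian moment equals √2.
  rw [Nat.cast_one, ← Real.sqrt_eq_rpow, ← Real.sqrt_eq_rpow]
  refine Real.sqrt_le_iff.2 ⟨by positivity, ?_⟩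
  rw [mul_pow, Real.sq_sqrt (by positivity)]
  nlinarith [Real.pi_pos]

/-- The reflection x ↦ -x preserves the Gaussian weight. The symmetry of ε is what eliminates the
linear term of the energy in `exp_le_integral_exp_lastSpin`. -/
theorem lintegral_neg_lastSpin {M : ℕ} {B : ℝ → ENNReal} (hB : Measurable B) :
    ∫⁻ σ, B (-lastSpin σ) ∂unif (M + 1) = ∫⁻ σ, B (lastSpin σ) ∂unif (M + 1) := by
  obtain ⟨hT0, hT1⟩ := lintegral_gaussWeight_ne (EuclideanSpace ℝ (Fin (M + 1)))
  have h1 := lintegral_unif (Nat.succ_pos M)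
    (F := fun x => B (-x (Fin.last M))) (hB.comp (by fun_prop))
  have h2 := lintegral_unif (Nat.succ_pos M)
    (F := fun x => B (x (Fin.last M))) (hB.comp (by fun_prop))
  have h3 := lintegral_neg_eq_self (μ := (volume : Measure (EuclideanSpace ℝ (Fin (M + 1)))))
    (fun x => B (((Real.sqrt (M + 1 : ℕ) / ‖x‖) • x) (Fin.last M)) * gaussWeight x)
  have h4 : ∀ x : EuclideanSpace ℝ (Fin (M + 1)), gaussWeight (-x) = gaussWeight x := fun x => by
    simp [gaussWeight]
  simp only [norm_neg, h4, smul_neg, PiLp.neg_apply] at h3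
  rw [h3, ← h2] at h1
  exact (ENNReal.mul_right_inj hT0 hT1).1 h1

end SphericalSK

/-! ### Deterministic bounds on the difference of covariances and on the drift. -/

namespace SphericalSK

theorem norm_sq_config {N : ℕ} (σ : Config N) : ‖σ.1‖ ^ 2 = N := by
  rw [mem_sphere_zero_iff_norm.1 σ.2, Real.sq_sqrt (by positivity)]

theorem sum_sq_config {N : ℕ} (σ : Config N) : ∑ i, σ.1 i ^ 2 = N := by
  have h := norm_sq_config σ
  rw [EuclideanSpace.norm_sq_eq] at h
  simpa using h

theorem overlap_mem_Icc {N : ℕ} (σ τ : Config N) : overlap σ τ ∈ Set.Icc (-1 : ℝ) 1 := by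
  rw [Set.mem_Icc, ← abs_le, overlap, abs_mul, abs_inv, Nat.abs_cast]
  have h : |∑ i, σ.1 i * τ.1 i| ≤ N := by
    refine abs_le_of_sq_le_sq ?_ (Nat.cast_nonneg N)
    have := Finset.sum_mul_sq_le_sq_mul_sq Finset.univ (fun i => σ.1 i) (fun i => τ.1 i)
    rw [sum_sq_config, sum_sq_config] at this
    nlinarith
  rcases Nat.eq_zero_or_pos N with rfl | hN
  · simp
  · have : (0 : ℝ) < N := by exact_mod_cast hN
    rw [inv_mul_le_iff₀ this]; linarith

theorem overlap_self {N : ℕ} (hN : 1 ≤ N) (σ : Config N) : overlap σ σ = 1 := by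
  have : (N : ℝ) ≠ 0 := by positivity
  rw [overlap]
  have h := sum_sq_config σ
  simp only [pow_two] at h
  rw [h, inv_mul_cancel₀ this]

section Geometry

variable {M : ℕ}

theorem scale_sq (hM : 1 ≤ M) (σ : Config (M + 1)) :
    scale σ ^ 2 * M = ((M + 1 : ℕ) : ℝ) - lastSpin σ ^ 2 := by
  have hM' : (0 : ℝ) < M := by exact_mod_cast hM
  rw [scale, Real.sq_sqrt (div_nonneg (sub_nonneg.2 (sq_lastSpin_le σ)) hM'.le)]
  field_simp

theorem scale_nonneg (σ : Config (M + 1)) : 0 ≤ scale σ := Real.sqrt_nonneg _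

theorem sum_sq_castSucc (σ : Config (M + 1)) :
    ∑ i : Fin M, σ.1 i.castSucc ^ 2 = ((M + 1 : ℕ) : ℝ) - lastSpin σ ^ 2 := by
  have := sum_sq_config σ
  rw [Fin.sum_univ_castSucc] at this
  rw [lastSpin]; linarith

theorem castSucc_eq_scale_mul {σ : Config (M + 1)} (hσ : 0 < scale σ) (i : Fin M) :
    σ.1 i.castSucc = scale σ * hatVec σ i := by
  simp only [hatVec]
  field_simp

theorem hatVec_mem_sphere (hM : 1 ≤ M) {σ : Config (M + 1)} (hσ : 0 < scale σ) :
    hatVec σ ∈ Metric.sphere (0 : EuclideanSpace ℝ (Fin M)) (Real.sqrt M) := by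
  rw [mem_sphere_zero_iff_norm, EuclideanSpace.norm_eq]
  congr 1
  have h := sum_sq_castSucc σ
  simp only [castSucc_eq_scale_mul hσ, mul_pow, ← Finset.mul_sum] at h
  rw [← scale_sq hM] at h
  simp only [Real.norm_eq_abs, sq_abs]
  exact mul_left_cancel₀ (by positivity) h

theorem atHat_eq {σ : Config (M + 1)}
    (hσ : hatVec σ ∈ Metric.sphere (0 : EuclideanSpace ℝ (Fin M)) (Real.sqrt M)) (f : Config M → ℝ) :
    atHat f σ = f ⟨hatVec σ, hσ⟩ := by
  rw [atHat, dif_pos hσ]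

theorem overlap_eq_hat (hM : 1 ≤ M) {σ τ : Config (M + 1)} (hσ : 0 < scale σ) (hτ : 0 < scale τ) :
    ((M + 1 : ℕ) : ℝ) * overlap σ τ = scale σ * scale τ * M *
      overlap ⟨hatVec σ, hatVec_mem_sphere hM hσ⟩ ⟨hatVec τ, hatVec_mem_sphere hM hτ⟩
      + lastSpin σ * lastSpin τ := by
  have hM' : (M : ℝ) ≠ 0 := by positivity
  have hN' : ((M + 1 : ℕ) : ℝ) ≠ 0 := by positivity
  rw [overlap, overlap, ← mul_assoc, mul_inv_cancel₀ hN', one_mul, Fin.sum_univ_castSucc]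
  simp only [castSucc_eq_scale_mul hσ, castSucc_eq_scale_mul hτ, lastSpin]
  rw [show scale σ * scale τ * (M : ℝ) * ((M : ℝ)⁻¹ * ∑ i, (hatVec σ) i * (hatVec τ) i)
    = scale σ * scale τ * ((M : ℝ) * (M : ℝ)⁻¹) * ∑ i, (hatVec σ) i * (hatVec τ) i by ring,
    mul_inv_cancel₀ hM', mul_one, Finset.mul_sum]
  congr 1
  exact Finset.sum_congr rfl fun i _ => by ring

/-- With n = M + 1, e = ε² and e' = ε'², the square of the product is (n - e)(n - e'), which is at
most n² and at least (n - e - e')² whenever n - e - e' ≥ 0. -/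
theorem abs_scale_mul_scale_sub_le (hM : 1 ≤ M) (σ τ : Config (M + 1)) :
    |scale σ * scale τ * M - ((M + 1 : ℕ) : ℝ)| ≤ lastSpin σ ^ 2 + lastSpin τ ^ 2 := by
  set n : ℝ := ((M + 1 : ℕ) : ℝ)
  set e := lastSpin σ ^ 2
  set e' := lastSpin τ ^ 2
  have he : 0 ≤ e := sq_nonneg _
  have he' : 0 ≤ e' := sq_nonneg _
  have hen : e ≤ n := sq_lastSpin_le σ
  have hen' : e' ≤ n := sq_lastSpin_le τ
  have h1 : scale σ ^ 2 * M = n - e := scale_sq hM σ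
  have h2 : scale τ ^ 2 * M = n - e' := scale_sq hM τ
  set p := scale σ * scale τ * M with hp
  have hp0 : 0 ≤ p := mul_nonneg (mul_nonneg (scale_nonneg σ) (scale_nonneg τ)) (Nat.cast_nonneg M)
  have hp2 : p ^ 2 = (n - e) * (n - e') := by rw [← h1, ← h2, hp]; ring
  rw [abs_le]
  constructor
  · by_contra h
    have h3 : p < n - e - e' := by linarith
    have h4 : p ^ 2 < (n - e - e') ^ 2 := pow_lt_pow_left₀ h3 hp0 two_ne_zero
    nlinarith [mul_nonneg he he']
  · have : p ≤ n := abs_le_of_sq_le_sq' (by nlinarith) (by linarith) |>.2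
    linarith

/-- By `overlap_eq_hat`, (M+1)(R - R') = (scale σ · scale τ · M - (M+1))R' + εε', so M|R - R'| ≤
(3/2)(ε² + ε'²). The Lipschitz bound contributes (3/2)K(ε² + ε'²), the product term (1/2)K(ε² +
ε'²), and the surplus ξ(R) at most K. -/
theorem abs_covariance_sub_le (hM : 1 ≤ M) {ξ : ℝ → ℝ} {K p : ℝ}
    (hK : ∀ x ∈ Set.Icc (-1 : ℝ) 1, |ξ x| ≤ K)
    (hL : ∀ x ∈ Set.Icc (-1 : ℝ) 1, ∀ y ∈ Set.Icc (-1 : ℝ) 1, |ξ x - ξ y| ≤ K * |x - y|)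
    (hp : |p| ≤ K) {σ τ : Config (M + 1)} (hσ : 0 < scale σ) (hτ : 0 < scale τ) :
    |((M + 1 : ℕ) : ℝ) * ξ (overlap σ τ) -
      (M * ξ (overlap ⟨hatVec σ, hatVec_mem_sphere hM hσ⟩ ⟨hatVec τ, hatVec_mem_sphere hM hτ⟩)
        + lastSpin σ * lastSpin τ * p)| ≤ 2 * K * (1 + lastSpin σ ^ 2 + lastSpin τ ^ 2) := by
  set R := overlap σ τ with hR
  set R' := overlap ⟨hatVec σ, hatVec_mem_sphere hM hσ⟩ ⟨hatVec τ, hatVec_mem_sphere hM hτ⟩ with hR'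
  have hM' : (0 : ℝ) < M := by exact_mod_cast hM
  have hRm : R ∈ Set.Icc (-1 : ℝ) 1 := overlap_mem_Icc _ _
  have hRm' : R' ∈ Set.Icc (-1 : ℝ) 1 := overlap_mem_Icc _ _
  have hov : ((M + 1 : ℕ) : ℝ) * R = _ := overlap_eq_hat hM hσ hτ
  have hs := abs_scale_mul_scale_sub_le hM σ τ
  have hK0 : 0 ≤ K := (abs_nonneg p).trans hp
  have hee : |lastSpin σ * lastSpin τ| ≤ (lastSpin σ ^ 2 + lastSpin τ ^ 2) / 2 := by
    rw [abs_le]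
    constructor <;> nlinarith [sq_nonneg (lastSpin σ + lastSpin τ), sq_nonneg (lastSpin σ - lastSpin τ)]
  have h1 : M * |R - R'| ≤ 3 / 2 * (lastSpin σ ^ 2 + lastSpin τ ^ 2) := by
    have h2 : ((M + 1 : ℕ) : ℝ) * (R - R')
        = (scale σ * scale τ * M - ((M + 1 : ℕ) : ℝ)) * R' + lastSpin σ * lastSpin τ := by
      rw [mul_sub, hov]; ring
    have h3 : ((M + 1 : ℕ) : ℝ) * |R - R'| ≤ (lastSpin σ ^ 2 + lastSpin τ ^ 2) * 1
        + (lastSpin σ ^ 2 + lastSpin τ ^ 2) / 2 := by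
      rw [← Nat.abs_cast (M + 1), ← abs_mul, h2]
      refine (abs_add_le _ _).trans (add_le_add ?_ hee)
      rw [abs_mul]
      exact mul_le_mul hs (abs_le.2 hRm') (abs_nonneg _) (by positivity)
    have h4 : (M : ℝ) * |R - R'| ≤ ((M + 1 : ℕ) : ℝ) * |R - R'| :=
      mul_le_mul_of_nonneg_right (by push_cast; linarith) (abs_nonneg _)
    linarith
  have h5 : ((M + 1 : ℕ) : ℝ) * ξ R - (M * ξ R' + lastSpin σ * lastSpin τ * p)
      = ξ R + M * (ξ R - ξ R') - lastSpin σ * lastSpin τ * p := by push_cast; ring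
  rw [h5]
  have h6 : |(M : ℝ) * (ξ R - ξ R')| ≤ K * (3 / 2 * (lastSpin σ ^ 2 + lastSpin τ ^ 2)) := by
    rw [abs_mul, Nat.abs_cast]
    calc (M : ℝ) * |ξ R - ξ R'| ≤ M * (K * |R - R'|) :=
          mul_le_mul_of_nonneg_left (hL _ hRm _ hRm') hM'.le
      _ = K * (M * |R - R'|) := by ring
      _ ≤ _ := mul_le_mul_of_nonneg_left h1 hK0
  have h7 : |lastSpin σ * lastSpin τ * p| ≤ (lastSpin σ ^ 2 + lastSpin τ ^ 2) / 2 * K := by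
    rw [abs_mul]
    exact mul_le_mul hee hp (abs_nonneg _) (by positivity)
  have h8 := abs_sub (ξ R + M * (ξ R - ξ R')) (lastSpin σ * lastSpin τ * p)
  have h9 := abs_add_le (ξ R) (M * (ξ R - ξ R'))
  have := hK R hRm
  nlinarith

theorem abs_sum_hatVec_le (hM : 1 ≤ M) {σ : Config (M + 1)} (hσ : 0 < scale σ) :
    |∑ i, hatVec σ i| ≤ M := by
  have h := sum_sq_config ⟨hatVec σ, hatVec_mem_sphere hM hσ⟩
  have h2 := sq_sum_le_card_mul_sum_sq (s := Finset.univ) (f := fun i => hatVec σ i)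
  rw [Finset.card_univ, Fintype.card_fin] at h2
  simp only at h
  rw [h] at h2
  exact abs_le_of_sq_le_sq (by nlinarith) (Nat.cast_nonneg M)

/-- From M(scale - 1)(scale + 1) = 1 - ε² and scale + 1 ≥ 1. -/
theorem mul_abs_scale_sub_one_le (hM : 1 ≤ M) (σ : Config (M + 1)) :
    M * |scale σ - 1| ≤ 1 + lastSpin σ ^ 2 := by
  have h := scale_sq hM σ
  have hs := scale_nonneg σ
  have hM' : (0 : ℝ) < M := by exact_mod_cast hM
  have h1 : (scale σ - 1) * (scale σ + 1) * M = 1 - lastSpin σ ^ 2 := by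
    push_cast at h; linear_combination h
  have h2 : |scale σ - 1| * (scale σ + 1) * M ≤ 1 + lastSpin σ ^ 2 := by
    have : |scale σ - 1| * (scale σ + 1) * M = |1 - lastSpin σ ^ 2| := by
      rw [← h1, abs_mul, abs_mul, abs_of_nonneg (by linarith : 0 ≤ scale σ + 1), Nat.abs_cast]
    rw [this, abs_le]
    constructor <;> nlinarith [sq_nonneg (lastSpin σ)]
  have h3 : 0 ≤ |scale σ - 1| * scale σ * M := by positivity
  linarith

/-- The left side is the coefficient of `t` in the deterministic part of H_t. The field term can be
of order M by Cauchy–Schwarz, and this is compensated by scale - 1 being of order (1 + ε²)/M. -/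
theorem abs_drift_le (hM : 1 ≤ M) {σ : Config (M + 1)} (hσ : 0 < scale σ) (h : ℝ) {b : ℝ}
    (hb : 0 ≤ b) :
    |h * (∑ i, hatVec σ i) * (scale σ - 1) + 1 / 2 * lastSpin σ ^ 2 * b|
      ≤ (|h| + b) * (1 + lastSpin σ ^ 2) := by
  have h1 := abs_sum_hatVec_le hM hσ
  have h2 := mul_abs_scale_sub_one_le hM σ
  have h3 : |h * (∑ i, hatVec σ i) * (scale σ - 1)| ≤ |h| * (1 + lastSpin σ ^ 2) := by
    rw [abs_mul, abs_mul, mul_assoc]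
    refine mul_le_mul_of_nonneg_left (le_trans ?_ h2) (abs_nonneg _)
    exact mul_le_mul_of_nonneg_right h1 (abs_nonneg _)
  have h4 : |1 / 2 * lastSpin σ ^ 2 * b| ≤ b * (1 + lastSpin σ ^ 2) := by
    rw [abs_of_nonneg (by positivity)]
    nlinarith [mul_nonneg hb (sq_nonneg (lastSpin σ))]
  refine (abs_add_le _ _).trans ?_
  linarith

end Geometry

/-- Bounds on a `C³` covariance function. -/
theorem exists_bound_covariance {ξ : ℝ → ℝ} (hξ : ContDiffOn ℝ 3 ξ (Set.Icc (-1) 1)) :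
    ∃ K > (0 : ℝ), (∀ x ∈ Set.Icc (-1 : ℝ) 1, |ξ x| ≤ K) ∧
      (∀ x ∈ Set.Icc (-1 : ℝ) 1, ∀ y ∈ Set.Icc (-1 : ℝ) 1, |ξ x - ξ y| ≤ K * |x - y|) ∧
      ∀ q : ℝ, 0 ≤ q → q < 1 → |deriv ξ q| ≤ K := by
  have hu : UniqueDiffOn ℝ (Set.Icc (-1 : ℝ) 1) := uniqueDiffOn_Icc (by norm_num)
  obtain ⟨K₁, h1⟩ := isCompact_Icc.exists_bound_of_continuousOn hξ.continuousOn
  obtain ⟨K₂, h2⟩ := isCompact_Icc.exists_bound_of_continuousOn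
    (hξ.continuousOn_derivWithin hu (by norm_num))
  refine ⟨max 1 (max K₁ K₂), by positivity, fun x hx => ?_, fun x hx y hy => ?_, fun q hq0 hq1 => ?_⟩
  · exact (h1 x hx).trans ((le_max_left _ _).trans (le_max_right _ _))
  · exact (convex_Icc (-1 : ℝ) 1).norm_image_sub_le_of_norm_derivWithin_le
      (hξ.differentiableOn (by norm_num))
      (fun z hz => (h2 z hz).trans ((le_max_right _ _).trans (le_max_right _ _))) hy hx
  -- Regularity is only assumed on [-1, 1]; the two-sided derivative agrees with the one within the
  -- interval because `q` is an interior point.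
  · have hm : Set.Icc (-1 : ℝ) 1 ∈ nhds q := Icc_mem_nhds (by linarith) hq1
    rw [← derivWithin_of_mem_nhds hm]
    exact (h2 q ⟨by linarith, hq1.le⟩).trans ((le_max_right _ _).trans (le_max_right _ _))

end SphericalSK

/-! ### The cavity interpolation on finitely many configurations. -/

namespace SphericalSK

variable {Ω : Type*} [mΩ : MeasurableSpace Ω]

theorem hasGaussianLaw_eval_comp {T ι : Type*} [Fintype ι] {P : Measure Ω} {X : T → Ω → ℝ}
    (hX : IsGaussianProcess X P) (s : ι → T) : HasGaussianLaw (fun ω i => X (s i) ω) P := by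
  have h := (hX.comp_right s).hasGaussianLaw Finset.univ
  exact h.map_fun (ContinuousLinearMap.pi fun i : ι =>
    ContinuousLinearMap.proj (R := ℝ) (φ := fun _ : (Finset.univ : Finset ι) => ℝ)
      ⟨i, Finset.mem_univ i⟩)

/-- The independent Gaussian disorder of the cavity interpolation: the Hamiltonians on `S_(M+1)`
and on `S_M`, and a standard Gaussian variable. -/
structure IsCavityDisorder (P : Measure Ω) (ξ : ℝ → ℝ) (M : ℕ) (HN : Config (M + 1) → Ω → ℝ)
    (HN' : Config M → Ω → ℝ) (z : Ω → ℝ) : Prop where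
  big : IsHamiltonian P ξ (M + 1) HN
  small : IsHamiltonian P ξ M HN'
  measurable : Measurable z
  law : HasLaw z (gaussianReal 0 1) P
  indep : IndepFun (fun ω σ => HN σ ω) (fun ω σ => HN' σ ω) P
  indep' : IndepFun (fun ω => ((fun σ => HN σ ω), (fun σ => HN' σ ω))) z P

namespace IsCavityDisorder

variable {P : Measure Ω} {ξ : ℝ → ℝ} {M : ℕ} {HN : Config (M + 1) → Ω → ℝ}
  {HN' : Config M → Ω → ℝ} {z : Ω → ℝ}

theorem hasGaussianLaw (hD : IsCavityDisorder P ξ M HN HN' z) {ι : Type*} [Fintype ι]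
    (σ : ι → Config (M + 1)) (τ : ι → Config M) :
    HasGaussianLaw (fun ω => (((fun i => HN (σ i) ω), (fun i => HN' (τ i) ω)), z ω)) P := by
  have hm1 : Measurable fun f : Config (M + 1) → ℝ => fun i => f (σ i) :=
    measurable_pi_lambda _ fun i => measurable_pi_apply _
  have hm2 : Measurable fun f : Config M → ℝ => fun i => f (τ i) :=
    measurable_pi_lambda _ fun i => measurable_pi_apply _
  have h1 := (hD.indep.comp hm1 hm2).hasGaussianLaw (hasGaussianLaw_eval_comp hD.big.gaussian σ)
    (hasGaussianLaw_eval_comp hD.small.gaussian τ)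
  have h2 := hD.indep'.comp (φ := fun p => ((fun i => p.1 (σ i)), (fun i => p.2 (τ i))))
    ((hm1.comp measurable_fst).prodMk (hm2.comp measurable_snd)) measurable_id
  exact h2.hasGaussianLaw h1 hD.law.hasGaussianLaw

theorem indepFun_big_small (hD : IsCavityDisorder P ξ M HN HN' z) (σ : Config (M + 1))
    (τ : Config M) : IndepFun (HN σ) (HN' τ) P := by
  have h1 : Measurable fun f : Config (M + 1) → ℝ => f σ := measurable_pi_apply σ
  have h2 : Measurable fun f : Config M → ℝ => f τ := measurable_pi_apply τ
  exact hD.indep.comp h1 h2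

theorem indepFun_big_gaussian (hD : IsCavityDisorder P ξ M HN HN' z) (σ : Config (M + 1)) :
    IndepFun (HN σ) z P := by
  have h1 : Measurable fun f : Config (M + 1) → ℝ => f σ := measurable_pi_apply σ
  have h2 : Measurable fun f : (Config (M + 1) → ℝ) × (Config M → ℝ) => f.1 σ :=
    h1.comp measurable_fst
  exact hD.indep'.comp h2 measurable_id

theorem indepFun_small_gaussian (hD : IsCavityDisorder P ξ M HN HN' z) (τ : Config M) :
    IndepFun (HN' τ) z P := by
  have h1 : Measurable fun f : Config M → ℝ => f τ := measurable_pi_apply τ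
  have h2 : Measurable fun f : (Config (M + 1) → ℝ) × (Config M → ℝ) => f.2 τ :=
    h1.comp measurable_snd
  exact hD.indep'.comp h2 measurable_id

theorem memLp_big (hD : IsCavityDisorder P ξ M HN HN' z) (σ : Config (M + 1)) :
    MemLp (HN σ) 2 P := (hD.big.gaussian.hasGaussianLaw_eval σ).memLp_two

theorem memLp_small (hD : IsCavityDisorder P ξ M HN HN' z) (τ : Config M) :
    MemLp (HN' τ) 2 P := (hD.small.gaussian.hasGaussianLaw_eval τ).memLp_two

theorem memLp_gaussian (hD : IsCavityDisorder P ξ M HN HN' z) : MemLp z 2 P :=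
  hD.law.hasGaussianLaw.memLp_two

theorem integral_gaussian (hD : IsCavityDisorder P ξ M HN HN' z) : ∫ ω, z ω ∂P = 0 := by
  rw [hD.law.integral_eq]; exact integral_id_gaussianReal

theorem integral_gaussian_mul_self (hD : IsCavityDisorder P ξ M HN HN' z) :
    ∫ ω, z ω * z ω ∂P = 1 := by
  have : IsProbabilityMeasure P := hD.law.hasGaussianLaw.isProbabilityMeasure
  have h := hD.law.variance_eq
  rw [variance_eq_sub hD.memLp_gaussian, hD.integral_gaussian, variance_id_gaussianReal] at h
  simpa [pow_two] using h

/-- The covariances of the two Gaussian families of the interpolation. -/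
theorem covariances (hD : IsCavityDisorder P ξ M HN HN' z) (β p : ℝ)
    (σ σ' : Config (M + 1)) (τ τ' : Config M) (ε ε' : ℝ) :
    ∫ ω, β * HN σ ω ∂P = 0 ∧ ∫ ω, β * (HN' τ ω + ε * p * z ω) ∂P = 0 ∧
    ∫ ω, (β * HN σ ω) * (β * (HN' τ ω + ε * p * z ω)) ∂P = 0 ∧
    ∫ ω, (β * HN σ ω) * (β * HN σ' ω) ∂P = β ^ 2 * (((M + 1 : ℕ) : ℝ) * ξ (overlap σ σ')) ∧
    ∫ ω, (β * (HN' τ ω + ε * p * z ω)) * (β * (HN' τ' ω + ε' * p * z ω)) ∂P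
      = β ^ 2 * (M * ξ (overlap τ τ') + ε * ε' * p ^ 2) := by
  have h1 := hD.memLp_big
  have h2 := hD.memLp_small
  have h3 := hD.memLp_gaussian
  have : IsProbabilityMeasure P := hD.law.hasGaussianLaw.isProbabilityMeasure
  have i2 : ∀ τ, Integrable (HN' τ) P := fun τ => (h2 τ).integrable (by norm_num)
  have i3 : Integrable z P := h3.integrable (by norm_num)
  have i12 : ∀ σ τ, Integrable (fun ω => HN σ ω * HN' τ ω) P := fun σ τ =>
    (h1 σ).integrable_mul (h2 τ)
  have i13 : ∀ σ, Integrable (fun ω => HN σ ω * z ω) P := fun σ => (h1 σ).integrable_mul h3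
  have i23 : ∀ τ, Integrable (fun ω => HN' τ ω * z ω) P := fun τ => (h2 τ).integrable_mul h3
  have i22 : ∀ τ τ', Integrable (fun ω => HN' τ ω * HN' τ' ω) P := fun τ τ' =>
    (h2 τ).integrable_mul (h2 τ')
  have i33 : Integrable (fun ω => z ω * z ω) P := h3.integrable_mul h3
  have e12 : ∀ σ τ, ∫ ω, HN σ ω * HN' τ ω ∂P = 0 := fun σ τ => by
    rw [(hD.indepFun_big_small σ τ).integral_fun_mul_eq_mul_integral (h1 σ).1 (h2 τ).1,
      hD.big.centred, zero_mul]
  have e13 : ∀ σ, ∫ ω, HN σ ω * z ω ∂P = 0 := fun σ => by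
    rw [(hD.indepFun_big_gaussian σ).integral_fun_mul_eq_mul_integral (h1 σ).1 h3.1,
      hD.big.centred, zero_mul]
  have e23 : ∀ τ, ∫ ω, HN' τ ω * z ω ∂P = 0 := fun τ => by
    rw [(hD.indepFun_small_gaussian τ).integral_fun_mul_eq_mul_integral (h2 τ).1 h3.1,
      hD.small.centred, zero_mul]
  refine ⟨?_, ?_, ?_, ?_, ?_⟩
  · rw [integral_const_mul, hD.big.centred, mul_zero]
  · rw [integral_const_mul, integral_add (i2 τ) (i3.const_mul _), hD.small.centred,
      integral_const_mul, hD.integral_gaussian]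
    simp
  · have : ∀ ω, (β * HN σ ω) * (β * (HN' τ ω + ε * p * z ω))
        = β ^ 2 * (HN σ ω * HN' τ ω) + β ^ 2 * ε * p * (HN σ ω * z ω) := fun ω => by ring
    simp only [this]
    rw [integral_add ((i12 _ _).const_mul _) ((i13 _).const_mul _), integral_const_mul,
      integral_const_mul, e12, e13]
    simp
  · have : ∀ ω, (β * HN σ ω) * (β * HN σ' ω) = β ^ 2 * (HN σ ω * HN σ' ω) := fun ω => by ring
    simp only [this]
    rw [integral_const_mul, hD.big.covariance]
  · have : ∀ ω, (β * (HN' τ ω + ε * p * z ω)) * (β * (HN' τ' ω + ε' * p * z ω))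
        = (β ^ 2 * (HN' τ ω * HN' τ' ω) + β ^ 2 * ε' * p * (HN' τ ω * z ω))
        + (β ^ 2 * ε * p * (HN' τ' ω * z ω) + β ^ 2 * (ε * ε' * p ^ 2) * (z ω * z ω)) :=
      fun ω => by ring
    simp only [this]
    have iA : Integrable (fun ω => β ^ 2 * (HN' τ ω * HN' τ' ω)
        + β ^ 2 * ε' * p * (HN' τ ω * z ω)) P := ((i22 _ _).const_mul _).add ((i23 _).const_mul _)
    have iB : Integrable (fun ω => β ^ 2 * ε * p * (HN' τ' ω * z ω)
        + β ^ 2 * (ε * ε' * p ^ 2) * (z ω * z ω)) P :=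
      ((i23 _).const_mul _).add (i33.const_mul _)
    rw [integral_add iA iB,
      integral_add ((i22 _ _).const_mul _) ((i23 _).const_mul _),
      integral_add ((i23 _).const_mul _) (i33.const_mul _)]
    simp only [integral_const_mul]
    rw [e23, e23, hD.small.covariance, hD.integral_gaussian_mul_self]
    ring

end IsCavityDisorder

/-- The interpolating Hamiltonian at a configuration which is not a pole. -/
theorem interpH_eq_interp {M : ℕ} (hM : 1 ≤ M) {ι : Type*} (ξ : ℝ → ℝ) (β h q : ℝ)
    (HN : Config (M + 1) → ℝ) (HN' : Config M → ℝ) (z t : ℝ) (σ : ι → Config (M + 1))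
    (hσ : ∀ i, 0 < scale (σ i)) (i : ι) :
    interpH ξ β h q HN HN' z t (σ i) = interp (fun i => β * HN (σ i))
      (fun i => β * (HN' ⟨hatVec (σ i), hatVec_mem_sphere hM (hσ i)⟩
        + lastSpin (σ i) * Real.sqrt (deriv ξ q) * z))
      (fun i => h * (∑ j, hatVec (σ i) j) + h * lastSpin (σ i)
        - 1 / 2 * lastSpin (σ i) ^ 2 * bConst ξ β h q)
      (fun i => h * (∑ j, hatVec (σ i) j) * (scale (σ i) - 1)
        + 1 / 2 * lastSpin (σ i) ^ 2 * bConst ξ β h q) t i := by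
  rw [interpH, interp, atHat_eq (hatVec_mem_sphere hM (hσ i))]
  ring

/-- The square of the root is the positive part of ξ'(q), so the estimates cover the convention for
negative arguments as well. -/
theorem sqrt_deriv_sq_le {ξ : ℝ → ℝ} {q K : ℝ} (hK : |deriv ξ q| ≤ K) :
    |Real.sqrt (deriv ξ q) ^ 2| ≤ K := by
  rw [abs_of_nonneg (sq_nonneg _)]
  rcases le_total 0 (deriv ξ q) with h | h
  · rw [Real.sq_sqrt h]; exact (le_abs_self _).trans hK
  · rw [Real.sqrt_eq_zero_of_nonpos h]
    simpa using (abs_nonneg _).trans hK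

/-- Here `integral_avg_interp_le` is applied with e = ε², u = 2Kβ² and d = |h| + b, the Gaussian
families being βH_N and β(H_{N-1}(σ̂) + ε√(ξ'(q)) z). -/
theorem IsCavityDisorder.integral_avg_interpH_le {P : Measure Ω} {ξ : ℝ → ℝ} {M : ℕ}
    {HN : Config (M + 1) → Ω → ℝ} {HN' : Config M → Ω → ℝ} {z : Ω → ℝ}
    (hD : IsCavityDisorder P ξ M HN HN' z) (hM : 1 ≤ M) {K : ℝ}
    (hK : ∀ x ∈ Set.Icc (-1 : ℝ) 1, |ξ x| ≤ K)
    (hL : ∀ x ∈ Set.Icc (-1 : ℝ) 1, ∀ y ∈ Set.Icc (-1 : ℝ) 1, |ξ x - ξ y| ≤ K * |x - y|)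
    {β h q a κ : ℝ} (hq : |deriv ξ q| ≤ K) (hb : 0 ≤ bConst ξ β h q)
    (hκ : κ = 2 * (|h| + bConst ξ β h q) + 6 * (β ^ 2 * (2 * K))) (ha : κ ≤ a) {t : ℝ}
    (ht : t ∈ Set.Icc (0 : ℝ) 1) {ι : Type*} [Fintype ι] [Nonempty ι] (σ : ι → Config (M + 1))
    (hσ : ∀ i, 0 < scale (σ i)) :
    ∫ ω, avg (fun i => interpH ξ β h q (HN · ω) (HN' · ω) (z ω) t (σ i))
        (fun i => Real.exp ((a - κ * t) * lastSpin (σ i) ^ 2)) ∂P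
      ≤ Real.exp κ * ∫ ω, avg (fun i => interpH ξ β h q (HN · ω) (HN' · ω) (z ω) 0 (σ i))
        (fun i => Real.exp (a * lastSpin (σ i) ^ 2)) ∂P := by
  set p := Real.sqrt (deriv ξ q) with hp
  set τ : ι → Config M := fun i => ⟨hatVec (σ i), hatVec_mem_sphere hM (hσ i)⟩ with hτ
  set e : ι → ℝ := fun i => lastSpin (σ i) with he
  have hG := hD.hasGaussianLaw σ τ
  have hXY : HasGaussianLaw (fun ω => ((fun i => β * HN (σ i) ω),
      (fun i => β * (HN' (τ i) ω + e i * p * z ω)))) P := by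
    let L1 : (((ι → ℝ) × (ι → ℝ)) × ℝ) →L[ℝ] (ι → ℝ) :=
      (ContinuousLinearMap.fst ℝ _ _).comp (ContinuousLinearMap.fst ℝ _ _)
    let L2 : (((ι → ℝ) × (ι → ℝ)) × ℝ) →L[ℝ] (ι → ℝ) :=
      (ContinuousLinearMap.snd ℝ _ _).comp (ContinuousLinearMap.fst ℝ _ _)
    let L3 : (((ι → ℝ) × (ι → ℝ)) × ℝ) →L[ℝ] (ι → ℝ) :=
      (ContinuousLinearMap.snd ℝ _ _).smulRight (fun i => e i * p)
    have h := hG.map_fun ((β • L1).prod (β • (L2 + L3)))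
    have e : (fun ω => ((fun i => β * HN (σ i) ω), (fun i => β * (HN' (τ i) ω + e i * p * z ω))))
        = fun ω => ((β • L1).prod (β • (L2 + L3)))
          (((fun i => HN (σ i) ω), (fun i => HN' (τ i) ω)), z ω) := by
      funext ω
      refine Prod.ext (funext fun i => ?_) (funext fun i => ?_)
      · simp [L1]
      · simp [L2, L3]; ring
    rw [e]
    exact h
  have hc := fun i j => hD.covariances β p (σ i) (σ j) (τ i) (τ j) (e i) (e j)
  -- The mixed covariance in `covariances` involves the first σ, τ and ε, so the last two must carry
  -- the index `j`.
  have hc' := fun i j => hD.covariances β p (σ i) (σ j) (τ j) (τ j) (e j) (e j)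
  simp only [interpH_eq_interp hM ξ β h q _ _ _ _ σ hσ]
  subst hκ
  refine integral_avg_interp_le (e := fun i => lastSpin (σ i) ^ 2) hXY (fun i => (hc i i).1)
    (fun i => (hc i i).2.1) (fun i j => (hc' i j).2.2.1) (fun i => sq_nonneg _) (fun i j => ?_)
    (fun i => abs_drift_le hM (hσ i) h hb) ha ht
  rw [(hc i j).2.2.2.1, (hc i j).2.2.2.2, ← mul_sub, abs_mul, abs_of_nonneg (sq_nonneg β),
    mul_assoc (β ^ 2) (2 * K)]
  exact mul_le_mul_of_nonneg_left
    (abs_covariance_sub_le hM hK hL (sqrt_deriv_sq_le hq) (hσ i) (hσ j)) (sq_nonneg β)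

end SphericalSK

/-! ### From finite samples to Gibbs averages by the strong law of large numbers. -/

namespace SphericalSK

section GibbsMeasure

open Filter Topology

variable {S : Type*} [MeasurableSpace S]

/-- The Gibbs average of `f` for the energy `E` and the reference measure `μ`. -/
noncomputable def gibbsAvg (μ : Measure S) (E f : S → ℝ) : ℝ :=
  (∫ s, f s * Real.exp (E s) ∂μ) / ∫ s, Real.exp (E s) ∂μ

theorem gibbs_eq_gibbsAvg {N : ℕ} (E f : Config N → ℝ) : gibbs E f = gibbsAvg (unif N) E f := rfl

theorem integrable_mul_exp {μ : Measure S} {E f : S → ℝ} {F : ℝ}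
    (hE : Integrable (fun s => Real.exp (E s)) μ) (hf : Measurable f) (hF : ∀ s, |f s| ≤ F) :
    Integrable (fun s => f s * Real.exp (E s)) μ :=
  hE.bdd_mul hf.aestronglyMeasurable (ae_of_all _ hF)

theorem gibbsAvg_nonneg {μ : Measure S} {E f : S → ℝ} (hf : ∀ s, 0 ≤ f s) : 0 ≤ gibbsAvg μ E f :=
  div_nonneg (integral_nonneg fun s => mul_nonneg (hf s) (Real.exp_pos _).le)
    (integral_nonneg fun _ => (Real.exp_pos _).le)

theorem gibbsAvg_mono {μ : Measure S} {E f g : S → ℝ} {F : ℝ}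
    (hE : Integrable (fun s => Real.exp (E s)) μ) (hf : Measurable f) (hF : ∀ s, |f s| ≤ F)
    (hg : Measurable g) (hG : ∀ s, |g s| ≤ F) (hfg : ∀ s, f s ≤ g s) :
    gibbsAvg μ E f ≤ gibbsAvg μ E g := by
  refine div_le_div_of_nonneg_right ?_ (integral_nonneg fun s => (Real.exp_pos _).le)
  exact integral_mono (integrable_mul_exp hE hf hF) (integrable_mul_exp hE hg hG)
    fun s => mul_le_mul_of_nonneg_right (hfg s) (Real.exp_pos _).le

theorem abs_gibbsAvg_le {μ : Measure S} {E f : S → ℝ} {F : ℝ} (hF0 : 0 ≤ F)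
    (hF : ∀ s, |f s| ≤ F) : |gibbsAvg μ E f| ≤ F := by
  have h0 : 0 ≤ ∫ s, Real.exp (E s) ∂μ := integral_nonneg fun s => (Real.exp_pos _).le
  by_cases hE : Integrable (fun s => Real.exp (E s)) μ
  · rw [gibbsAvg, abs_div, abs_of_nonneg h0]
    refine div_le_of_le_mul₀ h0 hF0 ?_
    rw [← integral_const_mul]
    rw [← Real.norm_eq_abs]
    refine norm_integral_le_of_norm_le (hE.const_mul F) (ae_of_all _ fun s => ?_)
    rw [norm_mul, Real.norm_of_nonneg (Real.exp_pos _).le]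
    exact mul_le_mul_of_nonneg_right (hF s) (Real.exp_pos _).le
  -- If the partition function diverges, its integral is 0 by convention and so is the quotient.
  · rw [gibbsAvg, integral_undef hE, div_zero, abs_zero]; exact hF0

variable {Ω : Type*} [MeasurableSpace Ω]

theorem measurable_gibbsAvg {μ : Measure S} [SFinite μ] {E : S → Ω → ℝ}
    (hE : Measurable fun p : S × Ω => E p.1 p.2) {f : S → ℝ} (hf : Measurable f) :
    Measurable fun ω => gibbsAvg μ (E · ω) f := by
  have hE' : Measurable fun p : Ω × S => E p.2 p.1 := hE.comp measurable_swap
  have h1 : Measurable fun p : Ω × S => Real.exp (E p.2 p.1) := hE'.exp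
  have h2 : Measurable fun p : Ω × S => f p.2 * Real.exp (E p.2 p.1) :=
    (hf.comp measurable_snd).mul h1
  exact (h2.stronglyMeasurable.integral_prod_right').measurable.div
    (h1.stronglyMeasurable.integral_prod_right').measurable

theorem ae_tendsto_mean {μ : Measure S} [IsProbabilityMeasure μ] {g : S → ℝ} (hg : Measurable g)
    (hgi : Integrable g μ) :
    ∀ᵐ x ∂Measure.infinitePi (fun _ : ℕ => μ),
      Tendsto (fun n : ℕ => (∑ i : Fin n, g (x i)) / n) atTop (𝓝 (∫ s, g s ∂μ)) := by
  have hmp : ∀ i : ℕ, MeasurePreserving (Function.eval i) (Measure.infinitePi fun _ : ℕ => μ) μ :=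
    fun i => measurePreserving_eval_infinitePi (fun _ : ℕ => μ) i
  have h := strong_law_ae_real (μ := Measure.infinitePi fun _ : ℕ => μ)
    (fun i (x : ℕ → S) => g (x i)) ((hmp 0).integrable_comp_of_integrable hgi)
    (fun i j hij => (iIndepFun_infinitePi (P := fun _ : ℕ => μ) (X := fun _ => g)
      (fun _ => hg)).indepFun hij) (fun i => ?_)
  · filter_upwards [h] with x hx
    have e : ∫ x : ℕ → S, g (x 0) ∂Measure.infinitePi (fun _ : ℕ => μ) = ∫ s, g s ∂μ := by
      have h0 := integral_map (μ := Measure.infinitePi fun _ : ℕ => μ)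
        (hmp 0).measurable.aemeasurable (f := g) hg.aestronglyMeasurable
      rw [(hmp 0).map_eq] at h0
      exact h0.symm
    rw [e] at hx
    simpa only [Fin.sum_univ_eq_sum_range (fun i => g (x i))] using hx
  · refine ⟨(hg.comp (hmp i).measurable).aemeasurable, (hg.comp (hmp 0).measurable).aemeasurable, ?_⟩
    have e : ∀ j : ℕ, Measure.map (fun x : ℕ → S => g (x j)) (Measure.infinitePi fun _ : ℕ => μ)
        = Measure.map g μ := fun j => by
      exact (Measure.map_map hg (hmp j).measurable).symm.trans (by rw [(hmp j).map_eq])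
    rw [e, e]

/-- A finite Gibbs average over a sample is a quotient of two empirical means with cancelling
normalizations, and the limit of the denominator is positive. Samples of size n + 1 are never empty.
-/
theorem ae_tendsto_avg {μ : Measure S} [IsProbabilityMeasure μ] {E f : S → ℝ} {F : ℝ}
    (hE : Measurable E) (hEi : Integrable (fun s => Real.exp (E s)) μ) (hf : Measurable f)
    (hF : ∀ s, |f s| ≤ F) :
    ∀ᵐ x ∂Measure.infinitePi (fun _ : ℕ => μ),
      Tendsto (fun n : ℕ => avg (fun i : Fin (n + 1) => E (x i)) (fun i => f (x i))) atTop
        (𝓝 (gibbsAvg μ E f)) := by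
  filter_upwards [ae_tendsto_mean (hf.mul hE.exp) (integrable_mul_exp hEi hf hF),
    ae_tendsto_mean hE.exp hEi] with x h1 h2
  have h := ((h1.div h2 (integral_exp_pos hEi).ne').comp (tendsto_add_atTop_nat 1))
  refine h.congr fun n => ?_
  have hn : ((n + 1 : ℕ) : ℝ) ≠ 0 := by positivity
  simp only [Function.comp_apply, Pi.div_apply, avg, weight, Pi.mul_apply]
  rw [div_div_div_cancel_right₀ hn, Finset.sum_div]
  exact Finset.sum_congr rfl fun i _ => by ring

theorem measurable_avg_comp {E : S → Ω → ℝ} (hE : Measurable fun p : S × Ω => E p.1 p.2)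
    {f : S → ℝ} (hf : Measurable f) (n : ℕ) :
    Measurable fun p : Ω × (ℕ → S) =>
      avg (fun i : Fin (n + 1) => E (p.2 i) p.1) (fun i => f (p.2 i)) := by
  have h1 : ∀ i : ℕ, Measurable fun p : Ω × (ℕ → S) => p.2 i := fun i =>
    (measurable_pi_apply i).comp measurable_snd
  have h2 : ∀ i : ℕ, Measurable fun p : Ω × (ℕ → S) => Real.exp (E (p.2 i) p.1) := fun i =>
    (hE.comp ((h1 i).prodMk measurable_fst)).exp
  simp only [avg, weight]
  refine Finset.measurable_fun_sum _ fun i _ => ?_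
  have h3 : Measurable fun p : Ω × (ℕ → S) => ∑ j : Fin (n + 1), Real.exp (E (p.2 j) p.1) :=
    Finset.measurable_fun_sum _ fun j _ => h2 j
  exact ((h2 i).div h3).mul (hf.comp (h1 i))

/-- For almost every disorder, almost every sample works; Fubini exchanges the quantifiers, so one
sample serves almost every disorder. The averages are bounded by `F`, and dominated convergence
concludes. -/
theorem ae_tendsto_integral_avg {P : Measure Ω} [IsProbabilityMeasure P] {μ : Measure S}
    [IsProbabilityMeasure μ] {E : S → Ω → ℝ} (hE : Measurable fun p : S × Ω => E p.1 p.2)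
    (hEi : ∀ᵐ ω ∂P, Integrable (fun s => Real.exp (E s ω)) μ) {f : S → ℝ} (hf : Measurable f)
    {F : ℝ} (hF : ∀ s, |f s| ≤ F) :
    ∀ᵐ x ∂Measure.infinitePi (fun _ : ℕ => μ),
      Tendsto (fun n : ℕ => ∫ ω, avg (fun i : Fin (n + 1) => E (x i) ω) (fun i => f (x i)) ∂P)
        atTop (𝓝 (∫ ω, gibbsAvg μ (E · ω) f ∂P)) := by
  have hm := measurableSet_tendsto_fun (l := atTop) (measurable_avg_comp hE hf)
    ((measurable_gibbsAvg (μ := μ) hE hf).comp (measurable_fst (β := ℕ → S)))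
  have h : ∀ᵐ ω ∂P, ∀ᵐ x ∂Measure.infinitePi (fun _ : ℕ => μ),
      Tendsto (fun n : ℕ => avg (fun i : Fin (n + 1) => E (x i) ω) (fun i => f (x i))) atTop
        (𝓝 (gibbsAvg μ (E · ω) f)) := by
    filter_upwards [hEi] with ω hω
    exact ae_tendsto_avg (hE.comp (measurable_id.prodMk measurable_const)) hω hf hF
  have h' := (Measure.ae_ae_comm (p := fun (ω : Ω) (x : ℕ → S) =>
    Tendsto (fun n : ℕ => avg (fun i : Fin (n + 1) => E (x i) ω) (fun i => f (x i))) atTop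
        (𝓝 (gibbsAvg μ (E · ω) f))) hm).1 h
  filter_upwards [h'] with x hx
  refine tendsto_integral_of_dominated_convergence (fun _ => F) (fun n => ?_)
    (integrable_const _) (fun n => ae_of_all _ fun ω => abs_avg_le fun i => hF _) hx
  exact ((measurable_avg_comp hE hf n).comp (measurable_id.prodMk measurable_const)).aestronglyMeasurable

/-- An inequality between the averages over finite samples passes to the Gibbs averages. -/
theorem integral_gibbsAvg_le_of_avg {P : Measure Ω} [IsProbabilityMeasure P] {μ : Measure S}
    [IsProbabilityMeasure μ] {E E' : S → Ω → ℝ} (hE : Measurable fun p : S × Ω => E p.1 p.2)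
    (hE' : Measurable fun p : S × Ω => E' p.1 p.2)
    (hEi : ∀ᵐ ω ∂P, Integrable (fun s => Real.exp (E s ω)) μ)
    (hEi' : ∀ᵐ ω ∂P, Integrable (fun s => Real.exp (E' s ω)) μ) {f f' : S → ℝ} (hf : Measurable f)
    (hf' : Measurable f') {F : ℝ} (hF : ∀ s, |f s| ≤ F) (hF' : ∀ s, |f' s| ≤ F)
    {G : S → Prop} (hG : ∀ᵐ s ∂μ, G s) {C : ℝ}
    (hle : ∀ (n : ℕ) (x : Fin (n + 1) → S), (∀ i, G (x i)) →
      ∫ ω, avg (fun i => E (x i) ω) (fun i => f (x i)) ∂P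
        ≤ C * ∫ ω, avg (fun i => E' (x i) ω) (fun i => f' (x i)) ∂P) :
    ∫ ω, gibbsAvg μ (E · ω) f ∂P ≤ C * ∫ ω, gibbsAvg μ (E' · ω) f' ∂P := by
  have hgood : ∀ᵐ x ∂Measure.infinitePi (fun _ : ℕ => μ), ∀ i, G (x i) :=
    ae_all_iff.2 fun i =>
      (measurePreserving_eval_infinitePi (fun _ : ℕ => μ) i).quasiMeasurePreserving.ae hG
  -- A single sequence of configurations satisfying `G` suffices: both limits are taken along it.
  obtain ⟨x, hx, h1, h2⟩ := (hgood.and ((ae_tendsto_integral_avg hE hEi hf hF).and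
    (ae_tendsto_integral_avg hE' hEi' hf' hF'))).exists
  exact le_of_tendsto_of_tendsto' h1 (h2.const_mul C) fun n => hle n (fun i => x i) fun i => hx i

end GibbsMeasure

end SphericalSK

/-! ### Measurability of the interpolating Hamiltonian and finiteness of the partition function. -/

namespace SphericalSK

section Measurability

variable {Ω : Type*} [mΩ : MeasurableSpace Ω]

/-- A jointly measurable function on `S_M` evaluated at `σ̂` depends measurably on `σ̂`. -/
theorem exists_measurable_atHat {M : ℕ} {H : Config M → Ω → ℝ}
    (hH : Measurable fun p : Config M × Ω => H p.1 p.2) :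
    ∃ V : EuclideanSpace ℝ (Fin M) × Ω → ℝ, Measurable V ∧
      ∀ (σ : Config (M + 1)) (ω : Ω), atHat (H · ω) σ = V (hatVec σ, ω) := by
  have hs : MeasurableSet (Metric.sphere (0 : EuclideanSpace ℝ (Fin M)) (Real.sqrt M)) :=
    Metric.isClosed_sphere.measurableSet
  rcases (Metric.sphere (0 : EuclideanSpace ℝ (Fin M)) (Real.sqrt M)).eq_empty_or_nonempty
    with he | hne
  · refine ⟨fun _ => 0, measurable_const, fun σ ω => ?_⟩
    rw [atHat, dif_neg (by simp only [he, Set.mem_empty_iff_false, not_false_iff])]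
  -- A measurable retraction onto the sphere extends `H` to the whole space, since joint
  -- measurability is only given on the sphere.
  · obtain ⟨r, hr, hrx⟩ := hs.exists_measurable_proj hne
    classical
    refine ⟨fun p => if p.1 ∈ Metric.sphere (0 : EuclideanSpace ℝ (Fin M)) (Real.sqrt M)
      then H (r p.1) p.2 else 0, Measurable.ite (measurable_fst hs)
      (hH.comp ((hr.comp measurable_fst).prodMk measurable_snd)) measurable_const, fun σ ω => ?_⟩
    by_cases h : hatVec σ ∈ Metric.sphere (0 : EuclideanSpace ℝ (Fin M)) (Real.sqrt M)
    · have hr' : r (hatVec σ) = ⟨hatVec σ, h⟩ := hrx ⟨hatVec σ, h⟩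
      simp only [atHat, dif_pos h, if_pos h, hr']
    · simp only [atHat, dif_neg h, if_neg h]

theorem measurable_scale {M : ℕ} : Measurable (scale (M := M)) :=
  ((measurable_const.sub (measurable_lastSpin.pow_const 2)).div_const _).sqrt

theorem measurable_sum_hatVec {M : ℕ} : Measurable fun σ : Config (M + 1) => ∑ i, hatVec σ i := by
  have h : Measurable fun u : EuclideanSpace ℝ (Fin M) => ∑ i, u i := by fun_prop
  exact h.comp measurable_hatVec

theorem IsCavityDisorder.measurable_interpH {P : Measure Ω} {ξ : ℝ → ℝ} {M : ℕ}
    {HN : Config (M + 1) → Ω → ℝ} {HN' : Config M → Ω → ℝ} {z : Ω → ℝ}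
    (hD : IsCavityDisorder P ξ M HN HN' z) (β h q t : ℝ) :
    Measurable fun p : Config (M + 1) × Ω =>
      interpH ξ β h q (HN · p.2) (HN' · p.2) (z p.2) t p.1 := by
  obtain ⟨V, hV, hVe⟩ := exists_measurable_atHat hD.small.measurable
  have h1 : Measurable fun p : Config (M + 1) × Ω => HN p.1 p.2 := hD.big.measurable
  have h2 : Measurable fun p : Config (M + 1) × Ω => V (hatVec p.1, p.2) :=
    hV.comp ((measurable_hatVec.comp measurable_fst).prodMk measurable_snd)
  have h3 : Measurable fun p : Config (M + 1) × Ω => ∑ i, hatVec p.1 i :=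
    measurable_sum_hatVec.comp measurable_fst
  have h4 : Measurable fun p : Config (M + 1) × Ω => scale p.1 :=
    measurable_scale.comp measurable_fst
  have h5 : Measurable fun p : Config (M + 1) × Ω => lastSpin p.1 :=
    measurable_lastSpin.comp measurable_fst
  have h6 : Measurable fun p : Config (M + 1) × Ω => z p.2 := hD.measurable.comp measurable_snd
  simp only [interpH, hVe]
  exact (((((h1.const_mul _).add (h2.const_mul _)).add ((h3.const_mul h).mul
    (((h4.sub_const 1).const_mul t).const_add 1))).add (h5.const_mul h)).add
    ((((h5.const_mul _).mul h6).mul_const β).mul_const _)).sub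
    (((h5.pow_const 2).const_mul _).mul_const _)

end Measurability

section Integrability

variable {Ω : Type*} [mΩ : MeasurableSpace Ω]

theorem lintegral_exp_mul_of_hasGaussianLaw {P : Measure Ω} {X : Ω → ℝ} (hX : HasGaussianLaw X P)
    (h0 : ∫ ω, X ω ∂P = 0) (c : ℝ) :
    ∫⁻ ω, ENNReal.ofReal (Real.exp (c * X ω)) ∂P
      = ENNReal.ofReal (Real.exp (c ^ 2 * (∫ ω, X ω * X ω ∂P) / 2)) := by
  have : IsProbabilityMeasure P := hX.isProbabilityMeasure
  have hmap := hX.map_eq_gaussianReal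
  have hvar : Var[X; P] = ∫ ω, X ω * X ω ∂P := by
    rw [variance_eq_sub hX.memLp_two, h0]
    simp [pow_two]
  have hs : 0 ≤ ∫ ω, X ω * X ω ∂P := integral_nonneg fun ω => mul_self_nonneg _
  rw [h0, hvar] at hmap
  have hm := mgf_gaussianReal hmap c
  rw [Real.coe_toNNReal _ hs, zero_mul, zero_add] at hm
  -- A moment generating function is positive only where the exponential is integrable.
  have hi : Integrable (fun ω => Real.exp (c * X ω)) P := by
    rw [← mgf_pos_iff, hm]; exact Real.exp_pos _
  rw [← ofReal_integral_eq_lintegral_ofReal hi (ae_of_all _ fun _ => (Real.exp_pos _).le)]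
  congr 1
  rw [show c ^ 2 * (∫ ω, X ω * X ω ∂P) / 2 = (∫ ω, X ω * X ω ∂P) * c ^ 2 / 2 by ring, ← hm, mgf]

/-- The sum is at most three times its largest term. This separates the three Gaussian contributions
to the energy without appealing to their independence. -/
theorem exp_add_add_le (x y w : ℝ) :
    Real.exp (x + y + w) ≤ Real.exp (3 * x) + Real.exp (3 * y) + Real.exp (3 * w) := by
  have h1 := (Real.exp_pos (3 * x)).le
  have h2 := (Real.exp_pos (3 * y)).le
  have h3 := (Real.exp_pos (3 * w)).le
  rcases le_total x y with hxy | hxy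
  · rcases le_total y w with hyw | hyw
    · have := Real.exp_le_exp.2 (show x + y + w ≤ 3 * w by linarith); linarith
    · have := Real.exp_le_exp.2 (show x + y + w ≤ 3 * y by linarith); linarith
  · rcases le_total x w with hyw | hyw
    · have := Real.exp_le_exp.2 (show x + y + w ≤ 3 * w by linarith); linarith
    · have := Real.exp_le_exp.2 (show x + y + w ≤ 3 * x by linarith); linarith

/-- By Tonelli the expected partition function is at most C, so the partition function is almost
surely finite. -/
theorem ae_integrable_exp_of_lintegral_le {S : Type*} [MeasurableSpace S] {P : Measure Ω}
    [IsProbabilityMeasure P] {μ : Measure S} [IsProbabilityMeasure μ] {E : S → Ω → ℝ}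
    (hE : Measurable fun p : S × Ω => E p.1 p.2) {C : ℝ}
    (hC : ∀ᵐ s ∂μ, ∫⁻ ω, ENNReal.ofReal (Real.exp (E s ω)) ∂P ≤ ENNReal.ofReal C) :
    ∀ᵐ ω ∂P, Integrable (fun s => Real.exp (E s ω)) μ := by
  have hE' : Measurable fun p : Ω × S => ENNReal.ofReal (Real.exp (E p.2 p.1)) :=
    (hE.comp measurable_swap).exp.ennreal_ofReal
  have hfin : ∫⁻ ω, ∫⁻ s, ENNReal.ofReal (Real.exp (E s ω)) ∂μ ∂P ≤ ENNReal.ofReal C := by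
    rw [lintegral_lintegral_swap (f := fun ω s => ENNReal.ofReal (Real.exp (E s ω)))
      hE'.aemeasurable]
    calc _ ≤ ∫⁻ _ : S, ENNReal.ofReal C ∂μ := lintegral_mono_ae hC
      _ = ENNReal.ofReal C := by simp
  filter_upwards [ae_lt_top hE'.lintegral_prod_right' (hfin.trans_lt ENNReal.ofReal_lt_top).ne]
    with ω hω
  refine ⟨(hE.comp measurable_prodMk_right).exp.aestronglyMeasurable, ?_⟩
  rw [hasFiniteIntegral_iff_ofReal (ae_of_all _ fun _ => (Real.exp_pos _).le)]
  exact hω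

variable {P : Measure Ω} {ξ : ℝ → ℝ} {M : ℕ} {HN : Config (M + 1) → Ω → ℝ}
  {HN' : Config M → Ω → ℝ} {z : Ω → ℝ}

theorem IsCavityDisorder.lintegral_exp_gaussian (hD : IsCavityDisorder P ξ M HN HN' z) (c : ℝ) :
    ∫⁻ ω, ENNReal.ofReal (Real.exp (c * z ω)) ∂P = ENNReal.ofReal (Real.exp (c ^ 2 / 2)) := by
  rw [lintegral_exp_mul_of_hasGaussianLaw hD.law.hasGaussianLaw hD.integral_gaussian,
    hD.integral_gaussian_mul_self, mul_one]

theorem IsHamiltonian.lintegral_exp_le {N : ℕ} (hN : 1 ≤ N) {H : Config N → Ω → ℝ}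
    (hH : IsHamiltonian P ξ N H) {K : ℝ} (hK : ξ 1 ≤ K) (c : ℝ) (σ : Config N) :
    ∫⁻ ω, ENNReal.ofReal (Real.exp (c * H σ ω)) ∂P
      ≤ ENNReal.ofReal (Real.exp (c ^ 2 * (N * K) / 2)) := by
  rw [lintegral_exp_mul_of_hasGaussianLaw (hH.gaussian.hasGaussianLaw_eval σ) (hH.centred σ),
    hH.covariance, overlap_self hN]
  gcongr

/-- The exponential moments of the interpolating Hamiltonian are bounded off the poles. -/
theorem IsCavityDisorder.exists_lintegral_exp_interpH_le (hD : IsCavityDisorder P ξ M HN HN' z)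
    (hM : 1 ≤ M) {β h q : ℝ} (hb : 0 ≤ bConst ξ β h q) {t : ℝ} (ht : t ∈ Set.Icc (0 : ℝ) 1) :
    ∃ C : ℝ, ∀ σ : Config (M + 1), 0 < scale σ →
      ∫⁻ ω, ENNReal.ofReal (Real.exp (interpH ξ β h q (HN · ω) (HN' · ω) (z ω) t σ)) ∂P
        ≤ ENNReal.ofReal C := by
  obtain ⟨ht0, ht1⟩ := ht
  set n : ℝ := ((M + 1 : ℕ) : ℝ)
  set s := Real.sqrt (deriv ξ q) with hs
  -- The factors 3 come from `exp_add_add_le`, and `D` bounds the deterministic part of the energy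
  -- once the quadratic term, nonpositive because b ≥ 0, is dropped.
  set c₁ := 3 * (Real.sqrt t * β)
  set c₂ := 3 * (Real.sqrt (1 - t) * β)
  set D := |h| * M + |h| * (1 + n) + |h| * (1 + n)
  refine ⟨Real.exp D * (Real.exp (c₁ ^ 2 * (n * |ξ 1|) / 2) + Real.exp (c₂ ^ 2 * (M * |ξ 1|) / 2)
    + Real.exp (c₂ ^ 2 * s ^ 2 * n / 2)), fun σ hσ => ?_⟩
  have hmem := hatVec_mem_sphere hM hσ
  have he := sq_lastSpin_le σ
  have hdrift : h * (∑ i, hatVec σ i) * (1 + t * (scale σ - 1)) + h * lastSpin σ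
      - 1 / 2 * (1 - t) * lastSpin σ ^ 2 * bConst ξ β h q ≤ D := by
    have h1 : |h * ∑ i, hatVec σ i| ≤ |h| * M := by
      rw [abs_mul]
      exact mul_le_mul_of_nonneg_left (abs_sum_hatVec_le hM hσ) (abs_nonneg _)
    have h2 : |t * (h * (∑ i, hatVec σ i) * (scale σ - 1))| ≤ |h| * (1 + n) := by
      have := abs_drift_le hM hσ h le_rfl
      rw [mul_zero, add_zero, add_zero] at this
      rw [abs_mul, abs_of_nonneg ht0]
      refine (mul_le_of_le_one_left (abs_nonneg _) ht1).trans (this.trans ?_)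
      exact mul_le_mul_of_nonneg_left (by linarith) (abs_nonneg _)
    have h3 : |h * lastSpin σ| ≤ |h| * (1 + n) := by
      rw [abs_mul]
      refine mul_le_mul_of_nonneg_left ?_ (abs_nonneg _)
      rw [abs_le]
      constructor <;> nlinarith [sq_nonneg (lastSpin σ - 1), sq_nonneg (lastSpin σ + 1)]
    have h4 : 0 ≤ 1 / 2 * (1 - t) * lastSpin σ ^ 2 * bConst ξ β h q :=
      mul_nonneg (mul_nonneg (by linarith) (sq_nonneg _)) hb
    have e : h * (∑ i, hatVec σ i) * (1 + t * (scale σ - 1))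
      = h * (∑ i, hatVec σ i) + t * (h * (∑ i, hatVec σ i) * (scale σ - 1)) := by ring
    rw [e]
    linarith [le_abs_self (h * ∑ i, hatVec σ i), le_abs_self (h * lastSpin σ),
      le_abs_self (t * (h * (∑ i, hatVec σ i) * (scale σ - 1)))]
  have hpt : ∀ ω, ENNReal.ofReal (Real.exp (interpH ξ β h q (HN · ω) (HN' · ω) (z ω) t σ))
      ≤ ENNReal.ofReal (Real.exp D) * (ENNReal.ofReal (Real.exp (c₁ * HN σ ω))
        + ENNReal.ofReal (Real.exp (c₂ * HN' ⟨hatVec σ, hmem⟩ ω))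
        + ENNReal.ofReal (Real.exp ((c₂ * s * lastSpin σ) * z ω))) := fun ω => by
    have hp := fun x => (Real.exp_pos x).le
    rw [← ENNReal.ofReal_add (hp _) (hp _), ← ENNReal.ofReal_add (add_nonneg (hp _) (hp _)) (hp _),
      ← ENNReal.ofReal_mul (hp _)]
    refine ENNReal.ofReal_le_ofReal ?_
    have h1 := exp_add_add_le (Real.sqrt t * β * HN σ ω)
      (Real.sqrt (1 - t) * β * HN' ⟨hatVec σ, hmem⟩ ω)
      (Real.sqrt (1 - t) * lastSpin σ * z ω * β * s)
    rw [interpH, atHat_eq hmem]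
    have e1 : c₁ * HN σ ω = 3 * (Real.sqrt t * β * HN σ ω) := by ring
    have e2 : c₂ * HN' ⟨hatVec σ, hmem⟩ ω
      = 3 * (Real.sqrt (1 - t) * β * HN' ⟨hatVec σ, hmem⟩ ω) := by ring
    have e3 : (c₂ * s * lastSpin σ) * z ω
      = 3 * (Real.sqrt (1 - t) * lastSpin σ * z ω * β * s) := by ring
    rw [e1, e2, e3]
    refine le_trans ?_ (mul_le_mul_of_nonneg_left h1 (hp D))
    rw [← Real.exp_add]
    refine Real.exp_le_exp.2 ?_
    linarith
  have hm1 : Measurable fun ω => ENNReal.ofReal (Real.exp (c₁ * HN σ ω)) :=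
    (((hD.big.measurable.comp measurable_prodMk_left).const_mul c₁).exp).ennreal_ofReal
  have hm2 : Measurable fun ω => ENNReal.ofReal (Real.exp (c₂ * HN' ⟨hatVec σ, hmem⟩ ω)) :=
    (((hD.small.measurable.comp measurable_prodMk_left).const_mul c₂).exp).ennreal_ofReal
  have hm12 : Measurable fun ω => ENNReal.ofReal (Real.exp (c₁ * HN σ ω))
      + ENNReal.ofReal (Real.exp (c₂ * HN' ⟨hatVec σ, hmem⟩ ω)) := hm1.add hm2
  have hp := fun x => (Real.exp_pos x).le
  refine (lintegral_mono hpt).trans ?_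
  rw [lintegral_const_mul' _ _ ENNReal.ofReal_ne_top, lintegral_add_left hm12,
    lintegral_add_left hm1, ENNReal.ofReal_mul (hp _),
    ENNReal.ofReal_add (add_nonneg (hp _) (hp _)) (hp _), ENNReal.ofReal_add (hp _) (hp _)]
  gcongr
  · exact hD.big.lintegral_exp_le (by omega) (le_abs_self _) _ _
  · exact hD.small.lintegral_exp_le hM (le_abs_self _) _ _
  · rw [hD.lintegral_exp_gaussian]
    refine ENNReal.ofReal_le_ofReal (Real.exp_le_exp.2 ?_)
    have : (c₂ * s * lastSpin σ) ^ 2 = c₂ ^ 2 * s ^ 2 * lastSpin σ ^ 2 := by ring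
    rw [this]
    gcongr

theorem IsCavityDisorder.ae_integrable_exp_interpH (hD : IsCavityDisorder P ξ M HN HN' z)
    (hM : 1 ≤ M) {β h q : ℝ} (hb : 0 ≤ bConst ξ β h q) {t : ℝ} (ht : t ∈ Set.Icc (0 : ℝ) 1) :
    ∀ᵐ ω ∂P, Integrable (fun σ => Real.exp
      (interpH ξ β h q (HN · ω) (HN' · ω) (z ω) t σ)) (unif (M + 1)) := by
  have : IsProbabilityMeasure P := hD.law.hasGaussianLaw.isProbabilityMeasure
  have : IsProbabilityMeasure (unif (M + 1)) := isProbabilityMeasure_unif (by omega)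
  obtain ⟨C, hC⟩ := hD.exists_lintegral_exp_interpH_le hM hb ht
  exact ae_integrable_exp_of_lintegral_le (hD.measurable_interpH β h q t)
    ((ae_scale_pos hM).mono hC)

end Integrability

end SphericalSK

/-! ### The decoupled system at `t = 0`. -/

namespace SphericalSK

section LastSpin

variable {M : ℕ}

theorem integrable_comp_lastSpin {φ : ℝ → ℝ} (hφ : Continuous φ) :
    Integrable (fun σ : Config (M + 1) => φ (lastSpin σ)) (unif (M + 1)) := by
  have : IsProbabilityMeasure (unif (M + 1)) := isProbabilityMeasure_unif (by omega)
  obtain ⟨C, hC⟩ := (isCompact_Icc (a := -((M + 1 : ℕ) : ℝ)) (b := ((M + 1 : ℕ) : ℝ))).exists_bound_of_continuousOn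
    hφ.continuousOn
  refine Integrable.of_bound (hφ.measurable.comp measurable_lastSpin).aestronglyMeasurable C
    (ae_of_all _ fun σ => hC _ ?_)
  have h := sq_lastSpin_le σ
  have h1 : (1 : ℝ) ≤ ((M + 1 : ℕ) : ℝ) := by push_cast; linarith [Nat.cast_nonneg (α := ℝ) M]
  exact abs_le_of_sq_le_sq' (by nlinarith) (by linarith)

theorem integral_comp_neg_lastSpin {φ : ℝ → ℝ} (hφ : Continuous φ) (h0 : ∀ x, 0 ≤ φ x) :
    ∫ σ : Config (M + 1), φ (-lastSpin σ) ∂unif (M + 1)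
      = ∫ σ : Config (M + 1), φ (lastSpin σ) ∂unif (M + 1) := by
  have h1 := integrable_comp_lastSpin (M := M) (φ := fun x => φ (-x)) (hφ.comp continuous_neg)
  rw [integral_eq_lintegral_of_nonneg_ae (ae_of_all _ fun σ => h0 _) h1.1,
    integral_eq_lintegral_of_nonneg_ae (ae_of_all _ fun σ => h0 _)
      (integrable_comp_lastSpin hφ).1]
  congr 1
  exact lintegral_neg_lastSpin hφ.measurable.ennreal_ofReal

/-- From x² ≤ 4 exp(x²/4) and the exponential moment bound 2. -/
theorem integral_sq_lastSpin_le :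
    ∫ σ : Config (M + 1), lastSpin σ ^ 2 ∂unif (M + 1) ≤ 8 := by
  have hi := integrable_comp_lastSpin (M := M) (φ := fun x => Real.exp (1 / 4 * x ^ 2))
    (by fun_prop)
  have h1 : ∫ σ : Config (M + 1), Real.exp (1 / 4 * lastSpin σ ^ 2) ∂unif (M + 1) ≤ 2 := by
    rw [integral_eq_lintegral_of_nonneg_ae (ae_of_all _ fun σ => (Real.exp_pos _).le) hi.1]
    refine ENNReal.toReal_le_of_le_ofReal (by norm_num) ?_
    simpa using lintegral_exp_sq_lastSpin (M := M)
  have h2 : ∫ σ : Config (M + 1), lastSpin σ ^ 2 ∂unif (M + 1)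
      ≤ ∫ σ : Config (M + 1), 4 * Real.exp (1 / 4 * lastSpin σ ^ 2) ∂unif (M + 1) :=
    integral_mono (integrable_comp_lastSpin (φ := fun x => x ^ 2) (by fun_prop)) (hi.const_mul 4)
      fun σ => by
        have := Real.add_one_le_exp (1 / 4 * lastSpin σ ^ 2)
        simp only
        linarith
  rw [integral_const_mul] at h2
  linarith

/-- Symmetrizing in ε replaces exp(cε) by cosh(cε) ≥ 1, whatever `c` is. Jensen's inequality, in the
form of the tangent bound for exp(-bε²/2) at ε² = 8, then uses that ε² has mean at most 8, whence
the exponent 4b. Since `c` will contain the Gaussian variable `z`, uniformity in `c` is essential.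
-/
theorem exp_le_integral_exp_lastSpin (c : ℝ) {b : ℝ} (hb : 0 ≤ b) :
    Real.exp (-(4 * b)) ≤ ∫ σ : Config (M + 1),
      Real.exp (c * lastSpin σ - 1 / 2 * lastSpin σ ^ 2 * b) ∂unif (M + 1) := by
  have : IsProbabilityMeasure (unif (M + 1)) := isProbabilityMeasure_unif (by omega)
  have hc : Continuous fun x : ℝ => Real.exp (c * x - 1 / 2 * x ^ 2 * b) := by fun_prop
  have hi := integrable_comp_lastSpin (M := M) hc
  have hi' : Integrable (fun σ : Config (M + 1) =>
      Real.exp (c * -lastSpin σ - 1 / 2 * (-lastSpin σ) ^ 2 * b)) (unif (M + 1)) :=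
    integrable_comp_lastSpin (M := M) (hc.comp continuous_neg)
  have hneg := integral_comp_neg_lastSpin (M := M) hc fun x => (Real.exp_pos _).le
  have hi2 : Integrable (fun σ : Config (M + 1) => lastSpin σ ^ 2) (unif (M + 1)) :=
    integrable_comp_lastSpin (φ := fun x => x ^ 2) (by fun_prop)
  have hi3 : Integrable (fun σ : Config (M + 1) => b * lastSpin σ ^ 2) (unif (M + 1)) :=
    hi2.const_mul b
  have hlow : ∫ σ : Config (M + 1), Real.exp (-(4 * b)) * (2 * (1 + 4 * b) - b * lastSpin σ ^ 2)
      ∂unif (M + 1) ≤ ∫ σ : Config (M + 1),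
        (Real.exp (c * lastSpin σ - 1 / 2 * lastSpin σ ^ 2 * b)
          + Real.exp (c * -lastSpin σ - 1 / 2 * (-lastSpin σ) ^ 2 * b)) ∂unif (M + 1) := by
    refine integral_mono (((integrable_const _).sub hi3).const_mul _) (hi.add hi') fun σ => ?_
    set x := lastSpin σ
    have h1 : Real.exp (c * x - 1 / 2 * x ^ 2 * b) + Real.exp (c * -x - 1 / 2 * (-x) ^ 2 * b)
        = Real.exp (-(1 / 2 * x ^ 2 * b)) * (Real.exp (c * x) + Real.exp (-(c * x))) := by
      rw [mul_add, ← Real.exp_add, ← Real.exp_add]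
      congr 2 <;> ring
    have h2 : 2 ≤ Real.exp (c * x) + Real.exp (-(c * x)) := by
      linarith [Real.one_le_cosh (c * x), Real.cosh_eq (c * x)]
    have h3 : Real.exp (-(1 / 2 * x ^ 2 * b))
        = Real.exp (-(4 * b)) * Real.exp (4 * b - 1 / 2 * x ^ 2 * b) := by
      rw [← Real.exp_add]; congr 1; ring
    have h4 := Real.add_one_le_exp (4 * b - 1 / 2 * x ^ 2 * b)
    simp only
    rw [h1, h3, mul_assoc]
    refine mul_le_mul_of_nonneg_left ?_ (Real.exp_pos _).le
    nlinarith [Real.exp_pos (4 * b - 1 / 2 * x ^ 2 * b)]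
  rw [integral_const_mul, integral_sub (integrable_const _) hi3,
    integral_const_mul b (fun σ : Config (M + 1) => lastSpin σ ^ 2), integral_add hi hi', hneg] at hlow
  simp only [integral_const, probReal_univ, one_smul] at hlow
  have h8 := mul_le_mul_of_nonneg_left (integral_sq_lastSpin_le (M := M)) hb
  have := mul_le_mul_of_nonneg_left (show (2 : ℝ) ≤ 2 * (1 + 4 * b)
    - b * ∫ σ : Config (M + 1), lastSpin σ ^ 2 ∂unif (M + 1) by linarith) (Real.exp_pos (-(4 * b))).le
  linarith

end LastSpin

/-- By independence the integral of exp V(X) factors out of numerator and denominator and cancels.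
Only an inequality is claimed, because that integral is 0 by convention when it diverges, and the
left side is then 0. -/
theorem gibbsAvg_add_le_of_indepFun {S α γ : Type*} [MeasurableSpace S] [MeasurableSpace α]
    [MeasurableSpace γ] {μ : Measure S} {X : S → α} {Y : S → γ} (hX : Measurable X)
    (hY : Measurable Y) (h : IndepFun X Y μ) {V : α → ℝ} (hV : Measurable V) {w g : γ → ℝ}
    (hw : Measurable w) (hg : Measurable g) (hg0 : ∀ y, 0 ≤ g y) :
    gibbsAvg μ (fun s => V (X s) + w (Y s)) (fun s => g (Y s))
      ≤ gibbsAvg μ (fun s => w (Y s)) (fun s => g (Y s)) := by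
  have hm : ∀ {u : γ → ℝ}, Measurable u →
      ∫ s, Real.exp (V (X s)) * u (Y s) ∂μ
        = (∫ s, Real.exp (V (X s)) ∂μ) * ∫ s, u (Y s) ∂μ := fun {u} hu =>
    (h.comp hV.exp hu).integral_fun_mul_eq_mul_integral
      (hV.exp.comp hX).aestronglyMeasurable (hu.comp hY).aestronglyMeasurable
  have e1 : ∀ s, g (Y s) * Real.exp (V (X s) + w (Y s))
      = Real.exp (V (X s)) * (g (Y s) * Real.exp (w (Y s))) := fun s => by
    rw [Real.exp_add]; ring
  rw [gibbsAvg]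
  simp only [e1]
  simp only [Real.exp_add]
  rw [hm (u := fun y => g y * Real.exp (w y)) (hg.mul hw.exp), hm hw.exp]
  rcases eq_or_ne (∫ s, Real.exp (V (X s)) ∂μ) 0 with h0 | h0
  · rw [h0, zero_mul, zero_div]
    exact gibbsAvg_nonneg fun s => hg0 _
  · rw [mul_div_mul_left _ _ h0]
    rfl

section Decoupled

variable {Ω : Type*} [mΩ : MeasurableSpace Ω] {P : Measure Ω} {ξ : ℝ → ℝ} {M : ℕ}
  {HN : Config (M + 1) → Ω → ℝ} {HN' : Config M → Ω → ℝ} {z : Ω → ℝ}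

/-- At `t = 0` the last spin decouples from the others. -/
theorem IsCavityDisorder.gibbsAvg_interpH_zero_le (hD : IsCavityDisorder P ξ M HN HN' z)
    (hM : 1 ≤ M) (β h q a : ℝ) (hb : 0 ≤ bConst ξ β h q) (ω : Ω) :
    gibbsAvg (unif (M + 1)) (interpH ξ β h q (HN · ω) (HN' · ω) (z ω) 0)
        (fun σ => Real.exp (a * lastSpin σ ^ 2))
      ≤ Real.exp (4 * bConst ξ β h q) * ∫ σ : Config (M + 1),
        Real.exp (a * lastSpin σ ^ 2 + ((h + z ω * β * Real.sqrt (deriv ξ q)) * lastSpin σ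
          - 1 / 2 * lastSpin σ ^ 2 * bConst ξ β h q)) ∂unif (M + 1) := by
  set b := bConst ξ β h q
  set c := h + z ω * β * Real.sqrt (deriv ξ q)
  obtain ⟨V, hV, hVe⟩ := exists_measurable_atHat hD.small.measurable
  have hV' : Measurable fun u : EuclideanSpace ℝ (Fin M) => β * V (u, ω) + h * ∑ i, u i := by
    have h1 : Measurable fun u : EuclideanSpace ℝ (Fin M) => V (u, ω) :=
      hV.comp measurable_prodMk_right
    have h2 : Measurable fun u : EuclideanSpace ℝ (Fin M) => ∑ i, u i := by fun_prop
    exact (h1.const_mul β).add (h2.const_mul h)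
  have hw : Measurable fun x : ℝ => c * x - 1 / 2 * x ^ 2 * b := by fun_prop
  have hg : Measurable fun x : ℝ => Real.exp (a * x ^ 2) := by fun_prop
  have key := gibbsAvg_add_le_of_indepFun measurable_hatVec measurable_lastSpin
    (indepFun_hatVec_lastSpin hM) hV' hw hg fun x => (Real.exp_pos _).le
  have e : interpH ξ β h q (HN · ω) (HN' · ω) (z ω) 0 = fun σ =>
      (β * V (hatVec σ, ω) + h * ∑ i, hatVec σ i)
        + (c * lastSpin σ - 1 / 2 * lastSpin σ ^ 2 * b) := by
    funext σ
    rw [interpH, hVe, Real.sqrt_zero, sub_zero, Real.sqrt_one]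
    ring
  rw [e]
  refine key.trans ?_
  -- The lower bound for the denominator is deterministic, so no negative moment of a random
  -- partition function is needed.
  have hden := exp_le_integral_exp_lastSpin (M := M) c hb
  rw [gibbsAvg, div_le_iff₀ ((Real.exp_pos _).trans_le hden)]
  simp only [← Real.exp_add]
  have hnum : 0 ≤ ∫ σ : Config (M + 1), Real.exp (a * lastSpin σ ^ 2
    + (c * lastSpin σ - 1 / 2 * lastSpin σ ^ 2 * b)) ∂unif (M + 1) :=
    integral_nonneg fun σ => (Real.exp_pos _).le
  have h1 := mul_le_mul_of_nonneg_left hden (Real.exp_pos (4 * b)).le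
  rw [← Real.exp_add, add_neg_cancel, Real.exp_zero] at h1
  calc _ ≤ _ := le_mul_of_one_le_left hnum h1
    _ = _ := by ring

/-- Integrating over `z` before ε turns the random linear term into at most β²Kε²/2, and hε ≤ |h|(1
+ ε²). Dropping the term in `b` leaves a total exponent of at most |h| + ε²/4, to which
`lintegral_exp_sq_lastSpin` applies. -/
theorem IsCavityDisorder.lintegral_decoupled_le (hD : IsCavityDisorder P ξ M HN HN' z)
    {β h q a b K : ℝ} (hb : 0 ≤ b) (hK : Real.sqrt (deriv ξ q) ^ 2 ≤ K)
    (ha : a + β ^ 2 * K / 2 + |h| ≤ 1 / 4) :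
    ∫⁻ ω, ∫⁻ σ : Config (M + 1), ENNReal.ofReal (Real.exp (a * lastSpin σ ^ 2
      + ((h + z ω * β * Real.sqrt (deriv ξ q)) * lastSpin σ - 1 / 2 * lastSpin σ ^ 2 * b)))
        ∂unif (M + 1) ∂P ≤ ENNReal.ofReal (2 * Real.exp |h|) := by
  have : IsProbabilityMeasure P := hD.law.hasGaussianLaw.isProbabilityMeasure
  have : IsProbabilityMeasure (unif (M + 1)) := isProbabilityMeasure_unif (by omega)
  set s := Real.sqrt (deriv ξ q)
  have hm : Measurable fun p : Ω × Config (M + 1) => ENNReal.ofReal (Real.exp (a * lastSpin p.2 ^ 2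
      + ((h + z p.1 * β * s) * lastSpin p.2 - 1 / 2 * lastSpin p.2 ^ 2 * b))) := by
    have h1 : Measurable fun p : Ω × Config (M + 1) => lastSpin p.2 :=
      measurable_lastSpin.comp measurable_snd
    have h2 : Measurable fun p : Ω × Config (M + 1) => z p.1 := hD.measurable.comp measurable_fst
    exact ((((h1.pow_const 2).const_mul a).add (((((h2.mul_const β).mul_const s).const_add h).mul
      h1).sub (((h1.pow_const 2).const_mul (1 / 2)).mul_const b))).exp).ennreal_ofReal
  rw [lintegral_lintegral_swap (f := fun ω σ => ENNReal.ofReal (Real.exp (a * lastSpin σ ^ 2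
      + ((h + z ω * β * s) * lastSpin σ - 1 / 2 * lastSpin σ ^ 2 * b)))) hm.aemeasurable]
  have hpt : ∀ σ : Config (M + 1), ∫⁻ ω, ENNReal.ofReal (Real.exp (a * lastSpin σ ^ 2
      + ((h + z ω * β * s) * lastSpin σ - 1 / 2 * lastSpin σ ^ 2 * b))) ∂P
      ≤ ENNReal.ofReal (Real.exp |h|) * ENNReal.ofReal (Real.exp (1 / 4 * lastSpin σ ^ 2)) := by
    intro σ
    set x := lastSpin σ
    have e : ∀ ω, ENNReal.ofReal (Real.exp (a * x ^ 2
        + ((h + z ω * β * s) * x - 1 / 2 * x ^ 2 * b)))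
        = ENNReal.ofReal (Real.exp (a * x ^ 2 + (h * x - 1 / 2 * x ^ 2 * b)))
          * ENNReal.ofReal (Real.exp ((β * s * x) * z ω)) := fun ω => by
      rw [← ENNReal.ofReal_mul (Real.exp_pos _).le, ← Real.exp_add]
      congr 2; ring
    simp only [e]
    rw [lintegral_const_mul' _ _ ENNReal.ofReal_ne_top, hD.lintegral_exp_gaussian,
      ← ENNReal.ofReal_mul (Real.exp_pos _).le, ← ENNReal.ofReal_mul (Real.exp_pos _).le,
      ← Real.exp_add, ← Real.exp_add]
    refine ENNReal.ofReal_le_ofReal (Real.exp_le_exp.2 ?_)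
    have h1 : h * x ≤ |h| * (1 + x ^ 2) := by
      refine (le_abs_self _).trans ?_
      rw [abs_mul]
      refine mul_le_mul_of_nonneg_left ?_ (abs_nonneg _)
      rw [abs_le]
      constructor <;> nlinarith [sq_nonneg (x - 1), sq_nonneg (x + 1)]
    have h2 : (β * s * x) ^ 2 / 2 ≤ β ^ 2 * K / 2 * x ^ 2 := by
      have := mul_le_mul_of_nonneg_left hK (show 0 ≤ β ^ 2 * x ^ 2 / 2 by positivity)
      nlinarith
    have h3 : 0 ≤ 1 / 2 * x ^ 2 * b := by positivity
    have h4 := mul_le_mul_of_nonneg_right ha (sq_nonneg x)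
    nlinarith
  refine (lintegral_mono hpt).trans ?_
  rw [lintegral_const_mul' _ _ ENNReal.ofReal_ne_top, mul_comm (2 : ℝ),
    ENNReal.ofReal_mul (Real.exp_pos _).le]
  gcongr
  simpa using lintegral_exp_sq_lastSpin (M := M)

theorem IsCavityDisorder.integral_gibbsAvg_interpH_zero_le (hD : IsCavityDisorder P ξ M HN HN' z)
    (hM : 1 ≤ M) {β h q a K : ℝ} (hb : 0 ≤ bConst ξ β h q) (hK : Real.sqrt (deriv ξ q) ^ 2 ≤ K)
    (ha : a + β ^ 2 * K / 2 + |h| ≤ 1 / 4) :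
    ∫ ω, gibbsAvg (unif (M + 1)) (interpH ξ β h q (HN · ω) (HN' · ω) (z ω) 0)
        (fun σ => Real.exp (a * lastSpin σ ^ 2)) ∂P
      ≤ Real.exp (4 * bConst ξ β h q) * (2 * Real.exp |h|) := by
  have : IsProbabilityMeasure (unif (M + 1)) := isProbabilityMeasure_unif (by omega)
  have hf : Measurable fun σ : Config (M + 1) => Real.exp (a * lastSpin σ ^ 2) :=
    ((measurable_lastSpin.pow_const 2).const_mul a).exp
  have hm := measurable_gibbsAvg (μ := unif (M + 1))
    (E := fun σ ω => interpH ξ β h q (HN · ω) (HN' · ω) (z ω) 0 σ) (hD.measurable_interpH β h q 0) hf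
  rw [integral_eq_lintegral_of_nonneg_ae
    (ae_of_all _ fun ω => gibbsAvg_nonneg fun σ => (Real.exp_pos _).le) hm.aestronglyMeasurable]
  refine ENNReal.toReal_le_of_le_ofReal (by positivity) ?_
  rw [ENNReal.ofReal_mul (Real.exp_pos _).le]
  refine le_trans ?_ (mul_le_mul_right (hD.lintegral_decoupled_le (M := M) hb hK ha) _)
  rw [← lintegral_const_mul' _ _ ENNReal.ofReal_ne_top]
  refine lintegral_mono fun ω => ?_
  refine (ENNReal.ofReal_le_ofReal (hD.gibbsAvg_interpH_zero_le hM β h q a hb ω)).trans ?_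
  rw [ENNReal.ofReal_mul (Real.exp_pos _).le]
  gcongr
  refine (ofReal_integral_eq_lintegral_ofReal ?_ (ae_of_all _ fun _ => (Real.exp_pos _).le)).le
  exact integrable_comp_lastSpin (φ := fun x => Real.exp (a * x ^ 2
    + ((h + z ω * β * Real.sqrt (deriv ξ q)) * x - 1 / 2 * x ^ 2 * bConst ξ β h q))) (by fun_prop)

end Decoupled

end SphericalSK

/-! ### Conclusion: assembling the estimates and choosing the constants. -/

namespace SphericalSK

section Main

variable {Ω : Type*} [mΩ : MeasurableSpace Ω] {P : Measure Ω} {ξ : ℝ → ℝ} {M : ℕ}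
  {HN : Config (M + 1) → Ω → ℝ} {HN' : Config M → Ω → ℝ} {z : Ω → ℝ}

theorem measurable_exp_mul_sq_lastSpin (c : ℝ) :
    Measurable fun σ : Config (M + 1) => Real.exp (c * lastSpin σ ^ 2) :=
  ((measurable_lastSpin.pow_const 2).const_mul c).exp

theorem abs_exp_mul_sq_lastSpin_le {c a : ℝ} (hca : c ≤ a) (ha : 0 ≤ a) (σ : Config (M + 1)) :
    |Real.exp (c * lastSpin σ ^ 2)| ≤ Real.exp (a * (M + 1 : ℕ)) := by
  rw [Real.abs_exp]
  refine Real.exp_le_exp.2 ((mul_le_mul_of_nonneg_right hca (sq_nonneg _)).trans ?_)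
  exact mul_le_mul_of_nonneg_left (sq_lastSpin_le σ) ha

/-- Along the interpolation the exponential moment of the last spin, with an exponent decreasing
in `t`, grows at most by a constant factor. -/
theorem IsCavityDisorder.integral_gibbsAvg_interpH_le (hD : IsCavityDisorder P ξ M HN HN' z)
    (hM : 1 ≤ M) {K : ℝ} (hK : ∀ x ∈ Set.Icc (-1 : ℝ) 1, |ξ x| ≤ K)
    (hL : ∀ x ∈ Set.Icc (-1 : ℝ) 1, ∀ y ∈ Set.Icc (-1 : ℝ) 1, |ξ x - ξ y| ≤ K * |x - y|)
    {β h q a κ : ℝ} (hq : |deriv ξ q| ≤ K) (hb : 0 ≤ bConst ξ β h q)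
    (hκ : κ = 2 * (|h| + bConst ξ β h q) + 6 * (β ^ 2 * (2 * K))) (ha : κ ≤ a) {t : ℝ}
    (ht : t ∈ Set.Icc (0 : ℝ) 1) :
    ∫ ω, gibbsAvg (unif (M + 1)) (interpH ξ β h q (HN · ω) (HN' · ω) (z ω) t)
        (fun σ => Real.exp ((a - κ * t) * lastSpin σ ^ 2)) ∂P
      ≤ Real.exp κ * ∫ ω, gibbsAvg (unif (M + 1)) (interpH ξ β h q (HN · ω) (HN' · ω) (z ω) 0)
        (fun σ => Real.exp (a * lastSpin σ ^ 2)) ∂P := by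
  have : IsProbabilityMeasure P := hD.law.hasGaussianLaw.isProbabilityMeasure
  have : IsProbabilityMeasure (unif (M + 1)) := isProbabilityMeasure_unif (by omega)
  have hκ0 : 0 ≤ κ := by
    have : 0 ≤ K := (abs_nonneg _).trans hq
    rw [hκ]; positivity
  have ha0 : 0 ≤ a := hκ0.trans ha
  exact integral_gibbsAvg_le_of_avg
    (E := fun σ ω => interpH ξ β h q (HN · ω) (HN' · ω) (z ω) t σ)
    (E' := fun σ ω => interpH ξ β h q (HN · ω) (HN' · ω) (z ω) 0 σ)
    (hD.measurable_interpH β h q t) (hD.measurable_interpH β h q 0)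
    (hD.ae_integrable_exp_interpH hM hb ht)
    (hD.ae_integrable_exp_interpH hM hb ⟨le_rfl, zero_le_one⟩)
    (measurable_exp_mul_sq_lastSpin _) (measurable_exp_mul_sq_lastSpin _)
    (abs_exp_mul_sq_lastSpin_le (sub_le_self _ (mul_nonneg hκ0 ht.1)) ha0)
    (abs_exp_mul_sq_lastSpin_le le_rfl ha0) (ae_scale_pos hM)
    fun n x hx => hD.integral_avg_interpH_le hM hK hL hq hb hκ ha ht x hx

/-- The exponential moment of the squared last spin is bounded uniformly along the interpolation. -/
theorem IsCavityDisorder.integral_gibbs_exp_sq_lastSpin_le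
    (hD : IsCavityDisorder P ξ M HN HN' z) (hM : 1 ≤ M) {K : ℝ}
    (hK : ∀ x ∈ Set.Icc (-1 : ℝ) 1, |ξ x| ≤ K)
    (hL : ∀ x ∈ Set.Icc (-1 : ℝ) 1, ∀ y ∈ Set.Icc (-1 : ℝ) 1, |ξ x - ξ y| ≤ K * |x - y|)
    {β h q : ℝ} (hq : |deriv ξ q| ≤ K) (hb : 0 ≤ bConst ξ β h q)
    (hsmall : 2 * (|h| + bConst ξ β h q) + 6 * (β ^ 2 * (2 * K)) ≤ 1 / 16)
    {L : ℝ} (hL16 : 16 ≤ L) {t : ℝ} (ht : t ∈ Set.Icc (0 : ℝ) 1) :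
    Integrable (fun ω => gibbs (interpH ξ β h q (HN · ω) (HN' · ω) (z ω) t)
      (fun σ => Real.exp (lastSpin σ ^ 2 / L))) P ∧
    ∫ ω, gibbs (interpH ξ β h q (HN · ω) (HN' · ω) (z ω) t)
      (fun σ => Real.exp (lastSpin σ ^ 2 / L)) ∂P ≤ 16 := by
  have : IsProbabilityMeasure P := hD.law.hasGaussianLaw.isProbabilityMeasure
  have : IsProbabilityMeasure (unif (M + 1)) := isProbabilityMeasure_unif (by omega)
  have hK0 : 0 ≤ K := (abs_nonneg _).trans hq
  have hβK : 0 ≤ β ^ 2 * K := by positivity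
  have hh : 0 ≤ |h| := abs_nonneg h
  set κ := 2 * (|h| + bConst ξ β h q) + 6 * (β ^ 2 * (2 * K)) with hκ
  have hκ0 : 0 ≤ κ := by positivity
  have hκt : κ * t ≤ 1 / 16 := (mul_le_of_le_one_right hκ0 ht.2).trans hsmall
  have hκt0 : 0 ≤ κ * t := mul_nonneg hκ0 ht.1
  clear_value κ
  -- The initial exponent is a = 1/8, small enough for the bound at `t = 0`. Since κ ≤ 1/16, the
  -- exponent at time `t` is still at least 1/16.
  have hLc : L⁻¹ ≤ 1 / 8 - κ * t := by
    have : L⁻¹ ≤ 1 / 16 := by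
      rw [inv_le_comm₀ (by linarith) (by norm_num)]; norm_num; exact hL16
    linarith
  have hgi : ∀ c ≤ (1 / 8 : ℝ), Integrable (fun ω => gibbsAvg (unif (M + 1))
      (interpH ξ β h q (HN · ω) (HN' · ω) (z ω) t) (fun σ => Real.exp (c * lastSpin σ ^ 2))) P :=
    fun c hc => Integrable.of_bound (measurable_gibbsAvg (μ := unif (M + 1))
      (E := fun σ ω => interpH ξ β h q (HN · ω) (HN' · ω) (z ω) t σ)
      (hD.measurable_interpH β h q t) (measurable_exp_mul_sq_lastSpin c)).aestronglyMeasurable _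
      (ae_of_all _ fun ω => abs_gibbsAvg_le (Real.exp_pos _).le
        (abs_exp_mul_sq_lastSpin_le hc (by norm_num)))
  simp only [gibbs_eq_gibbsAvg, div_eq_inv_mul _ L]
  refine ⟨hgi _ (by linarith), ?_⟩
  calc _ ≤ ∫ ω, gibbsAvg (unif (M + 1)) (interpH ξ β h q (HN · ω) (HN' · ω) (z ω) t)
        (fun σ => Real.exp ((1 / 8 - κ * t) * lastSpin σ ^ 2)) ∂P := by
        refine integral_mono_ae (hgi _ (by linarith)) (hgi _ (by linarith)) ?_
        filter_upwards [hD.ae_integrable_exp_interpH hM hb ht] with ω hω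
        exact gibbsAvg_mono hω (measurable_exp_mul_sq_lastSpin _)
          (abs_exp_mul_sq_lastSpin_le (a := 1 / 8) (by linarith) (by norm_num))
          (measurable_exp_mul_sq_lastSpin _)
          (abs_exp_mul_sq_lastSpin_le (by linarith) (by norm_num))
          fun σ => Real.exp_le_exp.2 (mul_le_mul_of_nonneg_right hLc (sq_nonneg _))
    _ ≤ Real.exp κ * ∫ ω, gibbsAvg (unif (M + 1))
        (interpH ξ β h q (HN · ω) (HN' · ω) (z ω) 0)
        (fun σ => Real.exp (1 / 8 * lastSpin σ ^ 2)) ∂P :=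
        hD.integral_gibbsAvg_interpH_le hM hK hL hq hb hκ (by linarith) ht
    _ ≤ Real.exp κ * (Real.exp (4 * bConst ξ β h q) * (2 * Real.exp |h|)) :=
        mul_le_mul_of_nonneg_left (hD.integral_gibbsAvg_interpH_zero_le hM hb
          ((le_abs_self _).trans (sqrt_deriv_sq_le hq)) (by linarith)) (Real.exp_pos _).le
    _ = 2 * Real.exp (κ + 4 * bConst ξ β h q + |h|) := by
        rw [Real.exp_add (κ + _), Real.exp_add κ]; ring
    _ ≤ 2 * Real.exp 1 := by
        gcongr
        linarith
    _ ≤ 16 := by linarith [Real.exp_one_lt_d9]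

/-- The constant is (1 - q)(h² + β²ξ'(q)), and the equation for `q` makes the second factor
nonnegative whatever the sign of ξ'(q). -/
theorem bConst_mem {β h q K : ℝ} (hq0 : 0 ≤ q) (hq1 : q < 1) (hK : deriv ξ q ≤ K)
    (hq : h ^ 2 + β ^ 2 * deriv ξ q = q / (1 - q) ^ 2) :
    0 ≤ bConst ξ β h q ∧ bConst ξ β h q ≤ h ^ 2 + β ^ 2 * K := by
  have h1 : bConst ξ β h q = (1 - q) * (h ^ 2 + β ^ 2 * deriv ξ q) := by rw [bConst]; ring
  have h2 : 0 ≤ h ^ 2 + β ^ 2 * deriv ξ q := by rw [hq]; positivity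
  rw [h1]
  refine ⟨mul_nonneg (by linarith) h2, ?_⟩
  have h3 := mul_le_mul_of_nonneg_left hK (sq_nonneg β)
  have h4 := mul_nonneg hq0 h2
  linarith

end Main

end SphericalSK

open SphericalSK in
theorem mainTheorem4 (ξ : ℝ → ℝ) (hξ : ContDiffOn ℝ 3 ξ (Set.Icc (-1) 1)) :
    ∃ β₀ > (0 : ℝ), ∃ h₀ > (0 : ℝ),
      ∀ β h q : ℝ, 0 < β → β < β₀ → h ≠ 0 → |h| < h₀ →
        0 ≤ q → q < 1 → h ^ 2 + β ^ 2 * deriv ξ q = q / (1 - q) ^ 2 →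
        ∃ L > (0 : ℝ), ∀ M : ℕ, 1 ≤ M →
          ∀ (Ω : Type*) (mΩ : MeasurableSpace Ω) (P : Measure Ω), IsProbabilityMeasure P →
          ∀ (HN : Config (M + 1) → Ω → ℝ) (HN' : Config M → Ω → ℝ) (z : Ω → ℝ),
            IsHamiltonian P ξ (M + 1) HN → IsHamiltonian P ξ M HN' →
            HasLaw z (gaussianReal 0 1) P →
            IndepFun (fun ω σ => HN σ ω) (fun ω σ => HN' σ ω) P →
            IndepFun (fun ω => ((fun σ => HN σ ω), (fun σ => HN' σ ω))) z P →
            ∀ t ∈ Set.Icc (0 : ℝ) 1,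
              (∀ᵐ ω ∂P, Integrable (fun σ => Real.exp
                (interpH ξ β h q (HN · ω) (HN' · ω) (z ω) t σ)) (unif (M + 1))) ∧
              Integrable (fun ω => gibbs (interpH ξ β h q (HN · ω) (HN' · ω) (z ω) t)
                (fun σ => Real.exp (lastSpin σ ^ 2 / L))) P ∧
              ∫ ω, gibbs (interpH ξ β h q (HN · ω) (HN' · ω) (z ω) t)
                (fun σ => Real.exp (lastSpin σ ^ 2 / L)) ∂P ≤ L := by
  obtain ⟨K, hK0, hK, hL, hK'⟩ := exists_bound_covariance hξ
  -- These thresholds give β²K ≤ 1/1600 and, with b ≤ h² + β²K, the bound κ ≤ 2|h| + 2h² + 14β²K ≤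
  -- 1/16. The value L = 16 serves both as inverse exponent and as bound.
  refine ⟨1 / (40 * (K + 1)), by positivity, 1 / 100, by norm_num,
    fun β h q hβ hβ₀ _ hh hq0 hq1 hq => ⟨16, by norm_num, ?_⟩⟩
  intro M hM Ω mΩ P _ HN HN' z hH hH' hz hi hi' t ht
  have hd := hK' q hq0 hq1
  obtain ⟨hb0, hb⟩ := bConst_mem hq0 hq1 ((le_abs_self _).trans hd) hq
  have hβK : β ^ 2 * K ≤ 1 / 1600 := by
    rw [lt_div_iff₀ (by positivity)] at hβ₀
    have h1 : (β * (K + 1)) * (β * (K + 1)) ≤ 1 / 40 * (1 / 40) :=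
      mul_le_mul (by linarith) (by linarith) (by positivity) (by norm_num)
    have h2 : β ^ 2 * K ≤ β ^ 2 * (K + 1) ^ 2 :=
      mul_le_mul_of_nonneg_left (by nlinarith) (sq_nonneg β)
    nlinarith
  have hh2 : h ^ 2 ≤ |h| * (1 / 100) := by
    rw [← sq_abs, pow_two]; exact mul_le_mul_of_nonneg_left hh.le (abs_nonneg h)
  have hsmall : 2 * (|h| + bConst ξ β h q) + 6 * (β ^ 2 * (2 * K)) ≤ 1 / 16 := by linarith
  -- The law of `z` only provides almost everywhere measurability, so `z` is replaced by a
  -- measurable version and the conclusions are transferred back almost surely.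
  have hae : z =ᵐ[P] hz.aemeasurable.mk z := hz.aemeasurable.ae_eq_mk
  have hD : IsCavityDisorder P ξ M HN HN' (hz.aemeasurable.mk z) :=
    ⟨hH, hH', hz.aemeasurable.measurable_mk, hz.congr hae.symm, hi,
      hi'.congr (ae_eq_refl _) hae⟩
  obtain ⟨h1, h2⟩ := hD.integral_gibbs_exp_sq_lastSpin_le hM hK hL hd hb0 hsmall le_rfl ht
  have hg : (fun ω => gibbs (interpH ξ β h q (HN · ω) (HN' · ω) (z ω) t)
      (fun σ => Real.exp (lastSpin σ ^ 2 / 16))) =ᵐ[P]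
      fun ω => gibbs (interpH ξ β h q (HN · ω) (HN' · ω) (hz.aemeasurable.mk z ω) t)
      (fun σ => Real.exp (lastSpin σ ^ 2 / 16)) := by
    filter_upwards [hae] with ω hω
    rw [hω]
  refine ⟨?_, h1.congr hg.symm, (integral_congr_ae hg).trans_le h2⟩
  filter_upwards [hae, hD.ae_integrable_exp_interpH hM hb0 ht] with ω hω hint
  rw [hω]
  exact hint
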